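/- **Lemma (Elementary symmetric fusion of the dilute $A_L$ model).** *Setting.* Let $L\ge 3$, let $p$ be real with $|p|<1$, and let $\lambda=\frac{\pi}{4}\frac{L}{L+1}$ or $\lambda=\frac{\pi}{4}\frac{L+2}{L+1}$. Heights are the integers $1,\dots,L$. Let $\vartheta_1,\vartheta_4$ be the standard theta functions of nome $p$, $$\vartheta_1(u)=2\sum_{n\ge0}(-1)^np^{(n+1/2)^2}\sin((2n+1)u),\qquad \vartheta_4(u)=1+2\sum_{n\ge1}(-1)^np^{n^2}\cos(2nu)$$ (every expression below is homogeneous of degree $0$ in $\vartheta_1$, so the factor $2p^{1/4}$ of $\vartheta_1$ cancels; at $p=0$ it is omitted, so that $\vartheta_1(u)=\sin u$ there). Put $S_a=(-1)^a\vartheta_1(4a\lambda)/\vartheta_4(2a\lambda)$; the ratios $S_a/S_b$, $1\le a,b\le L$, are positive. Square roots are principal. *Elementary weights.* $W(a,b,c,d|u)$ (corners: $a$ lower left, $b$ lower right, $c$ upper right, $d$ upper left) vanishes unless $|a-b|,|b-c|,|c-d|,|d-a|\le1$, and otherwise $$W(a,a,a,a|u)=\tfrac{\vartheta_1(6\lambda-u)\vartheta_1(3\lambda+u)}{\vartheta_1(6\lambda)\vartheta_1(3\lambda)}-\Bigl(\tfrac{S_{a+1}}{S_a}\tfrac{\vartheta_4(2a\lambda-5\lambda)}{\vartheta_4(2a\lambda+\lambda)}+\tfrac{S_{a-1}}{S_a}\tfrac{\vartheta_4(2a\lambda+5\lambda)}{\vartheta_4(2a\lambda-\lambda)}\Bigr)\tfrac{\vartheta_1(u)\vartheta_1(3\lambda-u)}{\vartheta_1(6\lambda)\vartheta_1(3\lambda)},$$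 $$W(a,a,a,a\pm1|u)=W(a,a\pm1,a,a|u)=\tfrac{\vartheta_1(3\lambda-u)\vartheta_4(\pm2a\lambda+\lambda-u)}{\vartheta_1(3\lambda)\vartheta_4(\pm2a\lambda+\lambda)},$$ $$W(a\pm1,a,a,a|u)=W(a,a,a\pm1,a|u)=\Bigl(\tfrac{S_{a\pm1}}{S_a}\Bigr)^{1/2}\tfrac{\vartheta_1(u)\vartheta_4(\pm2a\lambda-2\lambda+u)}{\vartheta_1(3\lambda)\vartheta_4(\pm2a\lambda+\lambda)},$$ $$W(a,a\pm1,a\pm1,a|u)=W(a,a,a\pm1,a\pm1|u)=\Bigl(\tfrac{\vartheta_4(\pm2a\lambda+3\lambda)\vartheta_4(\pm2a\lambda-\lambda)}{\vartheta_4(\pm2a\lambda+\lambda)^2}\Bigr)^{1/2}\tfrac{\vartheta_1(u)\vartheta_1(3\lambda-u)}{\vartheta_1(2\lambda)\vartheta_1(3\lambda)},$$ $$W(a,a\mp1,a,a\pm1|u)=\tfrac{\vartheta_1(2\lambda-u)\vartheta_1(3\lambda-u)}{\vartheta_1(2\lambda)\vartheta_1(3\lambda)},\qquad W(a\pm1,a,a\mp1,a|u)=-\Bigl(\tfrac{S_{a-1}S_{a+1}}{S_a^2}\Bigr)^{1/2}\tfrac{\vartheta_1(u)\vartheta_1(\lambda-u)}{\vartheta_1(2\lambda)\vartheta_1(3\lambda)},$$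 $$W(a\pm1,a,a\pm1,a|u)=\tfrac{\vartheta_1(3\lambda-u)\vartheta_1(\pm4a\lambda+2\lambda+u)}{\vartheta_1(3\lambda)\vartheta_1(\pm4a\lambda+2\lambda)}+\tfrac{S_{a\pm1}}{S_a}\tfrac{\vartheta_1(u)\vartheta_1(\pm4a\lambda-\lambda+u)}{\vartheta_1(3\lambda)\vartheta_1(\pm4a\lambda+2\lambda)},$$ where, if $\vartheta_1(\pm4a\lambda+2\lambda)=0$, the last expression is replaced by its other form $$\tfrac{\vartheta_1(3\lambda+u)\vartheta_1(\pm4a\lambda-4\lambda+u)}{\vartheta_1(3\lambda)\vartheta_1(\pm4a\lambda-4\lambda)}+\Bigl(\tfrac{S_{a\mp1}}{S_a}\tfrac{\vartheta_1(4\lambda)}{\vartheta_1(2\lambda)}-\tfrac{\vartheta_4(\pm2a\lambda-5\lambda)}{\vartheta_4(\pm2a\lambda+\lambda)}\Bigr)\tfrac{\vartheta_1(u)\vartheta_1(\pm4a\lambda-\lambda+u)}{\vartheta_1(3\lambda)\vartheta_1(\pm4a\lambda-4\lambda)}.$$ *Paths and coefficients.* A triple $(a,a',b)$ of heights is a path if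 $|a-a'|\le1$ and $|a'-b|\le1$. The independent paths from $a$ to $b$ are the paths with $a'\ne\min(a,b)$; write them $(a,a'_\alpha,b)$, $\alpha=1,2,\dots$, where for $a=b$ the path through $a+1$ (if present) precedes the one through $a-1$. Let $A^{(1,0)}_{a,b}=1$ if $|a-b|\le1$ and $0$ otherwise, and $A^{(2,0)}=(A^{(1,0)})^2-A^{(1,0)}$. Let $\langle a\rangle=\sum_bA^{(1,0)}_{a,b}$ and $S(a,b)=\sqrt{S_a}\,\vartheta_4(2b\lambda+(b-a)\lambda)$. For a path $(a,a',b)$ set $$\phi_{(2,0)}(a,a',b|\alpha)=\begin{cases}\delta_{\alpha,1}&|a-b|=2,\\ \Bigl(-\sqrt{\tfrac{\vartheta_4(2a'_\alpha\lambda+\lambda)}{\vartheta_4(2a'_\alpha\lambda-3\lambda)}}\Bigr)^{a'_\alpha-a'}\delta_{\alpha,1}&|a-b|=1,\\ \Bigl(-\tfrac{\vartheta_1(\lambda)}{\vartheta_1(2\lambda)}\tfrac{S(a'_\alpha,a)}{S(a,a)}\Bigr)^{\delta_{a,a'}}\delta_{\alpha,1}&a=b,\ \langle a\rangle=2,\\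 \Bigl(-\tfrac{\vartheta_1(\lambda)}{\vartheta_1(2\lambda)}\tfrac{S(a'_\alpha,a)}{S(a,a)}\Bigr)^{\delta_{a,a'}}&a=b,\ \langle a\rangle=3,\ |a'_\alpha-a'|<2,\\0&\text{otherwise,}\end{cases}$$ and $\phi_{(2,0)}(a,a',b|\alpha)=0$ if $(a,a',b)$ is not a path. *Fused weights.* For $1\le\alpha\le A^{(2,0)}_{a,b}$ and $1\le\beta\le A^{(2,0)}_{d,c}$, with $c'_\beta$ the middle height of the $\beta$-th independent path from $d$ to $c$, define $$W_{(2,0)}(a,b,c,d;\alpha,\beta|u)=\sum_{a'=1}^{L}\phi_{(2,0)}(a,a',b|\alpha)\,W(a,a',c'_\beta,d|u)\,W(a',b,c,c'_\beta|u+2\lambda).$$ *Claim.* 1. The number of independent paths from $a$ to $b$ is $A^{(2,0)}_{a,b}$, for all heights $a,b$. 2. (Yang–Baxter equation.) For all heights $a,b,c,d,e,f$, all $1\le\alpha\le A^{(2,0)}_{a,b}$, $1\le\gamma\le A^{(2,0)}_{e,d}$ and all $u,v\in\mathbb C$, $$\sum_{g=1}^{L}\sum_{\beta=1}^{A^{(2,0)}_{f,g}}W_{(2,0)}(a,b,g,f;\alpha,\beta|u)\,W_{(2,0)}(f,g,d,e;\beta,\gamma|v)\,W(g,b,c,d|v-u)$$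 $$=\sum_{g=1}^{L}\sum_{\beta=1}^{A^{(2,0)}_{g,c}}W(f,a,g,e|v-u)\,W_{(2,0)}(a,b,c,g;\alpha,\beta|v)\,W_{(2,0)}(g,c,d,e;\beta,\gamma|u).$$ 3. For all heights $a,b,c,d$ and all admissible $\alpha,\beta$: $W_{(2,0)}(a,b,c,d;\alpha,\beta|0)=W_{(2,0)}(a,b,c,d;\alpha,\beta|\lambda)=0$. -/

import Mathlib

/-!
The dilute `A_L` lattice model: elliptic face weights, independent two-step paths and the
`1 × 2` face weights of fusion level `(2,0)`. Heights are the integers `1, …, L`. -/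

namespace DiluteA

noncomputable section

/-- The constant prefactor `2 p^{1/4}` of `ϑ₁`. All weights below are homogeneous of degree zero
in `ϑ₁`, so its value does not matter as long as it is nonzero; at `p = 0` (criticality), where
`ϑ₁` would vanish identically, it is replaced by `1`, which gives the limit `p → 0` of all
weights. -/
def theta1Prefactor (p : ℝ) : ℂ :=
  if p = 0 then 1 else 2 * (p : ℂ) ^ (1 / 4 : ℂ)

/-- `ϑ₁(u) = 2 ∑_{n ≥ 0} (-1)^n p^{(n+1/2)^2} sin ((2n+1)u)`. -/
def theta1 (p : ℝ) (u : ℂ) : ℂ :=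
  theta1Prefactor p *
    ∑' n : ℕ, (-1 : ℂ) ^ n * (p : ℂ) ^ (n * (n + 1)) * Complex.sin ((2 * (n : ℂ) + 1) * u)

/-- `ϑ₄(u) = 1 + 2 ∑_{n ≥ 1} (-1)^n p^{n^2} cos (2nu)`. -/
def theta4 (p : ℝ) (u : ℂ) : ℂ :=
  1 + 2 * ∑' n : ℕ, (-1 : ℂ) ^ (n + 1) * (p : ℂ) ^ ((n + 1) ^ 2) *
    Complex.cos (2 * ((n : ℂ) + 1) * u)

/-- The principal square root. -/
def csqrt (z : ℂ) : ℂ := z ^ (1 / 2 : ℂ)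

/-- The crossing factors `S_a = (-1)^a ϑ₁(4aλ) / ϑ₄(2aλ)`. -/
def crossing (p lam : ℝ) (a : ℤ) : ℂ :=
  (-1 : ℂ) ^ a * theta1 p (4 * a * lam) / theta4 p (2 * a * lam)

/-- The weight with all four heights equal to `a`. -/
def weightFlat (p lam : ℝ) (a : ℤ) (u : ℂ) : ℂ :=
  theta1 p (6 * lam - u) * theta1 p (3 * lam + u) / (theta1 p (6 * lam) * theta1 p (3 * lam))
    - (crossing p lam (a + 1) / crossing p lam a
          * (theta4 p (2 * a * lam - 5 * lam) / theta4 p (2 * a * lam + lam))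
        + crossing p lam (a - 1) / crossing p lam a
          * (theta4 p (2 * a * lam + 5 * lam) / theta4 p (2 * a * lam - lam)))
      * (theta1 p u * theta1 p (3 * lam - u) / (theta1 p (6 * lam) * theta1 p (3 * lam)))

/-- The weight `W(a, a, a, a+s) = W(a, a+s, a, a)`, where `s = ±1`. -/
def weightSide (p lam : ℝ) (a s : ℤ) (u : ℂ) : ℂ :=
  theta1 p (3 * lam - u) * theta4 p (s * 2 * a * lam + lam - u)
    / (theta1 p (3 * lam) * theta4 p (s * 2 * a * lam + lam))

/-- The weight `W(a+s, a, a, a) = W(a, a, a+s, a)`, where `s = ±1`. -/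
def weightTip (p lam : ℝ) (a s : ℤ) (u : ℂ) : ℂ :=
  csqrt (crossing p lam (a + s) / crossing p lam a)
    * (theta1 p u * theta4 p (s * 2 * a * lam - 2 * lam + u)
      / (theta1 p (3 * lam) * theta4 p (s * 2 * a * lam + lam)))

/-- The weight `W(a, a+s, a+s, a) = W(a, a, a+s, a+s)`, where `s = ±1`. -/
def weightStep (p lam : ℝ) (a s : ℤ) (u : ℂ) : ℂ :=
  csqrt (theta4 p (s * 2 * a * lam + 3 * lam) * theta4 p (s * 2 * a * lam - lam)
      / theta4 p (s * 2 * a * lam + lam) ^ 2)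
    * (theta1 p u * theta1 p (3 * lam - u) / (theta1 p (2 * lam) * theta1 p (3 * lam)))

/-- The weight `W(a, a∓1, a, a±1)`. -/
def weightStraight (p lam : ℝ) (u : ℂ) : ℂ :=
  theta1 p (2 * lam - u) * theta1 p (3 * lam - u) / (theta1 p (2 * lam) * theta1 p (3 * lam))

/-- The weight `W(a±1, a, a∓1, a)`. -/
def weightCross (p lam : ℝ) (a : ℤ) (u : ℂ) : ℂ :=
  -csqrt (crossing p lam (a - 1) * crossing p lam (a + 1) / crossing p lam a ^ 2)
    * (theta1 p u * theta1 p (lam - u) / (theta1 p (2 * lam) * theta1 p (3 * lam)))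

/-- The weight `W(a+s, a, a+s, a)`, where `s = ±1`. It has two expressions, which agree wherever
both are defined; the second one is used where the first one has a vanishing denominator. -/
def weightAlternate (p lam : ℝ) (a s : ℤ) (u : ℂ) : ℂ :=
  if theta1 p (s * 4 * a * lam + 2 * lam) ≠ 0 then
    theta1 p (3 * lam - u) * theta1 p (s * 4 * a * lam + 2 * lam + u)
        / (theta1 p (3 * lam) * theta1 p (s * 4 * a * lam + 2 * lam))
      + crossing p lam (a + s) / crossing p lam a
        * (theta1 p u * theta1 p (s * 4 * a * lam - lam + u)
          / (theta1 p (3 * lam) * theta1 p (s * 4 * a * lam + 2 * lam)))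
  else
    theta1 p (3 * lam + u) * theta1 p (s * 4 * a * lam - 4 * lam + u)
        / (theta1 p (3 * lam) * theta1 p (s * 4 * a * lam - 4 * lam))
      + (crossing p lam (a - s) / crossing p lam a * (theta1 p (4 * lam) / theta1 p (2 * lam))
          - theta4 p (s * 2 * a * lam - 5 * lam) / theta4 p (s * 2 * a * lam + lam))
        * (theta1 p u * theta1 p (s * 4 * a * lam - lam + u)
          / (theta1 p (3 * lam) * theta1 p (s * 4 * a * lam - 4 * lam)))

/-- The elementary face weight `W(a, b, c, d | u)`; the corners are `a` (lower left), `b` (lower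
right), `c` (upper right), `d` (upper left). Adjacent corners differ by at most one, otherwise the
weight is zero. -/
def faceWeight (p lam : ℝ) (a b c d : ℤ) (u : ℂ) : ℂ :=
  if |a - b| ≤ 1 ∧ |b - c| ≤ 1 ∧ |c - d| ≤ 1 ∧ |d - a| ≤ 1 then
    if a = b ∧ b = c ∧ c = d then weightFlat p lam a u
    else if a = b ∧ b = c then weightSide p lam a (d - a) u
    else if c = d ∧ d = a then weightSide p lam a (b - a) u
    else if b = c ∧ c = d then weightTip p lam b (a - b) u
    else if d = a ∧ a = b then weightTip p lam a (c - a) u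
    else if (d = a ∧ b = c) ∨ (a = b ∧ c = d) then weightStep p lam a (c - a) u
    else if a = c ∧ b ≠ d then weightStraight p lam u
    else if b = d ∧ a ≠ c then weightCross p lam b u
    else weightAlternate p lam b (a - b) u
  else 0

/-- The heights `1, …, L`. -/
def heights (L : ℕ) : Finset ℤ := Finset.Icc 1 (L : ℤ)

/-- The effective adjacency matrix `A^{(1,0)} = I + A` of the dilute `A_L` model. -/
def effAdj (a b : ℤ) : ℤ := if |a - b| ≤ 1 then 1 else 0

/-- The entries of the fused adjacency matrix `A^{(2,0)}`, which is fixed by the `su(3)` fusion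
rule `A^{(1,0)} A^{(1,0)} = A^{(2,0)} + A^{(0,1)}` with `A^{(0,1)} = A^{(1,0)} = I + A`. -/
def fusedAdj20 (L : ℕ) (a b : ℤ) : ℕ :=
  ((∑ g ∈ heights L, effAdj a g * effAdj g b) - effAdj a b).toNat

/-- The number of allowed neighbours of the height `a`, including `a` itself. -/
def valence (L : ℕ) (a : ℤ) : ℤ := ∑ b ∈ heights L, effAdj a b

/-- `(a, x, b)` is an allowed two-step path. -/
def IsPath (L : ℕ) (a x b : ℤ) : Prop :=
  a ∈ heights L ∧ x ∈ heights L ∧ b ∈ heights L ∧ |a - x| ≤ 1 ∧ |x - b| ≤ 1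

open Classical in
/-- The list of the middle heights `x` of the independent paths `(a, x, b)` of level `(2,0)`, i.e.
of the allowed two-step paths with `x ≠ min a b`. For `a = b` the path through `a + 1` comes before
the path through `a - 1`. -/
def indPath20 (L : ℕ) (a b : ℤ) : List ℤ :=
  [a + 1, a, a - 1].filter fun x => IsPath L a x b ∧ x ≠ min a b

/-- The middle height `a'_α` of the independent path from `a` to `b` with label `α = 1, 2, …`. -/
def indMid20 (L : ℕ) (a b : ℤ) (α : ℕ) : ℤ := (indPath20 L a b).getD (α - 1) 0

/-- `S(a, b) = √(S_a) ϑ₄(2bλ + (b-a)λ)`. -/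
def crossing2 (p lam : ℝ) (a b : ℤ) : ℂ :=
  csqrt (crossing p lam a) * theta4 p (2 * b * lam + (b - a) * lam)

open Classical in
/-- The coefficients `φ_{(2,0)}(a, x, b | α)`. -/
def phi20 (L : ℕ) (p lam : ℝ) (a x b : ℤ) (α : ℕ) : ℂ :=
  let y : ℤ := indMid20 L a b α
  let δ : ℂ := if α = 1 then 1 else 0
  let k : ℂ := -(theta1 p lam / theta1 p (2 * lam)
    * (crossing2 p lam y a / crossing2 p lam a a))
  if ¬ IsPath L a x b then 0
  else if |a - b| = 2 then δ
  else if |a - b| = 1 then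
    (-csqrt (theta4 p (2 * y * lam + lam) / theta4 p (2 * y * lam - 3 * lam))) ^ (y - x) * δ
  else if a = b ∧ valence L a = 2 then (if a = x then k else 1) * δ
  else if a = b ∧ valence L a = 3 ∧ |y - x| < 2 then (if a = x then k else 1)
  else 0

/-- The `1 × 2` fused face weight `W_{(2,0)}(a, b, c, d; α, β | u)` with bond variable `α` on the
lower edge `(a, b)` and `β` on the upper edge `(d, c)`. -/
def fusedWeight20 (L : ℕ) (p lam : ℝ) (a b c d : ℤ) (α β : ℕ) (u : ℂ) : ℂ :=
  ∑ x ∈ heights L, phi20 L p lam a x b α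
    * faceWeight p lam a x (indMid20 L d c β) d u
    * faceWeight p lam x b c (indMid20 L d c β) (u + 2 * lam)

end

end DiluteA

/-!
# Fusion of the dilute `A_L` model at level `(2,0)`

All weights are products and sums of theta functions, and every identity between them is proved by
counting zeros. An entire function which behaves like a product of `n` theta functions under the
periods `π` and `πτ` (`IsTheta`) and vanishes at `n` inequivalent points is, by Liouville's theorem,
a multiple of the product of theta functions with these zeros (`exists_eq_zeroProd`). Hence it is
zero if it vanishes at one point more (`IsThetaSum.eq_zero_of_extra_zero`), or if the given zeros
have a sum different from the one fixed by its multipliers (`IsThetaSum.eq_zero_of_sum_ne`). The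
input is that the zeros of `ϑ₁` are exactly the lattice points and simple (`thetaOdd_zeros`), which
is read off from its product expansion.

The weights are freed from their square roots by positive roots of `S_a` and `ϑ₄((2a+1)λ)`, see
`IsGauge`. In this form they reduce to the identity at `u = 0` (`faceWeight_zero`), have the
crossing symmetry `u ↦ 3λ - u` (`faceWeight_three_sub`), satisfy an inversion relation
(`faceWeight_inversion`), and factor into the weights of two triangles at `u = λ`
(`faceWeight_one`).

The difference of the two sides of the elementary Yang–Baxter equation is a theta function of degree
four in `v` and also in `u`. The identity at zero, inversion and crossing give its zeros `v = 0`,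
`u`, `3λ`, `u + 3λ`, and `u = 0`, `v`, `3λ`, `v - 3λ`. At `u = λ` the point `v = 2λ` is a further
zero, since there both sides are products of the same six triangles (`ybeDefect_one_two`). So the
equation holds at `u = λ`, which is the missing fifth zero in `u` (`faceWeight_yang_baxter`).

At `u = 2λ` the weights form, by the factorization and crossing, a matrix of rank one. Its range on
the paths from `a` to `b` is spanned by a vector (`fusionVector`) which the coefficients `φ`
annihilate (`sum_phi20_mul_fusionVector`). By the Yang–Baxter equation the two-row weights then
annihilate the corresponding vector on the upper edge (`sum_halfFused_mul_fusionVector`), so that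
they are determined by their values on the independent paths (`sum_phi20_mul_indMid20`). Therefore
the sum over the bond variables is a sum over all middle heights, and the fused Yang–Baxter equation
follows from two elementary ones. At `u = 0` and `u = λ` one of the two rows of a fused weight is
trivial up to crossing and the other one has rank one, which gives zero.

All this is for `p ≠ 0`. The weights are continuous in the nome at `p = 0`, which settles the
remaining case.
-/

namespace DiluteA

open Complex

/-! ### Theta series -/

/-- The series of `ϑ₁` without its constant prefactor. Unlike `theta1` it is continuous in the nome
at `p = 0`, where it equals `sin`. -/
noncomputable def thetaOdd (p : ℝ) (u : ℂ) : ℂ :=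
  ∑' n : ℕ, (-1 : ℂ) ^ n * (p : ℂ) ^ (n * (n + 1)) * sin ((2 * (n : ℂ) + 1) * u)

lemma theta1_eq (p : ℝ) (u : ℂ) : theta1 p u = theta1Prefactor p * thetaOdd p u := rfl

lemma theta1Prefactor_ne_zero (p : ℝ) : theta1Prefactor p ≠ 0 := by
  unfold theta1Prefactor
  split_ifs with h
  · exact one_ne_zero
  · simp [cpow_eq_zero_iff, h]

lemma thetaOdd_neg (p : ℝ) (u : ℂ) : thetaOdd p (-u) = -thetaOdd p u := by
  simp only [thetaOdd, mul_neg, sin_neg, tsum_neg]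

lemma theta4_neg (p : ℝ) (u : ℂ) : theta4 p (-u) = theta4 p u := by
  simp only [theta4, mul_neg, cos_neg]

lemma thetaOdd_zero (p : ℝ) : thetaOdd p 0 = 0 := by simp [thetaOdd]

lemma thetaOdd_add_pi (p : ℝ) (u : ℂ) : thetaOdd p (u + Real.pi) = -thetaOdd p u := by
  simp only [thetaOdd, ← tsum_neg]
  refine tsum_congr fun n ↦ ?_
  have : (2 * (n : ℂ) + 1) * (u + Real.pi)
      = (2 * (n : ℂ) + 1) * u + Real.pi + n * (2 * Real.pi) := by ring
  rw [this, sin_add_nat_mul_two_pi, sin_add_pi]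
  ring

lemma theta4_add_pi (p : ℝ) (u : ℂ) : theta4 p (u + Real.pi) = theta4 p u := by
  simp only [theta4]
  congr 2
  refine tsum_congr fun n ↦ ?_
  have : 2 * ((n : ℂ) + 1) * (u + Real.pi)
      = 2 * ((n : ℂ) + 1) * u + (n + 1 : ℕ) * (2 * Real.pi) := by push_cast; ring
  rw [this, cos_add_nat_mul_two_pi]

lemma thetaOdd_nome_zero (u : ℂ) : thetaOdd 0 u = sin u := by
  rw [thetaOdd, tsum_eq_single 0]
  · simp
  · intro n hn
    simp [hn]

lemma theta4_nome_zero (u : ℂ) : theta4 0 u = 1 := by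
  simp [theta4]

/-- `t` is half of the quasi-period of theta functions of nome `p ≠ 0`. -/
structure IsHalfPeriod (p : ℝ) (t : ℂ) : Prop where
  exp_eq : exp (2 * I * t) = p
  im_pos : 0 < t.im

lemma exists_isHalfPeriod {p : ℝ} (hp : |p| < 1) (hp0 : p ≠ 0) : ∃ t, IsHalfPeriod p t := by
  have h0 : (p : ℂ) ≠ 0 := by exact_mod_cast hp0
  refine ⟨log p / (2 * I), ?_, ?_⟩
  · rw [mul_div_cancel₀ _ (by simp), exp_log h0]
  · have : log (p : ℂ) / (2 * I) = -(I * log p) / 2 := by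
      field_simp
      rw [I_sq]; ring
    rw [this]
    have h1 : (log (p : ℂ)).re < 0 := by
      rw [log_re, norm_real]
      exact Real.log_neg (abs_pos.mpr hp0) hp
    have h2 : (-(I * log (p : ℂ)) / 2).im = -(log (p : ℂ)).re / 2 := by
      rw [show (2 : ℂ) = ((2 : ℝ) : ℂ) by norm_num, div_ofReal_im]
      simp
    rw [h2]; linarith

namespace IsHalfPeriod

variable {p : ℝ} {t : ℂ}

lemma ne_zero (ht : IsHalfPeriod p t) : p ≠ 0 := by
  rintro rfl
  exact exp_ne_zero _ ht.exp_eq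

lemma im_tau (ht : IsHalfPeriod p t) : 0 < (2 * t / Real.pi).im := by
  rw [div_ofReal_im]
  have : (2 * t).im = 2 * t.im := by simp
  rw [this]
  have := ht.im_pos
  positivity

lemma norm_lt_one (ht : IsHalfPeriod p t) : |p| < 1 := by
  have := congrArg (‖·‖) ht.exp_eq
  simp only [norm_exp, norm_real, Real.norm_eq_abs] at this
  rw [← this, Real.exp_lt_one_iff]
  have := ht.im_pos
  simp
  exact this

lemma term_eq (ht : IsHalfPeriod p t) (n : ℤ) (u : ℂ) :
    jacobiTheta₂_term n (u / Real.pi + 1 / 2) (2 * t / Real.pi)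
      = (-1 : ℂ) ^ n * (p : ℂ) ^ (n ^ 2) * exp (2 * I * n * u) := by
  have hpi : (Real.pi : ℂ) ≠ 0 := by exact_mod_cast Real.pi_ne_zero
  rw [jacobiTheta₂_term, ← ht.exp_eq, ← exp_int_mul, ← exp_pi_mul_I, ← exp_int_mul, ← exp_add,
    ← exp_add]
  congr 1
  push_cast
  field_simp
  ring

lemma theta4_eq (ht : IsHalfPeriod p t) (u : ℂ) :
    theta4 p u = jacobiTheta₂ (u / Real.pi + 1 / 2) (2 * t / Real.pi) := by
  have h := (hasSum_jacobiTheta₂_term (u / Real.pi + 1 / 2) ht.im_tau).nat_add_neg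
  simp only [ht.term_eq] at h
  have h2 := (hasSum_nat_add_iff' 1).mpr h
  have h3 : ∀ n : ℕ, (-1 : ℂ) ^ ((n + 1 : ℕ) : ℤ) * (p : ℂ) ^ (((n + 1 : ℕ) : ℤ) ^ 2)
        * exp (2 * I * (((n + 1 : ℕ) : ℤ) : ℂ) * u)
      + (-1 : ℂ) ^ (-((n + 1 : ℕ) : ℤ)) * (p : ℂ) ^ ((-((n + 1 : ℕ) : ℤ)) ^ 2)
        * exp (2 * I * ((-((n + 1 : ℕ) : ℤ) : ℤ) : ℂ) * u)
      = 2 * ((-1 : ℂ) ^ (n + 1) * (p : ℂ) ^ ((n + 1) ^ 2) * cos (2 * ((n : ℂ) + 1) * u)) := by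
    intro n
    have e1 : (-1 : ℂ) ^ (-((n + 1 : ℕ) : ℤ)) = (-1 : ℂ) ^ (n + 1) := by
      rw [zpow_neg, zpow_natCast, ← inv_pow]; norm_num
    have e2 : (p : ℂ) ^ ((-((n + 1 : ℕ) : ℤ)) ^ 2) = (p : ℂ) ^ ((n + 1) ^ 2) := by
      rw [neg_sq, ← zpow_natCast]; norm_cast
    have e3 : (p : ℂ) ^ ((((n + 1 : ℕ) : ℤ)) ^ 2) = (p : ℂ) ^ ((n + 1) ^ 2) := by
      rw [← zpow_natCast]; norm_cast
    rw [e1, e2, e3, zpow_natCast, cos]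
    push_cast
    rw [show 2 * I * ((n : ℂ) + 1) * u = 2 * ((n : ℂ) + 1) * u * I by ring,
      show 2 * I * -((n : ℂ) + 1) * u = -(2 * ((n : ℂ) + 1) * u) * I by ring]
    ring
  simp only [h3] at h2
  have h4 := h2.tsum_eq
  rw [tsum_mul_left] at h4
  rw [theta4, h4]
  simp

lemma thetaOdd_eq (ht : IsHalfPeriod p t) (u : ℂ) :
    thetaOdd p u = exp (I * u) / (2 * I) * theta4 p (u + t) := by
  have h := (hasSum_jacobiTheta₂_term ((u + t) / Real.pi + 1 / 2) ht.im_tau).nat_add_neg_add_one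
  rw [← ht.theta4_eq] at h
  simp only [ht.term_eq] at h
  have h2 := h.mul_left (exp (I * u) / (2 * I))
  rw [thetaOdd, ← h2.tsum_eq]
  refine tsum_congr fun n ↦ ?_
  have hp0 : (p : ℂ) ≠ 0 := by exact_mod_cast ht.ne_zero
  have e0 : ∀ m : ℤ, exp (2 * I * m * (u + t)) = (p : ℂ) ^ m * exp (2 * I * m * u) := by
    intro m
    rw [← ht.exp_eq, ← exp_int_mul, ← exp_add]
    congr 1; ring
  have e1 : (-1 : ℂ) ^ (-((n : ℤ) + 1)) = -(-1 : ℂ) ^ n := by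
    rw [zpow_neg, ← inv_zpow, inv_neg, inv_one, zpow_add_one₀ (by norm_num), zpow_natCast]; ring
  have e2 : (p : ℂ) ^ ((n : ℤ) ^ 2) * (p : ℂ) ^ (n : ℤ) = (p : ℂ) ^ (n * (n + 1)) := by
    rw [← zpow_add₀ hp0, ← zpow_natCast]
    congr 1; push_cast; ring
  have e3 : (p : ℂ) ^ ((-((n : ℤ) + 1)) ^ 2) * (p : ℂ) ^ (-((n : ℤ) + 1))
      = (p : ℂ) ^ (n * (n + 1)) := by
    rw [← zpow_add₀ hp0, ← zpow_natCast]
    congr 1; push_cast; ring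
  have e4 : exp (I * u) * exp (2 * I * ((n : ℤ) : ℂ) * u) = exp ((2 * n + 1) * u * I) := by
    rw [← exp_add]; congr 1; push_cast; ring
  have e5 : exp (I * u) * exp (2 * I * ((-((n : ℤ) + 1) : ℤ) : ℂ) * u)
      = exp (-((2 * n + 1) * u) * I) := by
    rw [← exp_add]; congr 1; push_cast; ring
  rw [e0, e0, e1, sin, ← e4, ← e5, zpow_natCast]
  have hI : (I : ℂ) ≠ 0 := I_ne_zero
  have : I ^ 2 = -1 := I_sq
  calc _ = (-1 : ℂ) ^ n * (p : ℂ) ^ (n * (n + 1)) * ((exp (I * u)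
          * exp (2 * I * ((n : ℤ) : ℂ) * u)
          - exp (I * u) * exp (2 * I * ((-((n : ℤ) + 1) : ℤ) : ℂ) * u)) / (2 * I)) := by
        field_simp
        rw [this]; ring
    _ = exp (I * u) / (2 * I) * ((-1 : ℂ) ^ n * ((p : ℂ) ^ (n * (n + 1))
          * exp (2 * I * ((n : ℤ) : ℂ) * u)) + -(-1 : ℂ) ^ n * ((p : ℂ) ^ (n * (n + 1))
          * exp (2 * I * ((-((n : ℤ) + 1) : ℤ) : ℂ) * u))) := by ring
    _ = _ := by
      nth_rewrite 1 [← e2]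
      rw [← e3]
      ring

lemma theta4_differentiable (ht : IsHalfPeriod p t) : Differentiable ℂ (theta4 p) := by
  have : theta4 p = fun u ↦ jacobiTheta₂ (u / Real.pi + 1 / 2) (2 * t / Real.pi) :=
    funext ht.theta4_eq
  rw [this]
  intro u
  exact (differentiableAt_jacobiTheta₂_fst _ ht.im_tau).comp u
    (f := fun u : ℂ ↦ u / Real.pi + 1 / 2) (by fun_prop)

lemma thetaOdd_differentiable (ht : IsHalfPeriod p t) : Differentiable ℂ (thetaOdd p) := by
  have : thetaOdd p = fun u ↦ exp (I * u) / (2 * I) * theta4 p (u + t) :=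
    funext ht.thetaOdd_eq
  rw [this]
  have := ht.theta4_differentiable
  fun_prop

lemma theta4_add_two (ht : IsHalfPeriod p t) (u : ℂ) :
    theta4 p (u + 2 * t) = -(p : ℂ)⁻¹ * exp (-(2 * I * u)) * theta4 p u := by
  have hpi : (Real.pi : ℂ) ≠ 0 := by exact_mod_cast Real.pi_ne_zero
  rw [ht.theta4_eq, ht.theta4_eq, show (u + 2 * t) / Real.pi + 1 / 2
    = (u / Real.pi + 1 / 2) + 2 * t / Real.pi by ring, jacobiTheta₂_add_left']
  congr 1
  have : -Real.pi * I * (2 * t / Real.pi + 2 * (u / Real.pi + 1 / 2))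
      = -(2 * I * t) + -(2 * I * u) - Real.pi * I := by
    field_simp
    ring
  rw [this, exp_sub, exp_pi_mul_I, exp_add, ← ht.exp_eq, ← exp_neg]
  ring

lemma thetaOdd_add_two (ht : IsHalfPeriod p t) (u : ℂ) :
    thetaOdd p (u + 2 * t) = -(p : ℂ)⁻¹ * exp (-(2 * I * u)) * thetaOdd p u := by
  rw [ht.thetaOdd_eq, ht.thetaOdd_eq, show u + 2 * t + t = (u + t) + 2 * t by ring,
    ht.theta4_add_two, show I * (u + 2 * t) = I * u + 2 * I * t by ring, exp_add,
    show -(2 * I * (u + t)) = -(2 * I * u) + -(2 * I * t) by ring, exp_add, exp_neg (2 * I * t)]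
  have := exp_ne_zero (2 * I * t)
  field_simp

end IsHalfPeriod

/-! ### Quasi-periodic entire functions -/

/-- Theta functions of degree `n`: entire functions which are multiplied by the constant `ε` under
`u ↦ u + π` and by `c e^{-2inu}` under `u ↦ u + 2t`. -/
structure IsTheta (t : ℂ) (n : ℕ) (ε c : ℂ) (F : ℂ → ℂ) : Prop where
  differentiable : Differentiable ℂ F
  add_pi : ∀ u, F (u + Real.pi) = ε * F u
  add_two : ∀ u, F (u + 2 * t) = c * exp (-(2 * n * I * u)) * F u

namespace IsTheta

variable {p : ℝ} {t : ℂ} {n m : ℕ} {ε ε' c c' : ℂ} {F G : ℂ → ℂ}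

lemma congr (hF : IsTheta t n ε c F) (h : ∀ u, F u = G u) : IsTheta t n ε c G :=
  (funext h : F = G) ▸ hF

lemma of_eq (hF : IsTheta t n ε c F) (hn : n = m) (hε : ε = ε') (hc : c = c') :
    IsTheta t m ε' c' F := by
  subst hn hε hc; exact hF

lemma thetaOdd (ht : IsHalfPeriod p t) : IsTheta t 1 (-1) (-(p : ℂ)⁻¹) (DiluteA.thetaOdd p) where
  differentiable := ht.thetaOdd_differentiable
  add_pi u := by rw [thetaOdd_add_pi]; ring
  add_two u := by rw [ht.thetaOdd_add_two]; simp

lemma theta4 (ht : IsHalfPeriod p t) : IsTheta t 1 1 (-(p : ℂ)⁻¹) (DiluteA.theta4 p) where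
  differentiable := ht.theta4_differentiable
  add_pi u := by rw [theta4_add_pi]; ring
  add_two u := by rw [ht.theta4_add_two]; simp

lemma add (hF : IsTheta t n ε c F) (hG : IsTheta t n ε c G) :
    IsTheta t n ε c (fun u ↦ F u + G u) where
  differentiable := hF.differentiable.add hG.differentiable
  add_pi u := by rw [hF.add_pi, hG.add_pi]; ring
  add_two u := by rw [hF.add_two, hG.add_two]; ring

lemma const_mul (hF : IsTheta t n ε c F) (k : ℂ) : IsTheta t n ε c (fun u ↦ k * F u) where
  differentiable := hF.differentiable.const_mul k
  add_pi u := by rw [hF.add_pi]; ring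
  add_two u := by rw [hF.add_two]; ring

lemma neg (hF : IsTheta t n ε c F) : IsTheta t n ε c (fun u ↦ -F u) :=
  (hF.const_mul (-1)).congr fun u ↦ by ring

lemma sub (hF : IsTheta t n ε c F) (hG : IsTheta t n ε c G) :
    IsTheta t n ε c (fun u ↦ F u - G u) :=
  (hF.add hG.neg).congr fun u ↦ by ring

lemma zero : IsTheta t n ε c (fun _ ↦ 0) where
  differentiable := by fun_prop
  add_pi u := by simp
  add_two u := by simp

lemma sum {ι : Type*} (s : Finset ι) {f : ι → ℂ → ℂ} (hf : ∀ i ∈ s, IsTheta t n ε c (f i)) :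
    IsTheta t n ε c (fun u ↦ ∑ i ∈ s, f i u) where
  differentiable := by
    have := fun i hi ↦ (hf i hi).differentiable
    exact Differentiable.fun_sum this
  add_pi u := by
    rw [Finset.mul_sum]
    exact Finset.sum_congr rfl fun i hi ↦ (hf i hi).add_pi u
  add_two u := by
    rw [Finset.mul_sum]
    exact Finset.sum_congr rfl fun i hi ↦ (hf i hi).add_two u

lemma mul (hF : IsTheta t n ε c F) (hG : IsTheta t m ε' c' G) :
    IsTheta t (n + m) (ε * ε') (c * c') (fun u ↦ F u * G u) where
  differentiable := hF.differentiable.mul hG.differentiable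
  add_pi u := by rw [hF.add_pi, hG.add_pi]; ring
  add_two u := by
    rw [hF.add_two, hG.add_two]
    have : exp (-(2 * (n + m : ℕ) * I * u)) = exp (-(2 * n * I * u)) * exp (-(2 * m * I * u)) := by
      rw [← exp_add]; congr 1; push_cast; ring
    rw [this]
    ring

/-- The translate `u ↦ F (u - z)`. -/
lemma comp_sub (hF : IsTheta t n ε c F) (z : ℂ) :
    IsTheta t n ε (c * exp (2 * n * I * z)) (fun u ↦ F (u - z)) where
  differentiable := hF.differentiable.comp (by fun_prop)
  add_pi u := by rw [← hF.add_pi]; congr 1; ring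
  add_two u := by
    rw [show u + 2 * t - z = (u - z) + 2 * t by ring, hF.add_two,
      show -(2 * n * I * (u - z)) = 2 * n * I * z + -(2 * n * I * u) by ring, exp_add]
    ring

lemma comp_add (hF : IsTheta t n ε c F) (z : ℂ) :
    IsTheta t n ε (c * exp (-(2 * n * I * z))) (fun u ↦ F (u + z)) := by
  have := hF.comp_sub (-z)
  simpa only [sub_neg_eq_add, mul_neg] using this

/-- The reflection `u ↦ F (-u)`. -/
lemma comp_neg (ht : IsHalfPeriod p t) (hF : IsTheta t n ε c F) (hε : ε ≠ 0) (hc : c ≠ 0) :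
    IsTheta t n ε⁻¹ (c⁻¹ * ((p : ℂ)⁻¹ ^ (2 * n))) (fun u ↦ F (-u)) where
  differentiable := hF.differentiable.comp (by fun_prop)
  add_pi u := by
    have := hF.add_pi (-(u + Real.pi))
    rw [show -(u + (Real.pi : ℂ)) + Real.pi = -u by ring] at this
    rw [this]; field_simp
  add_two u := by
    have := hF.add_two (-(u + 2 * t))
    rw [show -(u + 2 * t) + 2 * t = -u by ring] at this
    rw [this, ← ht.exp_eq, ← exp_neg, ← exp_nat_mul]
    have e : exp (((2 * n : ℕ) : ℂ) * -(2 * I * t)) * exp (-(2 * n * I * u))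
        * exp (-(2 * n * I * -(u + 2 * t))) = 1 := by
      rw [← exp_add, ← exp_add, exp_eq_one_iff]
      exact ⟨0, by push_cast; ring⟩
    have hcc : c⁻¹ * c = 1 := inv_mul_cancel₀ hc
    linear_combination (-F (-(u + 2 * t)) * (c⁻¹ * c)) * e - F (-(u + 2 * t)) * hcc

end IsTheta

/-! ### Zeros of theta functions -/

/-- An entire function can be divided by an entire function with simple zeros at which it
vanishes. -/
lemma exists_eq_mul_of_simple_zeros {F P : ℂ → ℂ} (hF : Differentiable ℂ F)
    (hP : Differentiable ℂ P) (h : ∀ z, P z = 0 → F z = 0 ∧ deriv P z ≠ 0) :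
    ∃ G : ℂ → ℂ, Differentiable ℂ G ∧ ∀ u, F u = G u * P u := by
  classical
  refine ⟨fun u ↦ if P u = 0 then deriv F u / deriv P u else F u / P u, fun z ↦ ?_, fun u ↦ ?_⟩
  · by_cases hz : P z = 0
    · have hdF : DifferentiableAt ℂ (dslope F z) z :=
        ((Complex.differentiableOn_dslope Filter.univ_mem).mpr
          hF.differentiableOn).differentiableAt Filter.univ_mem
      have hdP : DifferentiableAt ℂ (dslope P z) z :=
        ((Complex.differentiableOn_dslope Filter.univ_mem).mpr
          hP.differentiableOn).differentiableAt Filter.univ_mem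
      have hne : dslope P z z ≠ 0 := by rw [dslope_same]; exact (h z hz).2
      refine (hdF.div hdP hne).congr_of_eventuallyEq ?_
      filter_upwards [hdP.continuousAt.eventually_ne hne] with w hw
      by_cases hwz : w = z
      · subst hwz
        simp [hz, dslope_same]
      · have hPw : P w = (w - z) * dslope P z w := by
          have := sub_smul_dslope P z w
          rw [hz, sub_zero, smul_eq_mul] at this
          exact this.symm
        have hFw : F w = (w - z) * dslope F z w := by
          have := sub_smul_dslope F z w
          rw [(h z hz).1, sub_zero, smul_eq_mul] at this
          exact this.symm
        have hs : w - z ≠ 0 := sub_ne_zero.mpr hwz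
        have : P w ≠ 0 := by rw [hPw]; exact mul_ne_zero hs hw
        simp only [this, if_false, Pi.div_apply]
        rw [hPw, hFw, mul_div_mul_left _ _ hs]
    · refine ((hF z).div (hP z) hz).congr_of_eventuallyEq ?_
      filter_upwards [hP.continuous.continuousAt.eventually_ne hz] with w hw
      simp [hw]
  · by_cases hu : P u = 0
    · simp [hu, (h u hu).1]
    · simp [hu]

lemma dense_ne_zero {P : ℂ → ℂ} (hP : Differentiable ℂ P) (hne : ∃ z, P z ≠ 0) :
    Dense {u | P u ≠ 0} := by
  obtain ⟨z₀, hz₀⟩ := hne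
  intro z
  have hA : AnalyticOnNhd ℂ P Set.univ := hP.differentiableOn.analyticOnNhd isOpen_univ
  rcases (hA z trivial).eventually_eq_zero_or_eventually_ne_zero with h | h
  · exact absurd (hA.eqOn_zero_of_preconnected_of_eventuallyEq_zero isPreconnected_univ
      (Set.mem_univ z) h (Set.mem_univ z₀)) hz₀
  · exact mem_closure_iff_frequently.mpr (h.frequently.filter_mono nhdsWithin_le_nhds)

/-- Liouville's theorem for entire functions that are doubly periodic up to unimodular factors. -/
lemma eq_const_of_quasi_periodic {p : ℝ} {t : ℂ} (ht : IsHalfPeriod p t) {G : ℂ → ℂ}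
    (hG : Differentiable ℂ G) {χ₁ χ₂ : ℂ} (h₁ : ‖χ₁‖ = 1) (h₂ : ‖χ₂‖ = 1)
    (hp₁ : ∀ u, G (u + Real.pi) = χ₁ * G u) (hp₂ : ∀ u, G (u + 2 * t) = χ₂ * G u) (u : ℂ) :
    G u = G 0 := by
  have e₁ : Function.Periodic (fun u ↦ ‖G u‖) (Real.pi : ℂ) := fun u ↦ by
    simp only [hp₁, norm_mul, h₁, one_mul]
  have e₂ : Function.Periodic (fun u ↦ ‖G u‖) (2 * t) := fun u ↦ by
    simp only [hp₂, norm_mul, h₂, one_mul]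
  refine hG.apply_eq_apply_of_bounded ?_ u 0
  let f : ℝ × ℝ → ℂ := fun x ↦ x.1 * Real.pi + x.2 * (2 * t)
  have hf : Continuous f := by fun_prop
  have hK : IsCompact (Set.Icc (0 : ℝ) 1 ×ˢ Set.Icc (0 : ℝ) 1) := isCompact_Icc.prod isCompact_Icc
  obtain ⟨C, hC⟩ := hK.exists_bound_of_continuousOn (hG.continuous.comp hf).continuousOn
  rw [isBounded_iff_forall_norm_le]
  refine ⟨C, ?_⟩
  rintro _ ⟨u, rfl⟩
  have him := ht.im_pos
  set y : ℝ := u.im / (2 * t.im) with hy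
  set x : ℝ := (u.re - 2 * t.re * y) / Real.pi with hx
  have hu : u = x * Real.pi + y * (2 * t) := by
    have hpi := Real.pi_ne_zero
    apply Complex.ext
    · simp [hx]; field_simp; ring
    · have h0 : t.im ≠ 0 := him.ne'
      have : u.im = y * (2 * t.im) := by rw [hy]; field_simp
      simp [this]
  have hfr : f (Int.fract x, Int.fract y) = u - ⌊x⌋ * (Real.pi : ℂ) - ⌊y⌋ * (2 * t) := by
    simp only [f, Int.fract]
    rw [hu]; push_cast; ring
  have hb := hC (Int.fract x, Int.fract y)
    ⟨⟨Int.fract_nonneg _, (Int.fract_lt_one _).le⟩, ⟨Int.fract_nonneg _, (Int.fract_lt_one _).le⟩⟩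
  simp only [Function.comp, hfr] at hb
  have h3 : ‖G (u - ⌊x⌋ * (Real.pi : ℂ) - ⌊y⌋ * (2 * t))‖ = ‖G u‖ := by
    rw [e₂.sub_int_mul_eq ⌊y⌋, e₁.sub_int_mul_eq ⌊x⌋]
  rwa [h3] at hb

namespace IsTheta

variable {p : ℝ} {t : ℂ} {n m : ℕ} {ε ε' c c' : ℂ} {F P : ℂ → ℂ}

/-- Simple zeros of theta functions repeat along the period lattice. -/
lemma simple_zero_add (hF : IsTheta t n ε c F) (hε : ε ≠ 0) (hc : c ≠ 0) (z : ℂ) (k l : ℤ) :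
    (F (z + k * Real.pi + l * (2 * t)) = 0 ∧ deriv F (z + k * Real.pi + l * (2 * t)) ≠ 0)
      ↔ (F z = 0 ∧ deriv F z ≠ 0) := by
  have h₁ : Function.Periodic (fun z ↦ F z = 0 ∧ deriv F z ≠ 0) (Real.pi : ℂ) := fun u ↦ by
    have hd : deriv F (u + Real.pi) = ε * deriv F u := by
      rw [← deriv_comp_add_const, funext hF.add_pi, deriv_const_mul _ (hF.differentiable u)]
    simp only [hF.add_pi, hd, mul_eq_zero, hε, false_or, ne_eq]
  have h₂ : Function.Periodic (fun z ↦ F z = 0 ∧ deriv F z ≠ 0) (2 * t) := fun u ↦ by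
    by_cases hu : F u = 0
    · have hd : deriv F (u + 2 * t) = c * exp (-(2 * n * I * u)) * deriv F u := by
        rw [← deriv_comp_add_const, funext hF.add_two]
        have := ((((hasDerivAt_id u).const_mul (2 * n * I)).neg.cexp.const_mul c).mul
          (hF.differentiable u).hasDerivAt).deriv
        simp only [id, Pi.mul_def, Pi.neg_apply] at this
        rw [this, hu]
        ring
      simp only [hF.add_two, hd, mul_eq_zero, hc, exp_ne_zero, false_or, ne_eq]
    · simp only [hF.add_two, mul_eq_zero, hc, exp_ne_zero, false_or, hu, false_and]
  have e₁ := (h₂.int_mul l) (z + k * Real.pi)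
  have e₂ := (h₁.int_mul k) z
  exact iff_of_eq (e₁.trans e₂)

/-- A theta function vanishing at the zeros of a second one of the same degree, whose zeros are
simple, is a multiple of it, and is zero if its multipliers are different. -/
lemma exists_eq_const_mul (ht : IsHalfPeriod p t) (hF : IsTheta t n ε c F)
    (hP : IsTheta t n ε' c' P) (hε' : ε' ≠ 0) (hc' : c' ≠ 0) (hε : ‖ε‖ = ‖ε'‖) (hc : ‖c‖ = ‖c'‖)
    (h : ∀ z, P z = 0 → F z = 0 ∧ deriv P z ≠ 0) (hne : ∃ z, P z ≠ 0) :
    ∃ K : ℂ, (∀ u, F u = K * P u) ∧ (ε ≠ ε' ∨ c ≠ c' → K = 0) := by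
  obtain ⟨G, hG, hFG⟩ := exists_eq_mul_of_simple_zeros hF.differentiable hP.differentiable h
  have hden := dense_ne_zero hP.differentiable hne
  have key : ∀ {χ : ℂ} {w : ℂ}, (∀ u, P u ≠ 0 → G (u + w) = χ * G u) →
      ∀ u, G (u + w) = χ * G u := by
    intro χ w hu
    have : (fun u ↦ G (u + w)) = fun u ↦ χ * G u :=
      Continuous.ext_on hden (hG.continuous.comp (by fun_prop))
        (hG.continuous.const_mul χ) (fun u h ↦ hu u h)
    exact congrFun this
  have h₁ : ∀ u, G (u + Real.pi) = ε / ε' * G u := by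
    refine key fun u hu ↦ ?_
    have e := hFG (u + Real.pi)
    rw [hF.add_pi, hP.add_pi, hFG u] at e
    field_simp
    apply mul_right_cancel₀ hu
    linear_combination -e
  have h₂ : ∀ u, G (u + 2 * t) = c / c' * G u := by
    refine key fun u hu ↦ ?_
    have e := hFG (u + 2 * t)
    rw [hF.add_two, hP.add_two, hFG u] at e
    field_simp
    apply mul_right_cancel₀ (mul_ne_zero (exp_ne_zero (-(2 * n * I * u))) hu)
    linear_combination -e
  have hconst := eq_const_of_quasi_periodic ht hG (χ₁ := ε / ε') (χ₂ := c / c')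
    (by rw [norm_div, hε, div_self (norm_ne_zero_iff.mpr hε')])
    (by rw [norm_div, hc, div_self (norm_ne_zero_iff.mpr hc')]) h₁ h₂
  refine ⟨G 0, fun u ↦ by rw [hFG u, hconst u], fun hor ↦ ?_⟩
  rcases hor with hor | hor
  · have e := h₁ 0
    rw [hconst] at e
    by_contra h0
    exact hor ((div_eq_one_iff_eq hε').mp (mul_right_cancel₀ h0 (by rw [← e, one_mul])))
  · have e := h₂ 0
    rw [hconst] at e
    by_contra h0
    exact hor ((div_eq_one_iff_eq hc').mp (mul_right_cancel₀ h0 (by rw [← e, one_mul])))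

end IsTheta

/-- The product `∏ (1 - qⁿ z)`. -/
noncomputable def qProd (q z : ℂ) : ℂ := ∏' n : ℕ, (1 + -(q ^ n * z))

lemma summable_qProd {q : ℂ} (hq : ‖q‖ < 1) (z : ℂ) : Summable fun n : ℕ ↦ ‖-(q ^ n * z)‖ := by
  simp only [norm_neg, norm_mul, norm_pow]
  exact (summable_geometric_of_lt_one (norm_nonneg q) hq).mul_right _

lemma qProd_eq {q : ℂ} (hq : ‖q‖ < 1) (z : ℂ) : qProd q z = (1 - z) * qProd q (q * z) := by
  rw [qProd, tprod_eq_zero_mul']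
  · congr 1
    · ring
    · exact tprod_congr fun n ↦ by ring
  · refine (multipliable_one_add_of_summable (summable_qProd hq (q * z))).congr fun n ↦ by ring

lemma qProd_ne_zero {q : ℂ} (hq : ‖q‖ < 1) {z : ℂ} (h : ∀ n : ℕ, q ^ n * z ≠ 1) :
    qProd q z ≠ 0 := by
  refine tprod_one_add_ne_zero_of_summable (fun n h0 ↦ h n ?_) (summable_qProd hq z)
  linear_combination -h0

lemma qProd_differentiable {q : ℂ} (hq : ‖q‖ < 1) : Differentiable ℂ (qProd q) := by
  intro z₀
  have hopen : IsOpen (Metric.ball (0 : ℂ) (‖z₀‖ + 1)) := Metric.isOpen_ball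
  have hs : Summable fun n : ℕ ↦ ‖q‖ ^ n * (‖z₀‖ + 1) :=
    (summable_geometric_of_lt_one (norm_nonneg q) hq).mul_right _
  have h := hs.hasProdLocallyUniformlyOn_nat_one_add hopen (f := fun n z ↦ -(q ^ n * z))
    (Filter.Eventually.of_forall fun n z hz ↦ by
      rw [norm_neg, norm_mul, norm_pow]
      have : ‖z‖ < ‖z₀‖ + 1 := by simpa using hz
      gcongr)
    (fun n ↦ by fun_prop)
  have hd : DifferentiableOn ℂ (qProd q) (Metric.ball (0 : ℂ) (‖z₀‖ + 1)) :=
    h.tendstoLocallyUniformlyOn_finsetRange.differentiableOn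
      (Filter.Eventually.of_forall fun N ↦ by fun_prop) hopen
  exact hd.differentiableAt (hopen.mem_nhds (by simp))

/-- The product expansion of `ϑ₁`, up to a constant factor. -/
noncomputable def thetaProd (p : ℝ) (u : ℂ) : ℂ :=
  exp (-(I * u)) * qProd ((p : ℂ) ^ 2) (exp (2 * I * u))
    * qProd ((p : ℂ) ^ 2) ((p : ℂ) ^ 2 * exp (-(2 * I * u)))

section Zeros

variable {p : ℝ} {t : ℂ}

lemma IsHalfPeriod.norm_sq_lt_one (ht : IsHalfPeriod p t) : ‖(p : ℂ) ^ 2‖ < 1 := by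
  rw [norm_pow, norm_real, Real.norm_eq_abs]
  exact pow_lt_one₀ (abs_nonneg _) ht.norm_lt_one two_ne_zero

lemma IsTheta.thetaProd (ht : IsHalfPeriod p t) :
    IsTheta t 1 (-1) (-(p : ℂ)⁻¹) (DiluteA.thetaProd p) where
  differentiable := by
    have := qProd_differentiable ht.norm_sq_lt_one
    unfold DiluteA.thetaProd
    fun_prop
  add_pi u := by
    have e₁ : exp (2 * I * (u + Real.pi)) = exp (2 * I * u) :=
      exp_eq_exp_iff_exists_int.mpr ⟨1, by push_cast; ring⟩
    have e₂ : exp (-(2 * I * (u + Real.pi))) = exp (-(2 * I * u)) :=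
      exp_eq_exp_iff_exists_int.mpr ⟨-1, by push_cast; ring⟩
    have e₃ : exp (-(I * (u + Real.pi))) = -exp (-(I * u)) := by
      rw [show -(I * (u + Real.pi)) = -(I * u) - Real.pi * I by ring, exp_sub, exp_pi_mul_I]
      ring
    rw [DiluteA.thetaProd, DiluteA.thetaProd, e₁, e₂, e₃]
    ring
  add_two u := by
    have hp0 : (p : ℂ) ≠ 0 := by exact_mod_cast ht.ne_zero
    have e₁ : exp (2 * I * (u + 2 * t)) = (p : ℂ) ^ 2 * exp (2 * I * u) := by
      rw [← ht.exp_eq, ← exp_nat_mul, ← exp_add]; congr 1; push_cast; ring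
    have e₂ : (p : ℂ) ^ 2 * exp (-(2 * I * (u + 2 * t))) = exp (-(2 * I * u)) := by
      rw [← ht.exp_eq, ← exp_nat_mul, ← exp_add]; congr 1; push_cast; ring
    have e₃ : exp (-(I * (u + 2 * t))) = (p : ℂ)⁻¹ * exp (-(I * u)) := by
      rw [← ht.exp_eq, ← exp_neg, ← exp_add]; congr 1; ring
    have e₄ : exp (-(2 * I * u)) = (exp (2 * I * u))⁻¹ := exp_neg _
    have hx := exp_ne_zero (2 * I * u)
    rw [DiluteA.thetaProd, DiluteA.thetaProd, e₁, e₂, e₃,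
      qProd_eq ht.norm_sq_lt_one (exp (2 * I * u)),
      qProd_eq ht.norm_sq_lt_one (exp (-(2 * I * u)))]
    simp only [Nat.cast_one, mul_one]
    rw [e₄]
    field_simp
    ring

lemma thetaProd_zero (ht : IsHalfPeriod p t) :
    thetaProd p 0 = 0 ∧ deriv (thetaProd p) 0 ≠ 0 := by
  have hq := ht.norm_sq_lt_one
  have hE := qProd_differentiable hq
  have hfac : ∀ u, thetaProd p u = (1 - exp (2 * I * u)) * (exp (-(I * u))
      * qProd ((p : ℂ) ^ 2) ((p : ℂ) ^ 2 * exp (2 * I * u))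
      * qProd ((p : ℂ) ^ 2) ((p : ℂ) ^ 2 * exp (-(2 * I * u)))) := fun u ↦ by
    rw [thetaProd, qProd_eq hq (exp (2 * I * u))]; ring
  refine ⟨by simp [hfac], ?_⟩
  have hne : qProd ((p : ℂ) ^ 2) ((p : ℂ) ^ 2) ≠ 0 := by
    refine qProd_ne_zero hq fun n h ↦ ?_
    rw [← pow_succ] at h
    have h1 := congrArg (‖·‖) h
    simp only [norm_one, norm_pow _ (n + 1)] at h1
    exact (pow_lt_one₀ (norm_nonneg _) hq (Nat.succ_ne_zero n)).ne h1
  have h1 : HasDerivAt (fun u ↦ 1 - exp (2 * I * u)) (-(exp (2 * I * 0) * (2 * I * 1))) 0 :=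
    (((hasDerivAt_id (0 : ℂ)).const_mul (2 * I)).cexp).const_sub 1
  have h2 : DifferentiableAt ℂ (fun u ↦ exp (-(I * u))
      * qProd ((p : ℂ) ^ 2) ((p : ℂ) ^ 2 * exp (2 * I * u))
      * qProd ((p : ℂ) ^ 2) ((p : ℂ) ^ 2 * exp (-(2 * I * u)))) 0 := by fun_prop
  have h3 := (h1.mul h2.hasDerivAt).deriv
  rw [funext hfac]
  simp only [Pi.mul_def] at h3
  rw [h3]
  simp [hne]

lemma thetaProd_eq_zero (ht : IsHalfPeriod p t) {u : ℂ} (h : thetaProd p u = 0) :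
    ∃ k l : ℤ, u = k * Real.pi + l * (2 * t) := by
  have hq := ht.norm_sq_lt_one
  have hpow : ∀ m : ℤ, (p : ℂ) ^ (2 * m) = exp (m * (2 * I * (2 * t))) := fun m ↦ by
    rw [← ht.exp_eq, ← exp_int_mul]; congr 1; push_cast; ring
  have key : ∃ m : ℤ, (p : ℂ) ^ (2 * m) * exp (2 * I * u) = 1 := by
    by_contra! hcon
    refine mul_ne_zero (mul_ne_zero (exp_ne_zero _) (qProd_ne_zero hq fun n hn ↦ ?_))
      (qProd_ne_zero hq fun n hn ↦ ?_) h
    · refine hcon n ?_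
      rw [← pow_mul] at hn
      exact_mod_cast hn
    · refine hcon (-(n + 1)) ?_
      have hp0 : (p : ℂ) ≠ 0 := by exact_mod_cast ht.ne_zero
      rw [← mul_assoc, ← pow_mul, ← pow_add, exp_neg] at hn
      have hx := exp_ne_zero (2 * I * u)
      rw [show 2 * (-((n : ℤ) + 1)) = -((2 * n + 2 : ℕ) : ℤ) by push_cast; ring, zpow_neg,
        zpow_natCast]
      field_simp at hn ⊢
      exact hn.symm
  obtain ⟨m, hm⟩ := key
  rw [hpow, ← exp_add, exp_eq_one_iff] at hm
  obtain ⟨k, hk⟩ := hm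
  refine ⟨k, -m, ?_⟩
  have h2 : (2 * I) * u = (2 * I) * (k * Real.pi + (-m : ℤ) * (2 * t)) := by
    push_cast
    linear_combination hk
  exact mul_left_cancel₀ (by simp) h2

lemma thetaProd_simple (ht : IsHalfPeriod p t) {u : ℂ} (h : thetaProd p u = 0) :
    deriv (thetaProd p) u ≠ 0 := by
  obtain ⟨k, l, rfl⟩ := thetaProd_eq_zero ht h
  have hp0 : (p : ℂ) ≠ 0 := by exact_mod_cast ht.ne_zero
  have := ((IsTheta.thetaProd ht).simple_zero_add (by norm_num) (by simpa using hp0) 0 k l).mpr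
    (thetaProd_zero ht)
  rw [zero_add] at this
  exact this.2

lemma thetaOdd_half_pi_ne_zero (ht : IsHalfPeriod p t) : thetaOdd p (Real.pi / 2) ≠ 0 := by
  have hp := ht.norm_lt_one
  have h1 : ∀ n : ℕ, (-1 : ℂ) ^ n * (p : ℂ) ^ (n * (n + 1))
      * sin ((2 * (n : ℂ) + 1) * (Real.pi / 2)) = ((p ^ (n * (n + 1)) : ℝ) : ℂ) := by
    intro n
    rw [show (2 * (n : ℂ) + 1) * (Real.pi / 2) = Real.pi / 2 + n * Real.pi by ring,
      Complex.sin_antiperiodic.add_nat_mul_eq]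
    simp only [sin_pi_div_two]
    push_cast
    have : (-1 : ℂ) ^ n * (-1) ^ n = 1 := by rw [← mul_pow]; norm_num
    linear_combination ((p : ℂ) ^ (n * (n + 1))) * this
  rw [thetaOdd, tsum_congr h1, ← ofReal_tsum]
  have hnn : ∀ n : ℕ, 0 ≤ p ^ (n * (n + 1)) := fun n ↦ (Nat.even_mul_succ_self n).pow_nonneg p
  have hsum : Summable fun n : ℕ ↦ p ^ (n * (n + 1)) := by
    refine Summable.of_norm_bounded (summable_geometric_of_lt_one (abs_nonneg p) hp) fun n ↦ ?_
    rw [norm_pow, Real.norm_eq_abs]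
    exact pow_le_pow_of_le_one (abs_nonneg p) hp.le (by nlinarith)
  have : 0 < ∑' n : ℕ, p ^ (n * (n + 1)) :=
    hsum.tsum_pos hnn 0 (by simp)
  exact_mod_cast this.ne'

/-- The zeros of `ϑ₁` are exactly the points of the period lattice, and they are simple. -/
lemma thetaOdd_zeros (ht : IsHalfPeriod p t) {u : ℂ} (h : thetaOdd p u = 0) :
    (∃ k l : ℤ, u = k * Real.pi + l * (2 * t)) ∧ deriv (thetaOdd p) u ≠ 0 := by
  have hp0 : (p : ℂ) ≠ 0 := by exact_mod_cast ht.ne_zero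
  have hlat : ∀ k l : ℤ, thetaOdd p (k * Real.pi + l * (2 * t)) = 0 := by
    have h₁ : Function.Periodic (fun z ↦ thetaOdd p z = 0) (Real.pi : ℂ) := fun u ↦ by
      simp only [thetaOdd_add_pi, neg_eq_zero]
    have h₂ : Function.Periodic (fun z ↦ thetaOdd p z = 0) (2 * t) := fun u ↦ by
      simp only [ht.thetaOdd_add_two, mul_eq_zero, exp_ne_zero, neg_eq_zero, inv_eq_zero, hp0,
        false_or]
    intro k l
    have e₁ := (h₂.int_mul l) (k * Real.pi)
    have e₂ := (h₁.int_mul k) 0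
    rw [zero_add] at e₂
    exact (e₁.trans e₂).mpr (thetaOdd_zero p)
  obtain ⟨K, hK, -⟩ := (IsTheta.thetaOdd ht).exists_eq_const_mul ht (IsTheta.thetaProd ht)
    (by norm_num) (by simpa using hp0) rfl rfl (fun z hz ↦ ⟨by
      obtain ⟨k, l, rfl⟩ := thetaProd_eq_zero ht hz
      exact hlat k l, thetaProd_simple ht hz⟩)
    (by
      by_contra! hcon
      exact (thetaProd_zero ht).2 (by rw [funext hcon]; simp))
  have hK0 : K ≠ 0 := by
    rintro rfl
    exact thetaOdd_half_pi_ne_zero ht (by rw [hK, zero_mul])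
  have hP : thetaProd p u = 0 := by
    rw [hK] at h
    exact (mul_eq_zero.mp h).resolve_left hK0
  refine ⟨thetaProd_eq_zero ht hP, ?_⟩
  rw [funext hK, deriv_const_mul _ ((IsTheta.thetaProd ht).differentiable u)]
  exact mul_ne_zero hK0 (thetaProd_simple ht hP)

/-- The product of the functions `ϑ₁(u - z)` over a list of points `z`. -/
noncomputable def zeroProd (p : ℝ) (zs : List ℂ) (u : ℂ) : ℂ :=
  (zs.map fun z ↦ thetaOdd p (u - z)).prod

lemma zeroProd_eq_zero {zs : List ℂ} {u : ℂ} (h : zeroProd p zs u = 0) :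
    ∃ z ∈ zs, thetaOdd p (u - z) = 0 := by
  simpa [zeroProd, List.prod_eq_zero_iff] using h

lemma IsTheta.zeroProd (ht : IsHalfPeriod p t) (zs : List ℂ) :
    IsTheta t zs.length ((-1) ^ zs.length) ((-(p : ℂ)⁻¹) ^ zs.length * exp (2 * I * zs.sum))
      (zeroProd p zs) := by
  induction zs with
  | nil =>
    exact ⟨by unfold DiluteA.zeroProd; simp, by simp [DiluteA.zeroProd],
      by simp [DiluteA.zeroProd]⟩
  | cons z zs ih =>
    have h := ((IsTheta.thetaOdd ht).comp_sub z).mul ih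
    have e : -(p : ℂ)⁻¹ * exp (2 * ((1 : ℕ) : ℂ) * I * z)
          * ((-(p : ℂ)⁻¹) ^ zs.length * exp (2 * I * zs.sum))
        = (-(p : ℂ)⁻¹) ^ (z :: zs).length * exp (2 * I * (z :: zs).sum) := by
      rw [List.sum_cons, mul_add, exp_add, List.length_cons, pow_succ]
      push_cast
      rw [mul_one]
      ring
    rw [e, add_comm 1, ← pow_succ'] at h
    exact h.congr fun u ↦ by simp [DiluteA.zeroProd]

lemma zeroProd_simple (ht : IsHalfPeriod p t) {zs : List ℂ}
    (hzs : zs.Pairwise fun z w ↦ thetaOdd p (z - w) ≠ 0) {u : ℂ} (h : zeroProd p zs u = 0) :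
    deriv (zeroProd p zs) u ≠ 0 := by
  have hd := ht.thetaOdd_differentiable
  have hdP := fun zs ↦ (IsTheta.zeroProd ht zs).differentiable
  have hp0 : (p : ℂ) ≠ 0 := by exact_mod_cast ht.ne_zero
  induction zs with
  | nil => simp [zeroProd] at h
  | cons z zs ih =>
    have hcons : zeroProd p (z :: zs) = fun u ↦ thetaOdd p (u - z) * zeroProd p zs u := by
      funext u; simp [zeroProd]
    have hd1 : DifferentiableAt ℂ (fun u ↦ thetaOdd p (u - z)) u := by fun_prop
    have hder : deriv (zeroProd p (z :: zs)) u
        = deriv (thetaOdd p) (u - z) * zeroProd p zs u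
          + thetaOdd p (u - z) * deriv (zeroProd p zs) u := by
      rw [hcons]
      have := (hd1.hasDerivAt.mul (hdP zs u).hasDerivAt).deriv
      simp only [Pi.mul_def] at this
      rw [this, deriv_comp_sub_const]
    obtain ⟨h1, h2⟩ := List.pairwise_cons.mp hzs
    rw [hder]
    by_cases hz : thetaOdd p (u - z) = 0
    · rw [hz, zero_mul, add_zero]
      refine mul_ne_zero (thetaOdd_zeros ht hz).2 fun h0 ↦ ?_
      obtain ⟨w, hw, hw0⟩ := zeroProd_eq_zero h0
      obtain ⟨⟨k, l, hkl⟩, -⟩ := thetaOdd_zeros ht hz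
      refine h1 w hw ?_
      -- both `u - z` and `u - w` are lattice points, hence so is their difference
      have hs := ((IsTheta.thetaOdd ht).simple_zero_add (by norm_num) (by simpa using hp0)
        (z - w) k l).mp ?_
      · exact hs.1
      · have e : z - w + k * Real.pi + l * (2 * t) = u - w := by linear_combination -hkl
        rw [e]
        exact ⟨hw0, (thetaOdd_zeros ht hw0).2⟩
    · have h0 : zeroProd p zs u = 0 := by
        rw [hcons] at h
        exact (mul_eq_zero.mp h).resolve_left hz
      rw [h0, mul_zero, zero_add]
      exact mul_ne_zero hz (ih h2 h0)

namespace IsTheta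

variable {ε c : ℂ} {F : ℂ → ℂ} {zs : List ℂ}

/-- A theta function of degree `n` which vanishes at `n` inequivalent points is a multiple of the
product `zeroProd` over these points, and it is zero if its multipliers are not those of the
product. -/
lemma exists_eq_zeroProd (ht : IsHalfPeriod p t) (hF : IsTheta t zs.length ε c F)
    (hzs : zs.Pairwise fun z w ↦ DiluteA.thetaOdd p (z - w) ≠ 0) (h : ∀ z ∈ zs, F z = 0)
    (hε : ‖ε‖ = 1) (hc : ‖c‖ = ‖(-(p : ℂ)⁻¹) ^ zs.length * exp (2 * I * zs.sum)‖) :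
    ∃ K : ℂ, (∀ u, F u = K * DiluteA.zeroProd p zs u) ∧
      (ε ≠ (-1) ^ zs.length ∨ c ≠ (-(p : ℂ)⁻¹) ^ zs.length * exp (2 * I * zs.sum) → K = 0) := by
  have hp0 : (p : ℂ) ≠ 0 := by exact_mod_cast ht.ne_zero
  have hε0 : ε ≠ 0 := by
    rintro rfl; simp at hε
  have hc' : (-(p : ℂ)⁻¹) ^ zs.length * exp (2 * I * zs.sum) ≠ 0 :=
    mul_ne_zero (pow_ne_zero _ (by simpa using hp0)) (exp_ne_zero _)
  have hc0 : c ≠ 0 := by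
    rw [← norm_ne_zero_iff, hc, norm_ne_zero_iff]; exact hc'
  refine hF.exists_eq_const_mul ht (IsTheta.zeroProd ht zs) (by simp) hc' (by simp [hε]) hc
    (fun z hz ↦ ⟨?_, zeroProd_simple ht hzs hz⟩) ?_
  · obtain ⟨w, hw, hw0⟩ := zeroProd_eq_zero hz
    obtain ⟨⟨k, l, hkl⟩, -⟩ := thetaOdd_zeros ht hw0
    have h₁ : Function.Periodic (fun z ↦ F z = 0) (Real.pi : ℂ) := fun u ↦ by
      simp only [hF.add_pi, mul_eq_zero, hε0, false_or]
    have h₂ : Function.Periodic (fun z ↦ F z = 0) (2 * t) := fun u ↦ by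
      simp only [hF.add_two, mul_eq_zero, hc0, exp_ne_zero, false_or]
    have e₁ := (h₂.int_mul l) (w + k * Real.pi)
    have e₂ := (h₁.int_mul k) w
    have e : z = w + k * Real.pi + l * (2 * t) := by linear_combination hkl
    rw [e]
    exact (e₁.trans e₂).mpr (h w hw)
  · by_contra! hcon
    exact zeroProd_simple ht hzs (hcon 0) (by rw [funext hcon]; simp)

/-- A theta function of degree `n` with `n` inequivalent zeros whose multipliers do not match
these zeros is zero. -/
lemma eq_zero_of_multiplier_ne (ht : IsHalfPeriod p t) (hF : IsTheta t zs.length ε c F)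
    (hzs : zs.Pairwise fun z w ↦ DiluteA.thetaOdd p (z - w) ≠ 0) (h : ∀ z ∈ zs, F z = 0)
    (hε : ‖ε‖ = 1) (hc : ‖c‖ = ‖(-(p : ℂ)⁻¹) ^ zs.length * exp (2 * I * zs.sum)‖)
    (hne : ε ≠ (-1) ^ zs.length ∨ c ≠ (-(p : ℂ)⁻¹) ^ zs.length * exp (2 * I * zs.sum)) (u : ℂ) :
    F u = 0 := by
  obtain ⟨K, hK, h0⟩ := hF.exists_eq_zeroProd ht hzs h hε hc
  rw [hK, h0 hne, zero_mul]

/-- A theta function of degree `n` with `n + 1` inequivalent zeros is zero. -/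
lemma eq_zero_of_extra_zero (ht : IsHalfPeriod p t) (hF : IsTheta t zs.length ε c F)
    (hzs : zs.Pairwise fun z w ↦ DiluteA.thetaOdd p (z - w) ≠ 0) (h : ∀ z ∈ zs, F z = 0)
    (hε : ‖ε‖ = 1) (hc : ‖c‖ = ‖(-(p : ℂ)⁻¹) ^ zs.length * exp (2 * I * zs.sum)‖)
    {w : ℂ} (hw : F w = 0) (hwz : ∀ z ∈ zs, DiluteA.thetaOdd p (w - z) ≠ 0) (u : ℂ) :
    F u = 0 := by
  obtain ⟨K, hK, -⟩ := hF.exists_eq_zeroProd ht hzs h hε hc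
  have h1 : DiluteA.zeroProd p zs w ≠ 0 := fun h0 ↦ by
    obtain ⟨z, hz, hz0⟩ := zeroProd_eq_zero h0
    exact hwz z hz hz0
  rw [hK] at hw
  rw [hK, (mul_eq_zero.mp hw).resolve_right h1, zero_mul]

end IsTheta

end Zeros

/-! ### The addition formula -/

section Addition

variable {p : ℝ} {t : ℂ}

lemma dense_thetaOdd_ne_zero (ht : IsHalfPeriod p t) {a : ℂ} (ha : a ≠ 0) (b : ℂ) :
    Dense {u | thetaOdd p (a * u + b) ≠ 0} := by
  have hd := ht.thetaOdd_differentiable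
  refine dense_ne_zero (P := fun u ↦ thetaOdd p (a * u + b)) (by fun_prop)
    ⟨(Real.pi / 2 - b) / a, ?_⟩
  rw [show a * ((Real.pi / 2 - b) / a) + b = Real.pi / 2 by field_simp; ring]
  exact thetaOdd_half_pi_ne_zero ht

lemma isOpen_thetaOdd_ne_zero (ht : IsHalfPeriod p t) (a b : ℂ) :
    IsOpen {u | thetaOdd p (a * u + b) ≠ 0} := by
  have hd := ht.thetaOdd_differentiable.continuous
  exact isOpen_ne_fun (by fun_prop) continuous_const

lemma IsTheta.mul_add_sub {ε ε' c : ℂ} {F G : ℂ → ℂ} (hF : IsTheta t 1 ε c F)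
    (hG : IsTheta t 1 ε' c G) (a : ℂ) :
    IsTheta t 2 (ε * ε') (c ^ 2) (fun u ↦ F (u + a) * G (u - a)) := by
  have h := (hF.comp_add a).mul (hG.comp_sub a)
  have e : exp (-(2 * ((1 : ℕ) : ℂ) * I * a)) * exp (2 * ((1 : ℕ) : ℂ) * I * a) = 1 := by
    rw [← exp_add, neg_add_cancel, exp_zero]
  have e' : c * exp (-(2 * ((1 : ℕ) : ℂ) * I * a)) * (c * exp (2 * ((1 : ℕ) : ℂ) * I * a))
      = c ^ 2 := by linear_combination c ^ 2 * e
  rwa [e'] at h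

/-- Weierstrass' three-term addition formula, with one of the four variables shifted by half a
quasi-period. -/
lemma theta_addition (ht : IsHalfPeriod p t) (X Y Z T : ℂ) :
    thetaOdd p (X + Y) * thetaOdd p (X - Y) * (theta4 p (Z + T) * theta4 p (Z - T))
      + thetaOdd p (Y + Z) * thetaOdd p (Y - Z) * (theta4 p (X + T) * theta4 p (X - T))
      + thetaOdd p (Z + X) * thetaOdd p (Z - X) * (theta4 p (Y + T) * theta4 p (Y - T)) = 0 := by
  have h1 := ht.thetaOdd_differentiable.continuous
  have h4 := ht.theta4_differentiable.continuous
  have hp0 : (p : ℂ) ≠ 0 := by exact_mod_cast ht.ne_zero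
  -- for fixed `Y`, `Z`, `T` the left hand side is a theta function of degree two in `X` which
  -- vanishes at `±Y` and `±Z`
  have hden : Dense ({Y | thetaOdd p (2 * Y + 0) ≠ 0} ∩ ({Y | thetaOdd p ((-1) * Y + Z) ≠ 0}
      ∩ {Y | thetaOdd p (1 * Y + Z) ≠ 0})) :=
    (dense_thetaOdd_ne_zero ht two_ne_zero 0).inter_of_isOpen_left
      ((dense_thetaOdd_ne_zero ht (by norm_num) Z).inter_of_isOpen_left
        (dense_thetaOdd_ne_zero ht one_ne_zero Z) (isOpen_thetaOdd_ne_zero ht _ _))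
      (isOpen_thetaOdd_ne_zero ht _ _)
  refine congrFun (Continuous.ext_on (f := fun Y ↦
    thetaOdd p (X + Y) * thetaOdd p (X - Y) * (theta4 p (Z + T) * theta4 p (Z - T))
      + thetaOdd p (Y + Z) * thetaOdd p (Y - Z) * (theta4 p (X + T) * theta4 p (X - T))
      + thetaOdd p (Z + X) * thetaOdd p (Z - X) * (theta4 p (Y + T) * theta4 p (Y - T)))
    (g := fun _ ↦ 0) hden (by fun_prop) continuous_const ?_) Y
  rintro Y ⟨hY, hYZ, hYZ'⟩
  simp only [ne_eq, Set.mem_ofPred_eq] at hY hYZ hYZ'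
  rw [add_zero] at hY
  have o1 := IsTheta.thetaOdd ht
  have o4 := IsTheta.theta4 ht
  have hF := (((o1.mul_add_sub o1 Y).const_mul (theta4 p (Z + T) * theta4 p (Z - T))).sub
    ((o1.mul_add_sub o1 Z).const_mul (theta4 p (Y + T) * theta4 p (Y - T)))).add
    (((o4.mul_add_sub o4 T).const_mul
      (thetaOdd p (Y + Z) * thetaOdd p (Y - Z))).of_eq rfl (by norm_num) rfl)
  have hX : ∀ X, thetaOdd p (X + Y) * thetaOdd p (X - Y) * (theta4 p (Z + T) * theta4 p (Z - T))
      + thetaOdd p (Y + Z) * thetaOdd p (Y - Z) * (theta4 p (X + T) * theta4 p (X - T))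
      + thetaOdd p (Z + X) * thetaOdd p (Z - X) * (theta4 p (Y + T) * theta4 p (Y - T))
      = (theta4 p (Z + T) * theta4 p (Z - T)) * (thetaOdd p (X + Y) * thetaOdd p (X - Y))
      - (theta4 p (Y + T) * theta4 p (Y - T)) * (thetaOdd p (X + Z) * thetaOdd p (X - Z))
      + (thetaOdd p (Y + Z) * thetaOdd p (Y - Z)) * (theta4 p (X + T) * theta4 p (X - T)) := by
    intro X
    rw [show Z - X = -(X - Z) by ring, thetaOdd_neg, add_comm Z X]
    ring
  have e1 : thetaOdd p (Z - Y) = -thetaOdd p (Y - Z) := by rw [← thetaOdd_neg]; congr 1; ring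
  have e2 : thetaOdd p (-Y + Z) = -thetaOdd p (Y - Z) := by rw [← thetaOdd_neg]; congr 1; ring
  have e3 : thetaOdd p (-Y - Z) = -thetaOdd p (Y + Z) := by rw [← thetaOdd_neg]; congr 1; ring
  have e4 : theta4 p (-Y + T) = theta4 p (Y - T) := by rw [← theta4_neg]; congr 1; ring
  have e5 : theta4 p (-Y - T) = theta4 p (Y + T) := by rw [← theta4_neg]; congr 1; ring
  refine (hX X).trans ?_
  refine IsTheta.eq_zero_of_extra_zero (zs := [Y, -Y]) (w := Z) ht hF ?_ ?_ (by simp) ?_ ?_ ?_ X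
  · simpa [← two_mul] using hY
  · intro z hz
    rcases List.mem_pair.mp hz with rfl | rfl
    · simp only [sub_self, thetaOdd_zero]; ring
    · simp only [neg_add_cancel, thetaOdd_zero, e2, e3, e4, e5]; ring
  · simp
  · simp only [sub_self, thetaOdd_zero, e1, add_comm Z Y]; ring
  · intro z hz
    rcases List.mem_pair.mp hz with rfl | rfl
    · rwa [neg_one_mul, neg_add_eq_sub] at hYZ
    · rwa [one_mul, add_comm, ← sub_neg_eq_add] at hYZ'

end Addition

/-! ### Theta functions on the real line -/

section Real

variable {p : ℝ}

lemma thetaOdd_ofReal_im (p x : ℝ) : (thetaOdd p x).im = 0 := by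
  have : thetaOdd p x = ((∑' n : ℕ, (-1 : ℝ) ^ n * p ^ (n * (n + 1))
      * Real.sin ((2 * (n : ℝ) + 1) * x) : ℝ) : ℂ) := by
    rw [thetaOdd, ofReal_tsum]
    exact tsum_congr fun n ↦ by push_cast; rfl
  rw [this, ofReal_im]

lemma theta4_ofReal_im (p x : ℝ) : (theta4 p x).im = 0 := by
  have : theta4 p x = ((1 + 2 * ∑' n : ℕ, (-1 : ℝ) ^ (n + 1) * p ^ ((n + 1) ^ 2)
      * Real.cos (2 * ((n : ℝ) + 1) * x) : ℝ) : ℂ) := by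
    rw [theta4, ofReal_add, ofReal_mul, ofReal_tsum]
    push_cast
    rfl
  rw [this, ofReal_im]

lemma thetaOdd_ofReal (p x : ℝ) : thetaOdd p x = ((thetaOdd p x).re : ℂ) :=
  Complex.ext rfl (by rw [thetaOdd_ofReal_im, ofReal_im])

lemma theta4_ofReal (p x : ℝ) : theta4 p x = ((theta4 p x).re : ℂ) :=
  Complex.ext rfl (by rw [theta4_ofReal_im, ofReal_im])

lemma thetaOdd_continuous (hp : |p| < 1) : Continuous (thetaOdd p) := by
  rcases eq_or_ne p 0 with rfl | h0
  · rw [funext thetaOdd_nome_zero]; fun_prop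
  · obtain ⟨t, ht⟩ := exists_isHalfPeriod hp h0
    exact ht.thetaOdd_differentiable.continuous

lemma theta4_continuous (hp : |p| < 1) : Continuous (theta4 p) := by
  rcases eq_or_ne p 0 with rfl | h0
  · rw [funext theta4_nome_zero]; fun_prop
  · obtain ⟨t, ht⟩ := exists_isHalfPeriod hp h0
    exact ht.theta4_differentiable.continuous

lemma thetaOdd_ofReal_ne_zero (hp : |p| < 1) {x : ℝ} (h : ∀ k : ℤ, x ≠ k * Real.pi) :
    thetaOdd p x ≠ 0 := by
  rcases eq_or_ne p 0 with rfl | h0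
  · rw [thetaOdd_nome_zero, ← ofReal_sin]
    intro hs
    obtain ⟨k, hk⟩ := Real.sin_eq_zero_iff.mp (by exact_mod_cast hs)
    exact h k hk.symm
  · obtain ⟨t, ht⟩ := exists_isHalfPeriod hp h0
    intro hz
    obtain ⟨⟨k, l, hkl⟩, -⟩ := thetaOdd_zeros ht hz
    have him := congrArg im hkl
    simp at him
    rcases him with hl | hl
    · subst hl
      exact h k (by simpa using congrArg re hkl)
    · exact ht.im_pos.ne' hl

lemma theta4_ofReal_ne_zero (hp : |p| < 1) (x : ℝ) : theta4 p x ≠ 0 := by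
  rcases eq_or_ne p 0 with rfl | h0
  · rw [theta4_nome_zero]; exact one_ne_zero
  · obtain ⟨t, ht⟩ := exists_isHalfPeriod hp h0
    intro hz
    have h1 : thetaOdd p (x - t) = 0 := by
      rw [ht.thetaOdd_eq, sub_add_cancel, hz, mul_zero]
    obtain ⟨⟨k, l, hkl⟩, -⟩ := thetaOdd_zeros ht h1
    have him := congrArg im hkl
    simp at him
    have h2 : ((2 * l + 1 : ℤ) : ℝ) * t.im = 0 := by push_cast; linarith
    rcases mul_eq_zero.mp h2 with hl | hl
    · have : (2 * l + 1 : ℤ) = 0 := by exact_mod_cast hl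
      omega
    · exact ht.im_pos.ne' hl

/-- A continuous function without zeros does not change sign on a connected set. -/
lemma mul_pos_of_continuousOn_ne_zero {f : ℝ → ℝ} {s : Set ℝ} (hs : IsPreconnected s)
    (hf : ContinuousOn f s) (h : ∀ x ∈ s, f x ≠ 0) {x y : ℝ} (hx : x ∈ s) (hy : y ∈ s) :
    0 < f x * f y := by
  by_contra! hle
  have hlt : f x * f y < 0 := lt_of_le_of_ne hle (mul_ne_zero (h x hx) (h y hy))
  have hz : (0 : ℝ) ∈ f '' s := by
    rcases mul_neg_iff.mp hlt with ⟨h1, h2⟩ | ⟨h1, h2⟩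
    · exact hs.intermediate_value hy hx hf ⟨h2.le, h1.le⟩
    · exact hs.intermediate_value hx hy hf ⟨h1.le, h2.le⟩
  obtain ⟨z, hz, hz0⟩ := hz
  exact h z hz hz0

lemma theta4_re_mul_pos (hp : |p| < 1) (x y : ℝ) : 0 < (theta4 p x).re * (theta4 p y).re := by
  have hc := theta4_continuous hp
  refine mul_pos_of_continuousOn_ne_zero (f := fun x : ℝ ↦ (theta4 p x).re) isPreconnected_univ
    (continuous_re.comp (hc.comp continuous_ofReal)).continuousOn
    (fun x _ h ↦ theta4_ofReal_ne_zero hp x ?_) (Set.mem_univ x) (Set.mem_univ y)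
  rw [theta4_ofReal, h, ofReal_zero]

lemma thetaOdd_re_mul_pos (hp : |p| < 1) {x y : ℝ} (hx : x ∈ Set.Ioo 0 Real.pi)
    (hy : y ∈ Set.Ioo 0 Real.pi) : 0 < (thetaOdd p x).re * (thetaOdd p y).re := by
  have hc := thetaOdd_continuous hp
  refine mul_pos_of_continuousOn_ne_zero (f := fun x : ℝ ↦ (thetaOdd p x).re) isPreconnected_Ioo
    (continuous_re.comp (hc.comp continuous_ofReal)).continuousOn
    (fun x hx h ↦ thetaOdd_ofReal_ne_zero hp (x := x) (fun k hk ↦ ?_) ?_) hx hy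
  · have h1 : (0 : ℝ) < k := by
      have := hx.1; rw [hk] at this; exact pos_of_mul_pos_left this Real.pi_pos.le
    have h2 : (k : ℝ) < 1 := by
      have := hx.2; rw [hk] at this; nlinarith [Real.pi_pos]
    have h3 : 0 < k := by exact_mod_cast h1
    have h4 : k < 1 := by exact_mod_cast h2
    omega
  · rw [thetaOdd_ofReal, h, ofReal_zero]

end Real

/-! ### Continuity in the nome at zero -/

lemma norm_exp_I_mul_le (z : ℂ) : ‖exp (z * I)‖ ≤ Real.exp ‖z‖ := by
  rw [norm_exp]
  refine Real.exp_le_exp.mpr ?_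
  simp only [mul_re, I_re, mul_zero, I_im, mul_one, zero_sub]
  exact (neg_le_abs _).trans (abs_im_le_norm z)

lemma norm_sin_le_exp (z : ℂ) : ‖sin z‖ ≤ Real.exp ‖z‖ := by
  have h1 := norm_exp_I_mul_le z
  have h2 := norm_exp_I_mul_le (-z)
  rw [norm_neg] at h2
  rw [sin, norm_div, norm_mul, norm_I, mul_one, Complex.norm_ofNat]
  linarith [norm_sub_le (exp (-z * I)) (exp (z * I))]

lemma norm_cos_le_exp (z : ℂ) : ‖cos z‖ ≤ Real.exp ‖z‖ := by
  have h1 := norm_exp_I_mul_le z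
  have h2 := norm_exp_I_mul_le (-z)
  rw [norm_neg] at h2
  rw [cos, norm_div, Complex.norm_ofNat]
  linarith [norm_add_le (exp (z * I)) (exp (-z * I))]

/-- Dominated convergence for power series in the nome whose exponents are at least `n` and whose
coefficients grow at most geometrically. -/
lemma continuousAt_tsum_nome {f : ℕ → ℂ} {k : ℕ → ℕ} {A B : ℝ} (hB : 0 < B)
    (hf : ∀ n, ‖f n‖ ≤ A * B ^ n) (hk : ∀ n, n ≤ k n) :
    ContinuousAt (fun p : ℝ ↦ ∑' n, (p : ℂ) ^ k n * f n) 0 := by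
  have hA : 0 ≤ A := by
    have := (norm_nonneg _).trans (hf 0); simpa using this
  have hs : Summable fun n : ℕ ↦ A * (1 / 2 : ℝ) ^ n :=
    (summable_geometric_of_lt_one (by norm_num) (by norm_num)).mul_left _
  refine tendsto_tsum_of_dominated_convergence hs (fun n ↦ ?_) ?_
  · exact ((continuous_ofReal.pow (k n)).mul continuous_const).continuousAt
  · have hr : 0 < min 1 (1 / (2 * B)) := by positivity
    filter_upwards [Metric.ball_mem_nhds (0 : ℝ) hr] with p hp n
    rw [mem_ball_zero_iff, Real.norm_eq_abs, lt_min_iff] at hp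
    rw [norm_mul, norm_pow, norm_real, Real.norm_eq_abs]
    have h2 : |p| * B ≤ 1 / 2 := by
      have := hp.2.le
      rw [le_div_iff₀ (by positivity)] at this
      linarith
    calc |p| ^ k n * ‖f n‖ ≤ |p| ^ n * (A * B ^ n) := by
          have := pow_le_pow_of_le_one (abs_nonneg p) hp.1.le (hk n)
          have := hf n
          gcongr
      _ = A * (|p| * B) ^ n := by rw [mul_pow]; ring
      _ ≤ A * (1 / 2) ^ n := by gcongr

lemma thetaOdd_continuousAt_nome (u : ℂ) : ContinuousAt (fun p : ℝ ↦ thetaOdd p u) 0 := by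
  have h := continuousAt_tsum_nome (f := fun n ↦ (-1 : ℂ) ^ n * sin ((2 * (n : ℂ) + 1) * u))
    (k := fun n ↦ n * (n + 1)) (A := Real.exp ‖u‖) (B := Real.exp (2 * ‖u‖)) (Real.exp_pos _)
    (fun n ↦ ?_) (fun n ↦ by nlinarith)
  · refine h.congr (Filter.Eventually.of_forall fun p ↦ tsum_congr fun n ↦ by ring)
  · rw [norm_mul, norm_pow, norm_neg, norm_one, one_pow, one_mul, ← Real.exp_nat_mul,
      ← Real.exp_add]
    refine (norm_sin_le_exp _).trans (Real.exp_le_exp.mpr ?_)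
    rw [norm_mul]
    have : ‖2 * (n : ℂ) + 1‖ = 2 * n + 1 := by
      rw [show 2 * (n : ℂ) + 1 = ((2 * n + 1 : ℕ) : ℂ) by push_cast; ring, Complex.norm_natCast]
      push_cast; ring
    rw [this]
    linarith

lemma theta4_continuousAt_nome (u : ℂ) : ContinuousAt (fun p : ℝ ↦ theta4 p u) 0 := by
  have h := continuousAt_tsum_nome
    (f := fun n ↦ (-1 : ℂ) ^ (n + 1) * cos (2 * ((n : ℂ) + 1) * u))
    (k := fun n ↦ (n + 1) ^ 2) (A := Real.exp (2 * ‖u‖)) (B := Real.exp (2 * ‖u‖))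
    (Real.exp_pos _) (fun n ↦ ?_) (fun n ↦ by nlinarith)
  · refine ((continuousAt_const (y := (1 : ℂ))).add
      ((continuousAt_const (y := (2 : ℂ))).mul h)).congr
      (Filter.Eventually.of_forall fun p ↦ ?_)
    simp only [theta4, Pi.add_apply, Pi.mul_apply]
    congr 2
    exact tsum_congr fun n ↦ by ring
  · rw [norm_mul, norm_pow, norm_neg, norm_one, one_pow, one_mul, ← Real.exp_nat_mul,
      ← Real.exp_add]
    refine (norm_cos_le_exp _).trans (Real.exp_le_exp.mpr ?_)
    rw [norm_mul]
    have : ‖2 * ((n : ℂ) + 1)‖ = 2 * (n + 1) := by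
      rw [show 2 * ((n : ℂ) + 1) = ((2 * (n + 1) : ℕ) : ℂ) by push_cast; ring, Complex.norm_natCast]
      push_cast; ring
    rw [this]
    linarith

/-! ### Theta functions with a prescribed sum of zeros -/

/-- Theta functions of degree `n` whose zeros add up to `s`, modulo the period lattice. The
multiplier `(-p)⁻ⁿ e^{2is}` is that of `∏ ϑ₁(u - zᵢ)` with `∑ zᵢ = s`. -/
def IsThetaSum (p : ℝ) (t : ℂ) (n : ℕ) (ε s : ℂ) (F : ℂ → ℂ) : Prop :=
  IsTheta t n ε ((-(p : ℂ)⁻¹) ^ n * exp (2 * I * s)) F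

namespace IsThetaSum

variable {p : ℝ} {t : ℂ} {n m : ℕ} {ε ε' s s' : ℂ} {F G : ℂ → ℂ}

lemma cast (hF : IsThetaSum p t n ε s F) (hn : n = m) (hε : ε = ε') (hs : s = s') :
    IsThetaSum p t m ε' s' F := by
  subst hn hε hs; exact hF

lemma congr (hF : IsThetaSum p t n ε s F) (h : ∀ u, F u = G u) : IsThetaSum p t n ε s G :=
  IsTheta.congr hF h

lemma add (hF : IsThetaSum p t n ε s F) (hG : IsThetaSum p t n ε s G) :
    IsThetaSum p t n ε s (fun u ↦ F u + G u) := IsTheta.add hF hG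

lemma sub (hF : IsThetaSum p t n ε s F) (hG : IsThetaSum p t n ε s G) :
    IsThetaSum p t n ε s (fun u ↦ F u - G u) := IsTheta.sub hF hG

lemma const_mul (hF : IsThetaSum p t n ε s F) (k : ℂ) :
    IsThetaSum p t n ε s (fun u ↦ k * F u) := IsTheta.const_mul hF k

lemma mul_const (hF : IsThetaSum p t n ε s F) (k : ℂ) :
    IsThetaSum p t n ε s (fun u ↦ F u * k) := (hF.const_mul k).congr fun _ ↦ mul_comm _ _

lemma div_const (hF : IsThetaSum p t n ε s F) (k : ℂ) :
    IsThetaSum p t n ε s (fun u ↦ F u / k) :=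
  (hF.mul_const k⁻¹).congr fun _ ↦ (div_eq_mul_inv _ _).symm

lemma mul (hF : IsThetaSum p t n ε s F) (hG : IsThetaSum p t m ε' s' G) :
    IsThetaSum p t (n + m) (ε * ε') (s + s') (fun u ↦ F u * G u) := by
  refine (IsTheta.mul hF hG).of_eq rfl rfl ?_
  rw [mul_add, exp_add, pow_add]
  ring

lemma comp_neg (ht : IsHalfPeriod p t) (hF : IsThetaSum p t n ε s F) (hε : ε * ε = 1) :
    IsThetaSum p t n ε (-s) (fun u ↦ F (-u)) := by
  have hp0 : (p : ℂ) ≠ 0 := by exact_mod_cast ht.ne_zero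
  have hε0 : ε ≠ 0 := left_ne_zero_of_mul (hε ▸ one_ne_zero)
  refine (IsTheta.comp_neg ht hF hε0 (by simp [hp0])).of_eq rfl
    (inv_eq_of_mul_eq_one_left hε) ?_
  rw [mul_inv, ← exp_neg, mul_neg, ← inv_pow, pow_mul, mul_right_comm, ← mul_pow]
  congr 2
  field_simp

lemma comp_sub (hF : IsThetaSum p t n ε s F) (z : ℂ) :
    IsThetaSum p t n ε (s + n * z) (fun u ↦ F (u - z)) := by
  refine (IsTheta.comp_sub hF z).of_eq rfl rfl ?_
  rw [mul_add, exp_add]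
  ring_nf

lemma comp_const_sub (ht : IsHalfPeriod p t) (hF : IsThetaSum p t n ε s F) (hε : ε * ε = 1)
    (z : ℂ) : IsThetaSum p t n ε (-s + n * z) (fun u ↦ F (z - u)) :=
  ((hF.comp_neg ht hε).comp_sub z).congr fun u ↦ by rw [neg_sub]

lemma odd (ht : IsHalfPeriod p t) : IsThetaSum p t 1 (-1) 0 (thetaOdd p) :=
  (IsTheta.thetaOdd ht).of_eq rfl rfl (by simp)

lemma even (ht : IsHalfPeriod p t) : IsThetaSum p t 1 1 0 (theta4 p) :=
  (IsTheta.theta4 ht).of_eq rfl rfl (by simp)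

lemma odd_sub (ht : IsHalfPeriod p t) (a : ℂ) :
    IsThetaSum p t 1 (-1) a (fun u ↦ thetaOdd p (a - u)) :=
  ((odd ht).comp_const_sub ht (by norm_num) a).cast rfl rfl (by simp)

lemma odd_add (ht : IsHalfPeriod p t) (a : ℂ) :
    IsThetaSum p t 1 (-1) (-a) (fun u ↦ thetaOdd p (a + u)) :=
  (((odd ht).comp_sub (-a)).cast rfl rfl (by simp)).congr fun u ↦ by
    rw [sub_neg_eq_add, add_comm]

lemma even_sub (ht : IsHalfPeriod p t) (a : ℂ) :
    IsThetaSum p t 1 1 a (fun u ↦ theta4 p (a - u)) :=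
  ((even ht).comp_const_sub ht (by norm_num) a).cast rfl rfl (by simp)

lemma even_add (ht : IsHalfPeriod p t) (a : ℂ) :
    IsThetaSum p t 1 1 (-a) (fun u ↦ theta4 p (a + u)) :=
  (((even ht).comp_sub (-a)).cast rfl rfl (by simp)).congr fun u ↦ by
    rw [sub_neg_eq_add, add_comm]

lemma norm_exp_eq {s s' : ℂ} (h : s.im = s'.im) : ‖exp (2 * I * s)‖ = ‖exp (2 * I * s')‖ := by
  simp [norm_exp, h]

lemma eq_zero_of_extra_zero (ht : IsHalfPeriod p t) {zs : List ℂ}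
    (hF : IsThetaSum p t zs.length ε s F)
    (hzs : zs.Pairwise fun z w ↦ thetaOdd p (z - w) ≠ 0) (h : ∀ z ∈ zs, F z = 0)
    (hε : ‖ε‖ = 1) (hs : s.im = zs.sum.im) {w : ℂ} (hw : F w = 0)
    (hwz : ∀ z ∈ zs, thetaOdd p (w - z) ≠ 0) (u : ℂ) : F u = 0 :=
  IsTheta.eq_zero_of_extra_zero ht hF hzs h hε
    (by rw [norm_mul, norm_mul, norm_exp_eq hs]) hw hwz u

/-- A theta function of degree `n` with `n` inequivalent zeros which do not add up to its zero
sum, or whose sign under `u ↦ u + π` does not match, is zero. -/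
lemma eq_zero_of_sum_ne (ht : IsHalfPeriod p t) {zs : List ℂ}
    (hF : IsThetaSum p t zs.length ε s F)
    (hzs : zs.Pairwise fun z w ↦ thetaOdd p (z - w) ≠ 0) (h : ∀ z ∈ zs, F z = 0)
    (hε : ‖ε‖ = 1) (hs : s.im = zs.sum.im)
    (hne : ε ≠ (-1) ^ zs.length ∨ thetaOdd p (s - zs.sum) ≠ 0) (u : ℂ) : F u = 0 := by
  have hp0 : (p : ℂ) ≠ 0 := by exact_mod_cast ht.ne_zero
  refine IsTheta.eq_zero_of_multiplier_ne ht hF hzs h hε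
    (by rw [norm_mul, norm_mul, norm_exp_eq hs]) (hne.imp_right fun h1 h2 ↦ h1 ?_) u
  have h3 := mul_left_cancel₀ (pow_ne_zero _ (by simpa using hp0)) h2
  obtain ⟨k, hk⟩ := exp_eq_exp_iff_exists_int.mp h3
  have h4 : s - zs.sum = k * Real.pi := by
    have : (2 * I) * (s - zs.sum) = (2 * I) * (k * Real.pi) := by linear_combination hk
    exact mul_left_cancel₀ (by simp) this
  have h₁ : Function.Periodic (fun z ↦ thetaOdd p z = 0) (Real.pi : ℂ) := fun u ↦ by
    simp only [thetaOdd_add_pi, neg_eq_zero]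
  have e := (h₁.int_mul k) 0
  rw [zero_add] at e
  rw [h4]
  exact e.mpr (thetaOdd_zero p)

end IsThetaSum

lemma theta4_ne_zero {p : ℝ} (hp : |p| < 1) {z : ℂ} (hz : z.im = 0) : theta4 p z ≠ 0 := by
  have : z = (z.re : ℂ) := Complex.ext rfl (by simp [hz])
  rw [this]
  exact theta4_ofReal_ne_zero hp _

lemma thetaOdd_ne_zero_neg {p : ℝ} {z : ℂ} (h : thetaOdd p z ≠ 0) : thetaOdd p (-z) ≠ 0 := by
  rw [thetaOdd_neg]; exact neg_ne_zero.mpr h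

/-- A real zero of `ϑ₁` is a period of `ϑ₄`, and a period or an antiperiod of `ϑ₁`. -/
lemma exists_sign_of_thetaOdd_eq_zero {p : ℝ} (hp : |p| < 1) {z : ℂ} (hz : z.im = 0)
    (h : thetaOdd p z = 0) : ∃ σ : ℂ, σ * σ = 1 ∧
      (∀ x, thetaOdd p (x + z) = σ * thetaOdd p x) ∧ ∀ x, theta4 p (x + z) = theta4 p x := by
  obtain ⟨k, hk⟩ : ∃ k : ℤ, z.re = k * Real.pi := by
    by_contra! hcon
    have e : z = (z.re : ℂ) := Complex.ext rfl (by simp [hz])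
    rw [e] at h
    exact thetaOdd_ofReal_ne_zero hp hcon h
  have e : z = k * Real.pi := Complex.ext (by simp [hk]) (by simp [hz])
  have ha : Function.Antiperiodic (thetaOdd p) (Real.pi : ℂ) := thetaOdd_add_pi p
  have hb : Function.Periodic (theta4 p) (Real.pi : ℂ) := theta4_add_pi p
  refine ⟨((k.negOnePow : ℤ) : ℂ), ?_, fun x ↦ ?_, fun x ↦ ?_⟩
  · rw [← Int.cast_mul, ← Units.val_mul, ← Int.negOnePow_add]
    simp [Int.negOnePow_even (k + k) ⟨k, rfl⟩]
  · rw [e]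
    have := ha.add_int_mul_eq (x := x) k
    rw [this]
  · rw [e]; exact hb.int_mul k x

/-! ### The weights at a single site

All weights around a height `a` depend on `a` through `w = ±2aλ` only. They are rid of square roots
here; `siteRatio` is `S_{a±1} / S_a`. -/

/-- The ratio `S_{a±1} / S_a`, as a function of `w = ±2aλ`. -/
noncomputable def siteRatio (p : ℝ) (l w : ℂ) : ℂ :=
  -(thetaOdd p (2 * w + 4 * l) * theta4 p w) / (theta4 p (w + 2 * l) * thetaOdd p (2 * w))

/-- The weight `W(a, a, a, a)`. -/
noncomputable def siteFlat (p : ℝ) (l w u : ℂ) : ℂ :=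
  thetaOdd p (6 * l - u) * thetaOdd p (3 * l + u) / (thetaOdd p (6 * l) * thetaOdd p (3 * l))
    - (siteRatio p l w * (theta4 p (w - 5 * l) / theta4 p (w + l))
        + siteRatio p l (-w) * (theta4 p (w + 5 * l) / theta4 p (w - l)))
      * (thetaOdd p u * thetaOdd p (3 * l - u) / (thetaOdd p (6 * l) * thetaOdd p (3 * l)))

/-- The weight `W(a ± 1, a, a, a)` without the root of `S_{a±1} / S_a` and the factor `ϑ₁(u)`. -/
noncomputable def siteTip (p : ℝ) (l w u : ℂ) : ℂ :=
  theta4 p (w - 2 * l + u) / (thetaOdd p (3 * l) * theta4 p (w + l))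

/-- The weight `W(a ± 1, a, a ± 1, a)`. -/
noncomputable def siteAlt (p : ℝ) (l w u : ℂ) : ℂ :=
  open Classical in
  if thetaOdd p (2 * w + 2 * l) ≠ 0 then
    thetaOdd p (3 * l - u) * thetaOdd p (2 * w + 2 * l + u)
        / (thetaOdd p (3 * l) * thetaOdd p (2 * w + 2 * l))
      + siteRatio p l w * (thetaOdd p u * thetaOdd p (2 * w - l + u)
          / (thetaOdd p (3 * l) * thetaOdd p (2 * w + 2 * l)))
  else
    thetaOdd p (3 * l + u) * thetaOdd p (2 * w - 4 * l + u)
        / (thetaOdd p (3 * l) * thetaOdd p (2 * w - 4 * l))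
      + (siteRatio p l (-w) * (thetaOdd p (4 * l) / thetaOdd p (2 * l))
          - theta4 p (w - 5 * l) / theta4 p (w + l))
        * (thetaOdd p u * thetaOdd p (2 * w - l + u)
          / (thetaOdd p (3 * l) * thetaOdd p (2 * w - 4 * l)))

/-- The weight `W(a ± 1, a, a ∓ 1, a)` without the root and the factor `-ϑ₁(u)`. -/
noncomputable def siteCross (p : ℝ) (l u : ℂ) : ℂ :=
  thetaOdd p (l - u) / (thetaOdd p (2 * l) * thetaOdd p (3 * l))

/-- The scalar in the inversion relation. -/
noncomputable def inversionFactor (p : ℝ) (l u : ℂ) : ℂ :=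
  thetaOdd p (2 * l - u) * thetaOdd p (2 * l + u)
      * (thetaOdd p (3 * l - u) * thetaOdd p (3 * l + u))
    / (thetaOdd p (2 * l) * thetaOdd p (3 * l)) ^ 2

/-- The conditions on the crossing parameter `l` and on `w` under which the weights at a site are
regular. -/
structure IsSite (p : ℝ) (t l w : ℂ) : Prop where
  halfPeriod : IsHalfPeriod p t
  im_l : l.im = 0
  im_w : w.im = 0
  one : thetaOdd p l ≠ 0
  two : thetaOdd p (2 * l) ≠ 0
  three : thetaOdd p (3 * l) ≠ 0
  six : thetaOdd p (6 * l) ≠ 0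
  two_w : thetaOdd p (2 * w) ≠ 0

namespace IsSite

variable {p : ℝ} {t l w : ℂ}

lemma neg (h : IsSite p t l w) : IsSite p t l (-w) :=
  { h with
    im_w := by simp [h.im_w]
    two_w := by rw [mul_neg]; exact thetaOdd_ne_zero_neg h.two_w }

lemma theta4_ne (h : IsSite p t l w) (m : ℝ) : theta4 p (w + m * l) ≠ 0 :=
  theta4_ne_zero h.halfPeriod.norm_lt_one (by simp [h.im_l, h.im_w])

lemma theta4_ne' (h : IsSite p t l w) (m : ℝ) : theta4 p (w - m * l) ≠ 0 :=
  theta4_ne_zero h.halfPeriod.norm_lt_one (by simp [h.im_l, h.im_w])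

lemma theta4_w (h : IsSite p t l w) : theta4 p w ≠ 0 := by simpa using h.theta4_ne 0
lemma theta4_add (h : IsSite p t l w) : theta4 p (w + l) ≠ 0 := by simpa using h.theta4_ne 1
lemma theta4_sub (h : IsSite p t l w) : theta4 p (w - l) ≠ 0 := by simpa using h.theta4_ne' 1
lemma theta4_add_two (h : IsSite p t l w) : theta4 p (w + 2 * l) ≠ 0 := by
  simpa using h.theta4_ne 2
lemma theta4_sub_two (h : IsSite p t l w) : theta4 p (w - 2 * l) ≠ 0 := by
  simpa using h.theta4_ne' 2

lemma sign (h : IsSite p t l w) (h0 : thetaOdd p (2 * w + 2 * l) = 0) :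
    ∃ σ : ℂ, σ * σ = 1 ∧ (∀ x, thetaOdd p (x + (2 * w + 2 * l)) = σ * thetaOdd p x) ∧
      ∀ x, theta4 p (x + (2 * w + 2 * l)) = theta4 p x :=
  exists_sign_of_thetaOdd_eq_zero h.halfPeriod.norm_lt_one (by simp [h.im_l, h.im_w]) h0

lemma degenerate_ne (h : IsSite p t l w) (h0 : thetaOdd p (2 * w + 2 * l) = 0) :
    thetaOdd p (2 * w - 4 * l) ≠ 0 := by
  obtain ⟨σ, hσ, h1, -⟩ := h.sign h0
  rw [show 2 * w - 4 * l = -(6 * l) + (2 * w + 2 * l) by ring, h1]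
  exact mul_ne_zero (left_ne_zero_of_mul (hσ ▸ one_ne_zero)) (thetaOdd_ne_zero_neg h.six)

lemma siteFlat_neg (p : ℝ) (l w u : ℂ) : siteFlat p l (-w) u = siteFlat p l w u := by
  simp only [siteFlat, neg_neg]
  rw [show -w - 5 * l = -(w + 5 * l) by ring, show -w + l = -(w - l) by ring,
    show -w + 5 * l = -(w - 5 * l) by ring, show -w - l = -(w + l) by ring]
  simp only [theta4_neg]
  ring

lemma siteRatio_neg (p : ℝ) (l w : ℂ) : siteRatio p l (-w)
    = -(thetaOdd p (2 * w - 4 * l) * theta4 p w) / (theta4 p (w - 2 * l) * thetaOdd p (2 * w)) := by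
  rw [siteRatio, show 2 * -w + 4 * l = -(2 * w - 4 * l) by ring,
    show -w + 2 * l = -(w - 2 * l) by ring, show 2 * -w = -(2 * w) by ring]
  simp only [theta4_neg, thetaOdd_neg]
  ring

lemma siteTip_neg (p : ℝ) (l w u : ℂ) : siteTip p l (-w) u
    = theta4 p (w + 2 * l - u) / (thetaOdd p (3 * l) * theta4 p (w - l)) := by
  rw [siteTip, show -w - 2 * l + u = -(w + 2 * l - u) by ring, show -w + l = -(w - l) by ring]
  simp only [theta4_neg]

/-! #### Special values -/

lemma siteAlt_zero (h : IsSite p t l w) : siteAlt p l w 0 = 1 := by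
  have h3 := h.three
  rw [siteAlt]
  split_ifs with h0
  · simp [thetaOdd_zero, h3, h0]
  · have := h.degenerate_ne (not_not.mp h0)
    simp [thetaOdd_zero, h3, this]

lemma siteAlt_three (h : IsSite p t l w) : siteAlt p l w (3 * l) = siteRatio p l w := by
  have h3 := h.three
  rw [siteAlt]
  split_ifs with h0
  · rw [show 2 * w - l + 3 * l = 2 * w + 2 * l by ring]
    simp [thetaOdd_zero, h3, h0]
  · rw [not_not] at h0
    have h6 := h.six
    have h2 := h.two
    have h4 := h.theta4_w
    obtain ⟨σ, hσ, e1, e4⟩ := h.sign h0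
    have hσ0 : σ ≠ 0 := left_ne_zero_of_mul (hσ ▸ one_ne_zero)
    have a1 : thetaOdd p (2 * w - 4 * l + 3 * l) = -(σ * thetaOdd p (3 * l)) := by
      rw [show 2 * w - 4 * l + 3 * l = -(3 * l) + (2 * w + 2 * l) by ring, e1, thetaOdd_neg]; ring
    have a2 : thetaOdd p (2 * w - 4 * l) = -(σ * thetaOdd p (6 * l)) := by
      rw [show 2 * w - 4 * l = -(6 * l) + (2 * w + 2 * l) by ring, e1, thetaOdd_neg]; ring
    have a3 : thetaOdd p (2 * w - l + 3 * l) = 0 := by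
      rw [show 2 * w - l + 3 * l = 2 * w + 2 * l by ring, h0]
    have a4 : thetaOdd p (2 * w + 4 * l) = σ * thetaOdd p (2 * l) := by
      rw [show 2 * w + 4 * l = 2 * l + (2 * w + 2 * l) by ring, e1]
    have a5 : thetaOdd p (2 * w) = -(σ * thetaOdd p (2 * l)) := by
      rw [show 2 * w = -(2 * l) + (2 * w + 2 * l) by ring, e1, thetaOdd_neg]; ring
    have a6 : theta4 p (w + 2 * l) = theta4 p w := by
      rw [show w + 2 * l = -w + (2 * w + 2 * l) by ring, e4, theta4_neg]
    rw [a1, a2, a3, siteRatio.eq_def p l w, a4, a5, a6, show 3 * l + 3 * l = 6 * l by ring]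
    generalize thetaOdd p (6 * l) = x6 at *
    generalize thetaOdd p (3 * l) = x3 at *
    generalize thetaOdd p (2 * l) = x2 at *
    generalize theta4 p w = y at *
    field_simp
    ring

/-- The two expressions for `W(a ± 1, a, a ± 1, a)` agree at `u = -3λ`. -/
lemma siteAlt_neg_three (h : IsSite p t l w) : siteAlt p l w (-(3 * l))
    = theta4 p (w - 5 * l) / theta4 p (w + l)
      - siteRatio p l (-w) * (thetaOdd p (4 * l) / thetaOdd p (2 * l)) := by
  have h3 := h.three
  have h2 := h.two
  have hw := h.theta4_w
  have h2w := h.two_w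
  have hw1 := h.theta4_add
  have hw2 := h.theta4_add_two
  have hw2' := h.theta4_sub_two
  rw [siteAlt]
  split_ifs with h0
  · have A := theta_addition h.halfPeriod (w + 3 * l) (w + l) (w - l) l
    have B := theta_addition h.halfPeriod (w + 5 * l / 2) (w - 7 * l / 2) (w - l / 2) (3 * l / 2)
    rw [show w + 3 * l + (w + l) = 2 * w + 4 * l by ring, show w + 3 * l - (w + l) = 2 * l by ring,
      show w - l + l = w by ring, show w - l - l = w - 2 * l by ring,
      show w + l + (w - l) = 2 * w by ring, show w + l - (w - l) = 2 * l by ring,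
      show w + 3 * l + l = w + 4 * l by ring, show w + 3 * l - l = w + 2 * l by ring,
      show w - l + (w + 3 * l) = 2 * w + 2 * l by ring,
      show w - l - (w + 3 * l) = -(4 * l) by ring, show w + l + l = w + 2 * l by ring,
      show w + l - l = w by ring, thetaOdd_neg] at A
    rw [show w + 5 * l / 2 + (w - 7 * l / 2) = 2 * w - l by ring,
      show w + 5 * l / 2 - (w - 7 * l / 2) = 6 * l by ring,
      show w - l / 2 + 3 * l / 2 = w + l by ring, show w - l / 2 - 3 * l / 2 = w - 2 * l by ring,
      show w - 7 * l / 2 + (w - l / 2) = 2 * w - 4 * l by ring,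
      show w - 7 * l / 2 - (w - l / 2) = -(3 * l) by ring,
      show w + 5 * l / 2 + 3 * l / 2 = w + 4 * l by ring,
      show w + 5 * l / 2 - 3 * l / 2 = w + l by ring,
      show w - l / 2 + (w + 5 * l / 2) = 2 * w + 2 * l by ring,
      show w - l / 2 - (w + 5 * l / 2) = -(3 * l) by ring,
      show w - 7 * l / 2 + 3 * l / 2 = w - 2 * l by ring,
      show w - 7 * l / 2 - 3 * l / 2 = w - 5 * l by ring, thetaOdd_neg] at B
    rw [show 3 * l - -(3 * l) = 6 * l by ring,
      show 2 * w + 2 * l + -(3 * l) = 2 * w - l by ring, thetaOdd_neg,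
      show 2 * w - l + -(3 * l) = 2 * w - 4 * l by ring, siteRatio_neg, siteRatio]
    generalize thetaOdd p (6 * l) = a at *
    generalize thetaOdd p (3 * l) = b at *
    generalize thetaOdd p (2 * l) = c at *
    generalize thetaOdd p (4 * l) = d at *
    generalize thetaOdd p (2 * w - l) = e at *
    generalize thetaOdd p (2 * w + 2 * l) = f at *
    generalize thetaOdd p (2 * w + 4 * l) = g at *
    generalize thetaOdd p (2 * w) = k at *
    generalize thetaOdd p (2 * w - 4 * l) = m at *
    generalize theta4 p w = q0 at *
    generalize theta4 p (w + l) = q1 at *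
    generalize theta4 p (w + 2 * l) = q2 at *
    generalize theta4 p (w - 2 * l) = r2 at *
    generalize theta4 p (w + 4 * l) = q4 at *
    generalize theta4 p (w - 5 * l) = r5 at *
    field_simp
    linear_combination b * m * q1 * A + c * k * q2 * B
  · have hd := h.degenerate_ne (not_not.mp h0)
    rw [add_neg_cancel, thetaOdd_zero, thetaOdd_neg,
      show 2 * w - l + -(3 * l) = 2 * w - 4 * l by ring]
    generalize thetaOdd p (3 * l) = b at *
    generalize thetaOdd p (2 * w - 4 * l) = m at *
    field_simp
    ring

/-- The value needed for the inversion relation at `u = 2λ`. -/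
lemma siteAlt_two (h : IsSite p t l w) : siteAlt p l w (2 * l)
    = siteRatio p l w
      * (thetaOdd p l * theta4 p (w - l) / (thetaOdd p (3 * l) * theta4 p (w + l))) := by
  have h3 := h.three
  have h2 := h.two
  have hw := h.theta4_w
  have h2w := h.two_w
  have hw1 := h.theta4_add
  have hw2 := h.theta4_add_two
  have hw2' := h.theta4_sub_two
  rw [siteAlt]
  split_ifs with h0
  · have A := theta_addition h.halfPeriod (w + l / 2) (w - l / 2) (w + 3 * l / 2) (l / 2)
    rw [show w + l / 2 + (w - l / 2) = 2 * w by ring, show w + l / 2 - (w - l / 2) = l by ring,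
      show w + 3 * l / 2 + l / 2 = w + 2 * l by ring, show w + 3 * l / 2 - l / 2 = w + l by ring,
      show w - l / 2 + (w + 3 * l / 2) = 2 * w + l by ring,
      show w - l / 2 - (w + 3 * l / 2) = -(2 * l) by ring,
      show w + l / 2 + l / 2 = w + l by ring, show w + l / 2 - l / 2 = w by ring,
      show w + 3 * l / 2 + (w + l / 2) = 2 * w + 2 * l by ring,
      show w + 3 * l / 2 - (w + l / 2) = l by ring, show w - l / 2 + l / 2 = w by ring,
      show w - l / 2 - l / 2 = w - l by ring, thetaOdd_neg] at A
    rw [show 3 * l - 2 * l = l by ring, show 2 * w + 2 * l + 2 * l = 2 * w + 4 * l by ring,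
      show 2 * w - l + 2 * l = 2 * w + l by ring, siteRatio]
    generalize thetaOdd p (3 * l) = b at *
    generalize thetaOdd p (2 * l) = c at *
    generalize thetaOdd p l = o at *
    generalize thetaOdd p (2 * w + l) = n at *
    generalize thetaOdd p (2 * w + 2 * l) = f at *
    generalize thetaOdd p (2 * w + 4 * l) = g at *
    generalize thetaOdd p (2 * w) = k at *
    generalize theta4 p w = q0 at *
    generalize theta4 p (w + l) = q1 at *
    generalize theta4 p (w + 2 * l) = q2 at *
    generalize theta4 p (w - l) = r1 at *
    field_simp
    linear_combination g * A
  · have hd := h.degenerate_ne (not_not.mp h0)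
    have A := theta_addition h.halfPeriod (w + 3 * l / 2) (w - 7 * l / 2) (w - l / 2) (3 * l / 2)
    have B := theta_addition h.halfPeriod (w + 3 * l / 2) (w - 3 * l / 2) (w + 5 * l / 2) (l / 2)
    rw [show w + 3 * l / 2 + (w - 7 * l / 2) = 2 * w - 2 * l by ring,
      show w + 3 * l / 2 - (w - 7 * l / 2) = 5 * l by ring,
      show w - l / 2 + 3 * l / 2 = w + l by ring, show w - l / 2 - 3 * l / 2 = w - 2 * l by ring,
      show w - 7 * l / 2 + (w - l / 2) = 2 * w - 4 * l by ring,
      show w - 7 * l / 2 - (w - l / 2) = -(3 * l) by ring,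
      show w + 3 * l / 2 + 3 * l / 2 = w + 3 * l by ring,
      show w + 3 * l / 2 - 3 * l / 2 = w by ring,
      show w - l / 2 + (w + 3 * l / 2) = 2 * w + l by ring,
      show w - l / 2 - (w + 3 * l / 2) = -(2 * l) by ring,
      show w - 7 * l / 2 + 3 * l / 2 = w - 2 * l by ring,
      show w - 7 * l / 2 - 3 * l / 2 = w - 5 * l by ring, thetaOdd_neg, thetaOdd_neg] at A
    rw [show w + 3 * l / 2 + (w - 3 * l / 2) = 2 * w by ring,
      show w + 3 * l / 2 - (w - 3 * l / 2) = 3 * l by ring,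
      show w + 5 * l / 2 + l / 2 = w + 3 * l by ring,
      show w + 5 * l / 2 - l / 2 = w + 2 * l by ring,
      show w - 3 * l / 2 + (w + 5 * l / 2) = 2 * w + l by ring,
      show w - 3 * l / 2 - (w + 5 * l / 2) = -(4 * l) by ring,
      show w + 3 * l / 2 + l / 2 = w + 2 * l by ring,
      show w + 3 * l / 2 - l / 2 = w + l by ring,
      show w + 5 * l / 2 + (w + 3 * l / 2) = 2 * w + 4 * l by ring,
      show w + 5 * l / 2 - (w + 3 * l / 2) = l by ring,
      show w - 3 * l / 2 + l / 2 = w - l by ring,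
      show w - 3 * l / 2 - l / 2 = w - 2 * l by ring, thetaOdd_neg] at B
    rw [show 3 * l + 2 * l = 5 * l by ring, show 2 * w - 4 * l + 2 * l = 2 * w - 2 * l by ring,
      show 2 * w - l + 2 * l = 2 * w + l by ring, siteRatio_neg, siteRatio]
    generalize thetaOdd p (5 * l) = s5 at *
    generalize thetaOdd p (4 * l) = d at *
    generalize thetaOdd p (3 * l) = b at *
    generalize thetaOdd p (2 * l) = c at *
    generalize thetaOdd p l = o at *
    generalize thetaOdd p (2 * w + l) = n at *
    generalize thetaOdd p (2 * w - 2 * l) = y at *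
    generalize thetaOdd p (2 * w + 4 * l) = g at *
    generalize thetaOdd p (2 * w - 4 * l) = m at *
    generalize thetaOdd p (2 * w) = k at *
    generalize theta4 p w = q0 at *
    generalize theta4 p (w + l) = q1 at *
    generalize theta4 p (w + 2 * l) = q2 at *
    generalize theta4 p (w + 3 * l) = q3 at *
    generalize theta4 p (w - l) = r1 at *
    generalize theta4 p (w - 2 * l) = r2 at *
    generalize theta4 p (w - 5 * l) = r5 at *
    field_simp
    linear_combination k * q2 * A + m * q0 * B

/-- The ratios `S_{a+1} / S_a` and `S_a / S_{a+1}`, as functions of `w = 2aλ` and `-2(a+1)λ`. -/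
lemma siteRatio_mul (h : IsSite p t l w) (hw4 : thetaOdd p (2 * w + 4 * l) ≠ 0) :
    siteRatio p l w * siteRatio p l (-w - 2 * l) = 1 := by
  have hw := h.theta4_w
  have h2w := h.two_w
  have hw2 := h.theta4_add_two
  rw [siteRatio, siteRatio, show 2 * (-w - 2 * l) + 4 * l = -(2 * w) by ring,
    show -w - 2 * l + 2 * l = -w by ring, show 2 * (-w - 2 * l) = -(2 * w + 4 * l) by ring,
    show -w - 2 * l = -(w + 2 * l) by ring]
  simp only [theta4_neg, thetaOdd_neg]
  generalize thetaOdd p (2 * w + 4 * l) = g at *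
  generalize thetaOdd p (2 * w) = k at *
  generalize theta4 p w = q0 at *
  generalize theta4 p (w + 2 * l) = q2 at *
  field_simp

/-- Crossing symmetry of `W(a ± 1, a, a ± 1, a)`. -/
lemma siteAlt_crossing (h : IsSite p t l w) (hw4 : thetaOdd p (2 * w + 4 * l) ≠ 0) (u : ℂ) :
    siteAlt p l w (3 * l - u) = siteRatio p l w * siteAlt p l (-w - 2 * l) u := by
  have hr := h.siteRatio_mul hw4
  have h3 := h.three
  rw [siteAlt, siteAlt]
  have e : thetaOdd p (2 * (-w - 2 * l) + 2 * l) = -thetaOdd p (2 * w + 2 * l) := by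
    rw [← thetaOdd_neg]; congr 1; ring
  simp only [e, ne_eq, neg_eq_zero]
  split_ifs with h0
  · -- degenerate case: both sides are the second expression at the same site, up to a period
    obtain ⟨σ, hσ, e1, e4⟩ := h.sign h0
    have b1 : ∀ x, thetaOdd p (2 * (-w - 2 * l) + x) = thetaOdd p (2 * w + x) := fun x ↦ by
      rw [show 2 * w + x = 2 * (-w - 2 * l) + x + (2 * w + 2 * l) + (2 * w + 2 * l) by ring, e1, e1,
        ← mul_assoc, hσ, one_mul]
    have b2 : ∀ x, theta4 p (-w - 2 * l + x) = theta4 p (w + x) := fun x ↦ by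
      rw [← e4 (-w - 2 * l + x)]; congr 1; ring
    have b3 := b1 0
    have b4 := b2 0
    rw [add_zero, add_zero] at b3 b4
    have b5 : siteRatio p l (-(-w - 2 * l)) = siteRatio p l (-w) := by
      rw [siteRatio_neg, siteRatio_neg, sub_eq_add_neg (2 * (-w - 2 * l)), b1,
        sub_eq_add_neg (-w - 2 * l) (2 * l), b2, b3, b4]
      simp only [sub_eq_add_neg]
    have b6 : siteRatio p l w = 1 := by
      have h2 := h.two
      have hw := h.theta4_w
      have hσ0 : σ ≠ 0 := left_ne_zero_of_mul (hσ ▸ one_ne_zero)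
      rw [siteRatio, show 2 * w + 4 * l = 2 * l + (2 * w + 2 * l) by ring, e1,
        show w + 2 * l = -w + (2 * w + 2 * l) by ring, e4, theta4_neg,
        show thetaOdd p (2 * w) = thetaOdd p (-(2 * l) + (2 * w + 2 * l)) by congr 1; ring, e1,
        thetaOdd_neg]
      generalize thetaOdd p (2 * l) = c at *
      generalize theta4 p w = q0 at *
      field_simp
    have b7 : thetaOdd p (2 * (-w - 2 * l) - 4 * l) = thetaOdd p (2 * w - 4 * l) := by
      rw [sub_eq_add_neg, b1, sub_eq_add_neg (2 * w)]
    have b8 : thetaOdd p (2 * (-w - 2 * l) - 4 * l + u) = -(σ * thetaOdd p (6 * l - u)) := by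
      rw [show 2 * (-w - 2 * l) - 4 * l + u = 2 * (-w - 2 * l) + (-(4 * l) + u) by ring, b1,
        show 2 * w + (-(4 * l) + u) = -(6 * l - u) + (2 * w + 2 * l) by ring, e1, thetaOdd_neg]
      ring
    have b9 : thetaOdd p (2 * (-w - 2 * l) - l + u) = -(σ * thetaOdd p (3 * l - u)) := by
      rw [show 2 * (-w - 2 * l) - l + u = 2 * (-w - 2 * l) + (-l + u) by ring, b1,
        show 2 * w + (-l + u) = -(3 * l - u) + (2 * w + 2 * l) by ring, e1, thetaOdd_neg]
      ring
    have c1 : thetaOdd p (2 * w - 4 * l + (3 * l - u)) = -(σ * thetaOdd p (3 * l + u)) := by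
      rw [show 2 * w - 4 * l + (3 * l - u) = -(3 * l + u) + (2 * w + 2 * l) by ring, e1,
        thetaOdd_neg]
      ring
    have c2 : thetaOdd p (2 * w - l + (3 * l - u)) = -(σ * thetaOdd p u) := by
      rw [show 2 * w - l + (3 * l - u) = -u + (2 * w + 2 * l) by ring, e1, thetaOdd_neg]
      ring
    rw [b5, b6, b7, b8, b9, c1, c2, sub_eq_add_neg (-w - 2 * l) (5 * l), b2, b2,
      show 3 * l + (3 * l - u) = 6 * l - u by ring, sub_eq_add_neg w (5 * l)]
    ring
  · rw [show 3 * l - (3 * l - u) = u by ring,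
      show 2 * (-w - 2 * l) + 2 * l + u = -(2 * w + 2 * l + -u) by ring,
      show 2 * (-w - 2 * l) - l + u = -(2 * w - l + (3 * l - u) + 3 * l) by ring,
      show 2 * w - l + (3 * l - u) = 2 * w + 2 * l + -u by ring,
      show 2 * w + 2 * l + -u + 3 * l = 2 * w + 2 * l + (3 * l - u) by ring]
    simp only [thetaOdd_neg]
    generalize thetaOdd p (2 * w + 2 * l) = f at *
    generalize thetaOdd p (3 * l) = b at *
    generalize thetaOdd p (2 * w + 2 * l + (3 * l - u)) = x at *
    generalize thetaOdd p u = y at *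
    generalize siteRatio p l (-w - 2 * l) = r' at *
    field_simp
    linear_combination (-(y * x)) * hr

/-! #### Zero sums -/

lemma siteFlat_isThetaSum (ht : IsHalfPeriod p t) (l w : ℂ) :
    IsThetaSum p t 2 1 (3 * l) (siteFlat p l w) :=
  ((((IsThetaSum.odd_sub ht (6 * l)).mul (IsThetaSum.odd_add ht (3 * l))).div_const _).cast rfl
    (by norm_num) (by ring)).sub
    (((((IsThetaSum.odd ht).mul (IsThetaSum.odd_sub ht (3 * l))).div_const _).const_mul _).cast rfl
    (by norm_num) (by ring))

lemma siteTip_isThetaSum (ht : IsHalfPeriod p t) (l w : ℂ) :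
    IsThetaSum p t 1 1 (2 * l - w) (siteTip p l w) :=
  ((IsThetaSum.even_add ht (w - 2 * l)).div_const _).cast rfl rfl (by ring)

lemma siteAlt_isThetaSum (ht : IsHalfPeriod p t) (l w : ℂ) :
    IsThetaSum p t 2 1 (l - 2 * w) (siteAlt p l w) := by
  by_cases h0 : thetaOdd p (2 * w + 2 * l) = 0
  · have e : siteAlt p l w = fun u ↦ thetaOdd p (3 * l + u) * thetaOdd p (2 * w - 4 * l + u)
        / (thetaOdd p (3 * l) * thetaOdd p (2 * w - 4 * l))
      + (siteRatio p l (-w) * (thetaOdd p (4 * l) / thetaOdd p (2 * l))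
          - theta4 p (w - 5 * l) / theta4 p (w + l))
        * (thetaOdd p u * thetaOdd p (2 * w - l + u)
          / (thetaOdd p (3 * l) * thetaOdd p (2 * w - 4 * l))) := by
      funext u; rw [siteAlt, if_neg (not_not.mpr h0)]
    rw [e]
    exact ((((IsThetaSum.odd_add ht (3 * l)).mul
      (IsThetaSum.odd_add ht (2 * w - 4 * l))).div_const _).cast rfl (by norm_num) (by ring)).add
      (((((IsThetaSum.odd ht).mul (IsThetaSum.odd_add ht (2 * w - l))).div_const _).const_mul
      _).cast rfl (by norm_num) (by ring))
  · have e : siteAlt p l w = fun u ↦ thetaOdd p (3 * l - u) * thetaOdd p (2 * w + 2 * l + u)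
        / (thetaOdd p (3 * l) * thetaOdd p (2 * w + 2 * l))
      + siteRatio p l w * (thetaOdd p u * thetaOdd p (2 * w - l + u)
          / (thetaOdd p (3 * l) * thetaOdd p (2 * w + 2 * l))) := by
      funext u; rw [siteAlt, if_pos h0]
    rw [e]
    exact ((((IsThetaSum.odd_sub ht (3 * l)).mul
      (IsThetaSum.odd_add ht (2 * w + 2 * l))).div_const _).cast rfl (by norm_num) (by ring)).add
      (((((IsThetaSum.odd ht).mul (IsThetaSum.odd_add ht (2 * w - l))).div_const _).const_mul
      _).cast rfl (by norm_num) (by ring))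

lemma siteCross_isThetaSum (ht : IsHalfPeriod p t) (l : ℂ) :
    IsThetaSum p t 1 (-1) l (siteCross p l) :=
  (IsThetaSum.odd_sub ht l).div_const _

lemma inversionFactor_isThetaSum (ht : IsHalfPeriod p t) (l : ℂ) :
    IsThetaSum p t 4 1 0 (inversionFactor p l) :=
  ((((IsThetaSum.odd_sub ht (2 * l)).mul (IsThetaSum.odd_add ht (2 * l))).mul
    ((IsThetaSum.odd_sub ht (3 * l)).mul (IsThetaSum.odd_add ht (3 * l)))).div_const _).cast rfl
    (by norm_num) (by ring)

end IsSite

namespace IsSite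

variable {p : ℝ} {t l w : ℂ}

lemma siteFlat_zero (h : IsSite p t l w) : siteFlat p l w 0 = 1 := by
  have h3 := h.three
  have h6 := h.six
  rw [siteFlat, thetaOdd_zero, zero_mul, zero_div, mul_zero, sub_zero, sub_zero, add_zero, div_self]
  exact mul_ne_zero h6 h3

lemma siteFlat_three (h : IsSite p t l w) : siteFlat p l w (3 * l) = 1 := by
  have h3 := h.three
  have h6 := h.six
  rw [siteFlat, sub_self, thetaOdd_zero, mul_zero, zero_div, mul_zero, sub_zero,
    show 6 * l - 3 * l = 3 * l by ring, show 3 * l + 3 * l = 6 * l by ring, mul_comm, div_self]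
  exact mul_ne_zero h6 h3

lemma siteFlat_neg_three (h : IsSite p t l w) : siteFlat p l w (-(3 * l))
    = siteRatio p l w * (theta4 p (w - 5 * l) / theta4 p (w + l))
        + siteRatio p l (-w) * (theta4 p (w + 5 * l) / theta4 p (w - l)) := by
  have h3 := h.three
  have h6 := h.six
  rw [siteFlat, add_neg_cancel, thetaOdd_zero, mul_zero, zero_div, thetaOdd_neg,
    show 3 * l - -(3 * l) = 6 * l by ring]
  generalize thetaOdd p (3 * l) = b at *
  generalize thetaOdd p (6 * l) = a at *
  field_simp
  ring

lemma siteTip_three (h : IsSite p t l w) : siteTip p l w (3 * l) = (thetaOdd p (3 * l))⁻¹ := by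
  have hw := h.theta4_add
  rw [siteTip, show w - 2 * l + 3 * l = w + l by ring]
  generalize theta4 p (w + l) = q at *
  field_simp

lemma siteTip_neg_three (p : ℝ) (l w : ℂ) : siteTip p l w (-(3 * l))
    = theta4 p (w - 5 * l) / theta4 p (w + l) * (thetaOdd p (3 * l))⁻¹ := by
  rw [siteTip, show w - 2 * l + -(3 * l) = w - 5 * l by ring]
  ring

/-- The three points `0`, `±3λ` are inequivalent. -/
lemma pairwise_three (h : IsSite p t l w) :
    ([0, 3 * l, -(3 * l)] : List ℂ).Pairwise fun z w ↦ thetaOdd p (z - w) ≠ 0 := by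
  have h3 := h.three
  have h6 := h.six
  simp only [List.pairwise_cons, List.mem_cons, List.not_mem_nil, or_false, forall_eq_or_imp,
    forall_eq, List.Pairwise.nil, and_true, IsEmpty.forall_iff, implies_true]
  refine ⟨⟨?_, ?_⟩, ?_⟩
  · rw [zero_sub]; exact thetaOdd_ne_zero_neg h3
  · rwa [zero_sub, neg_neg]
  · rwa [show 3 * l - -(3 * l) = 6 * l by ring]

/-! #### Inversion at a site

The product of the matrices of weights at `u` and `-u` around a site is scalar. Each entry is a
theta function of `u` with more zeros than its degree allows: it vanishes at `0` and `±3λ`. -/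

/-- The entry `(a, a ± 1)` of the inversion relation. -/
lemma inversion_flat_tip (h : IsSite p t l w) (u : ℂ) :
    siteTip p l w u * siteAlt p l w (-u) - siteFlat p l w u * siteTip p l w (-u)
      + siteRatio p l (-w) * (siteTip p l (-w) u * (thetaOdd p u * siteCross p l (-u))) = 0 := by
  have ht := h.halfPeriod
  have hA := siteAlt_isThetaSum ht l w
  have hT := siteTip_isThetaSum ht l w
  have hT' := siteTip_isThetaSum ht l (-w)
  have hF := siteFlat_isThetaSum ht l w
  have hC := siteCross_isThetaSum ht l
  have key := (((hT.mul (hA.comp_neg ht (by norm_num))).sub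
    ((hF.mul (hT.comp_neg ht (by norm_num))).cast (m := 3) (s' := w + l) rfl (by norm_num)
      (by ring) |>.cast rfl rfl (by ring))).add
    ((((hT'.mul ((IsThetaSum.odd ht).mul (hC.comp_neg ht (by norm_num)))).const_mul
      (siteRatio p l (-w))).cast (m := 3) rfl (by norm_num) (by ring))))
  have h3 := h.three
  have h2 := h.two
  refine IsThetaSum.eq_zero_of_sum_ne (zs := [0, 3 * l, -(3 * l)]) ht key h.pairwise_three ?_
    (by simp) ?_ (Or.inl ?_) u
  · simp only [List.mem_cons, List.not_mem_nil, or_false, forall_eq_or_imp, forall_eq]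
    refine ⟨?_, ?_, ?_⟩
    · rw [neg_zero, h.siteAlt_zero, h.siteFlat_zero, thetaOdd_zero]; ring
    · rw [h.siteAlt_neg_three, h.siteFlat_three, h.siteTip_three, h.neg.siteTip_three,
        siteTip_neg_three, siteCross, show l - -(3 * l) = 4 * l by ring]
      generalize thetaOdd p (2 * l) = c at *
      generalize thetaOdd p (3 * l) = b at *
      field_simp
      ring
    · rw [neg_neg, h.siteAlt_three, h.siteFlat_neg_three, h.siteTip_three,
        siteTip_neg_three, siteTip_neg_three, siteCross, show l - 3 * l = -(2 * l) by ring,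
        thetaOdd_neg, thetaOdd_neg, show -w - 5 * l = -(w + 5 * l) by ring,
        show -w + l = -(w - l) by ring, theta4_neg, theta4_neg]
      generalize thetaOdd p (2 * l) = c at *
      generalize thetaOdd p (3 * l) = b at *
      field_simp
      ring
  · simp [h.im_l, h.im_w]
  · norm_num

/-- The entry `(a ± 1, a ∓ 1)` of the inversion relation. -/
lemma inversion_alt_cross (h : IsSite p t l w) (u : ℂ) :
    siteAlt p l w u * siteCross p l (-u) - siteCross p l u * siteAlt p l (-w) (-u)
      - thetaOdd p u * (siteTip p l w u * siteTip p l (-w) (-u)) = 0 := by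
  have ht := h.halfPeriod
  have hA := siteAlt_isThetaSum ht l w
  have hA' := siteAlt_isThetaSum ht l (-w)
  have hT := siteTip_isThetaSum ht l w
  have hT' := siteTip_isThetaSum ht l (-w)
  have hC := siteCross_isThetaSum ht l
  have key := (((hA.mul (hC.comp_neg ht (by norm_num))).cast (m := 3) (s' := -(2 * w)) rfl
      (one_mul _) (by ring)).sub
    ((hC.mul (hA'.comp_neg ht (by norm_num))).cast (m := 3) (s' := -(2 * w)) rfl
      (mul_one _) (by ring))).sub
    (((IsThetaSum.odd ht).mul (hT.mul (hT'.comp_neg ht (by norm_num)))).cast (m := 3)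
      (s' := -(2 * w)) rfl (by norm_num) (by ring))
  have h3 := h.three
  have h2 := h.two
  have hw := h.theta4_add
  have hw' := h.theta4_sub
  refine IsThetaSum.eq_zero_of_sum_ne (zs := [0, 3 * l, -(3 * l)]) ht key h.pairwise_three ?_
    (by simp) ?_ (Or.inr ?_) u
  · simp only [List.mem_cons, List.not_mem_nil, or_false, forall_eq_or_imp, forall_eq]
    have e1 : siteCross p l (3 * l) = -(thetaOdd p (3 * l))⁻¹ := by
      rw [siteCross, show l - 3 * l = -(2 * l) by ring, thetaOdd_neg]
      generalize thetaOdd p (2 * l) = c at *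
      field_simp
    have e2 : siteCross p l (-(3 * l))
        = thetaOdd p (4 * l) / thetaOdd p (2 * l) * (thetaOdd p (3 * l))⁻¹ := by
      rw [siteCross, show l - -(3 * l) = 4 * l by ring]
      ring
    refine ⟨?_, ?_, ?_⟩
    · rw [neg_zero, h.siteAlt_zero, h.neg.siteAlt_zero, thetaOdd_zero]; ring
    · rw [h.siteAlt_three, h.neg.siteAlt_neg_three, h.siteTip_three, siteTip_neg_three, e1, e2,
        neg_neg]
      generalize thetaOdd p (3 * l) = b at *
      field_simp
      ring
    · rw [neg_neg, h.siteAlt_neg_three, h.neg.siteAlt_three, h.neg.siteTip_three,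
        siteTip_neg_three, e1, e2, thetaOdd_neg]
      generalize thetaOdd p (3 * l) = b at *
      field_simp
      ring
  · simp [h.im_w]
  · have := thetaOdd_ne_zero_neg h.two_w
    simpa using this

end IsSite

namespace IsSite

variable {p : ℝ} {t l w : ℂ}

lemma siteCross_two (p : ℝ) (l : ℂ) :
    siteCross p l (2 * l) = -(thetaOdd p l / (thetaOdd p (2 * l) * thetaOdd p (3 * l))) := by
  rw [siteCross, show l - 2 * l = -l by ring, thetaOdd_neg]
  ring

lemma siteCross_neg_two (h : IsSite p t l w) :
    siteCross p l (-(2 * l)) = (thetaOdd p (2 * l))⁻¹ := by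
  have h3 := h.three
  rw [siteCross, show l - -(2 * l) = 3 * l by ring]
  generalize thetaOdd p (3 * l) = b at *
  generalize thetaOdd p (2 * l) = c at *
  field_simp

/-- Follows from the relations `inversion_flat_tip` and `inversion_alt_cross` at `u = ±2λ`. -/
lemma siteFlat_two (h : IsSite p t l w) : siteFlat p l w (2 * l)
    = thetaOdd p (2 * l) ^ 2 * theta4 p w ^ 2
      / (thetaOdd p l * thetaOdd p (3 * l) * (theta4 p (w + l) * theta4 p (w - l))) := by
  have A := h.inversion_flat_tip (2 * l)
  have B := h.inversion_alt_cross (-(2 * l))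
  have h1 := h.one
  have h2 := h.two
  have h3 := h.three
  have hw1 := h.theta4_add
  have hw2 := h.theta4_sub
  have hw4 : theta4 p (w - 4 * l) ≠ 0 := by simpa using h.theta4_ne' 4
  rw [neg_neg, siteCross_two, h.siteCross_neg_two, h.neg.siteAlt_two, siteTip_neg, siteTip,
    show -w - l = -(w + l) by ring, show -w + l = -(w - l) by ring, theta4_neg, theta4_neg,
    thetaOdd_neg, show w - 2 * l + -(2 * l) = w - 4 * l by ring,
    show w + 2 * l - 2 * l = w by ring] at B
  rw [h.siteCross_neg_two, siteTip_neg, siteTip, siteTip,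
    show w - 2 * l + -(2 * l) = w - 4 * l by ring, show w + 2 * l - 2 * l = w by ring,
    show w - 2 * l + 2 * l = w by ring] at A
  generalize thetaOdd p (3 * l) = b at *
  generalize thetaOdd p (2 * l) = c at *
  generalize thetaOdd p l = o at *
  generalize theta4 p w = q0 at *
  generalize theta4 p (w + l) = q1 at *
  generalize theta4 p (w - l) = r1 at *
  generalize theta4 p (w - 4 * l) = r4 at *
  generalize siteRatio p l (-w) = r at *
  generalize siteAlt p l w (-(2 * l)) = x at *
  generalize siteFlat p l w (2 * l) = y at *
  field_simp at A B ⊢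
  refine mul_left_cancel₀ hw4 ?_
  linear_combination (-b * q1 * o) * A - q0 * B

lemma inversion_side (ht : IsHalfPeriod p t) (l w u : ℂ) :
    theta4 p (w + l - u) * theta4 p (w + l + u) * thetaOdd p (2 * l) ^ 2
      - theta4 p (w + 3 * l) * theta4 p (w - l) * thetaOdd p u ^ 2
      = thetaOdd p (2 * l - u) * thetaOdd p (2 * l + u) * theta4 p (w + l) ^ 2 := by
  have A := theta_addition ht (2 * l) u 0 (w + l)
  rw [zero_add, zero_sub, theta4_neg, add_zero, sub_zero, zero_add, zero_sub, thetaOdd_neg,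
    show 2 * l + (w + l) = w + 3 * l by ring, show 2 * l - (w + l) = -(w - l) by ring, theta4_neg,
    show u + (w + l) = w + l + u by ring, show u - (w + l) = -(w + l - u) by ring, theta4_neg] at A
  linear_combination -A

end IsSite

end DiluteA

namespace DiluteA

open Complex Filter Topology

namespace IsSite

variable {p : ℝ} {t l w : ℂ}

/-- The points `0`, `±3λ`, `2λ` are inequivalent if `ϑ₁(5λ) ≠ 0`, and they do not add up to the zero
sum `0`. -/
lemma inversion_flat_of_five (h : IsSite p t l w) (h5 : thetaOdd p (5 * l) ≠ 0) (u : ℂ) :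
    siteFlat p l w u * siteFlat p l w (-u)
      - siteRatio p l w * (thetaOdd p u ^ 2 * (siteTip p l w u * siteTip p l w (-u)))
      - siteRatio p l (-w) * (thetaOdd p u ^ 2 * (siteTip p l (-w) u * siteTip p l (-w) (-u)))
      - inversionFactor p l u = 0 := by
  have ht := h.halfPeriod
  have hO := IsThetaSum.odd ht
  have hT := siteTip_isThetaSum ht l w
  have hT' := siteTip_isThetaSum ht l (-w)
  have hF := siteFlat_isThetaSum ht l w
  have hR := inversionFactor_isThetaSum ht l
  have hOO : IsThetaSum p t 2 1 0 fun u ↦ thetaOdd p u ^ 2 :=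
    ((hO.mul hO).cast rfl (by norm_num) (by ring)).congr fun u ↦ by ring
  have key := ((((hF.mul (hF.comp_neg ht (by norm_num))).cast (m := 4) (ε' := 1) (s' := 0) rfl
      (by norm_num) (by ring)).sub
    (((hOO.mul (hT.mul (hT.comp_neg ht (by norm_num)))).const_mul (siteRatio p l w)).cast
      (m := 4) rfl (by norm_num) (by ring))).sub
    (((hOO.mul (hT'.mul (hT'.comp_neg ht (by norm_num)))).const_mul (siteRatio p l (-w))).cast
      (m := 4) rfl (by norm_num) (by ring))).sub hR
  have h1 := h.one
  have h3 := h.three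
  have h2 := h.two
  have h6 := h.six
  refine IsThetaSum.eq_zero_of_sum_ne (zs := [0, 3 * l, -(3 * l), 2 * l]) ht key ?_ ?_
    (by simp) ?_ (Or.inr ?_) u
  · simp only [List.pairwise_cons, List.mem_cons, List.not_mem_nil, or_false, forall_eq_or_imp,
      forall_eq, List.Pairwise.nil, and_true, IsEmpty.forall_iff, implies_true]
    refine ⟨⟨?_, ?_, ?_⟩, ⟨?_, ?_⟩, ?_⟩
    · rw [zero_sub]; exact thetaOdd_ne_zero_neg h3
    · rwa [zero_sub, neg_neg]
    · rw [zero_sub]; exact thetaOdd_ne_zero_neg h2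
    · rwa [show 3 * l - -(3 * l) = 6 * l by ring]
    · rwa [show 3 * l - 2 * l = l by ring]
    · rw [show -(3 * l) - 2 * l = -(5 * l) by ring]; exact thetaOdd_ne_zero_neg h5
  · simp only [List.mem_cons, List.not_mem_nil, or_false, forall_eq_or_imp, forall_eq]
    have e3 : ∀ v, siteTip p l v (3 * l) * siteTip p l v (-(3 * l)) * thetaOdd p (3 * l) ^ 2
        = theta4 p (v - 5 * l) / theta4 p (v + l) * (siteTip p l v (3 * l) * thetaOdd p (3 * l)) :=
      fun v ↦ by
        rw [siteTip_neg_three]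
        generalize thetaOdd p (3 * l) = b at *
        field_simp
    refine ⟨?_, ?_, ?_, ?_⟩
    · rw [neg_zero, h.siteFlat_zero, thetaOdd_zero, inversionFactor]
      simp only [add_zero, sub_zero]
      generalize thetaOdd p (2 * l) = c at *
      generalize thetaOdd p (3 * l) = b at *
      field_simp
      ring
    · have e := e3 w
      have e' := e3 (-w)
      rw [h.siteTip_three, inv_mul_cancel₀ h3] at e
      rw [h.neg.siteTip_three, inv_mul_cancel₀ h3, show -w - 5 * l = -(w + 5 * l) by ring,
        show -w + l = -(w - l) by ring, theta4_neg, theta4_neg] at e'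
      rw [h.siteFlat_three, h.siteFlat_neg_three, inversionFactor, sub_self, thetaOdd_zero,
        h.siteTip_three, h.neg.siteTip_three]
      linear_combination (-siteRatio p l w) * e - siteRatio p l (-w) * e'
    · have e := e3 w
      have e' := e3 (-w)
      rw [h.siteTip_three, inv_mul_cancel₀ h3] at e
      rw [h.neg.siteTip_three, inv_mul_cancel₀ h3, show -w - 5 * l = -(w + 5 * l) by ring,
        show -w + l = -(w - l) by ring, theta4_neg, theta4_neg] at e'
      rw [neg_neg, h.siteFlat_three, h.siteFlat_neg_three, inversionFactor, add_neg_cancel,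
        thetaOdd_zero, thetaOdd_neg, h.siteTip_three, h.neg.siteTip_three]
      linear_combination (-siteRatio p l w) * e - siteRatio p l (-w) * e'
    · have e := h.inversion_flat_tip (-(2 * l))
      have hq0 := h.theta4_w
      have hq1 := h.theta4_add
      have hr1 := h.theta4_sub
      have e2 : siteTip p l w (2 * l) = theta4 p w / (thetaOdd p (3 * l) * theta4 p (w + l)) := by
        rw [siteTip, show w - 2 * l + 2 * l = w by ring]
      have e2' : siteTip p l (-w) (2 * l)
          = theta4 p w / (thetaOdd p (3 * l) * theta4 p (w - l)) := by
        rw [siteTip_neg, show w + 2 * l - 2 * l = w by ring]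
      rw [neg_neg, h.siteAlt_two, siteCross_two, thetaOdd_neg, e2] at e
      rw [h.siteFlat_two, inversionFactor, sub_self, thetaOdd_zero, e2, e2']
      generalize thetaOdd p (3 * l) = b at *
      generalize thetaOdd p (2 * l) = c at *
      generalize thetaOdd p l = o at *
      generalize theta4 p w = q0 at *
      generalize theta4 p (w + l) = q1 at *
      generalize theta4 p (w - l) = r1 at *
      generalize siteFlat p l w (-(2 * l)) = x at *
      generalize siteRatio p l w = s at *
      generalize siteRatio p l (-w) = s' at *
      generalize siteTip p l w (-(2 * l)) = y at *
      generalize siteTip p l (-w) (-(2 * l)) = y' at *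
      field_simp at e ⊢
      linear_combination (-b * q0 * c ^ 4) * e
  · simp [h.im_l]
  · rw [show (0 : ℂ) - [0, 3 * l, -(3 * l), 2 * l].sum = -(2 * l) by simp]
    exact thetaOdd_ne_zero_neg h2

/-- The entry `(a, a)` of the inversion relation. -/
lemma inversion_flat (h : IsSite p t l w) (u : ℂ) :
    siteFlat p l w u * siteFlat p l w (-u)
      - siteRatio p l w * (thetaOdd p u ^ 2 * (siteTip p l w u * siteTip p l w (-u)))
      - siteRatio p l (-w) * (thetaOdd p u ^ 2 * (siteTip p l (-w) u * siteTip p l (-w) (-u)))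
      - inversionFactor p l u = 0 := by
  -- if `ϑ₁(5λ) = 0` two of the zeros coincide, but the relation extends by continuity in `λ`
  have hp := h.halfPeriod.norm_lt_one
  have c1 := h.halfPeriod.thetaOdd_differentiable.continuous
  have c4 := h.halfPeriod.theta4_differentiable.continuous
  set G : ℂ → ℂ := fun l ↦ siteFlat p l w u * siteFlat p l w (-u)
      - siteRatio p l w * (thetaOdd p u ^ 2 * (siteTip p l w u * siteTip p l w (-u)))
      - siteRatio p l (-w) * (thetaOdd p u ^ 2 * (siteTip p l (-w) u * siteTip p l (-w) (-u)))
      - inversionFactor p l u with hG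
  have hl : (l.re : ℂ) = l := Complex.ext rfl (by simp [h.im_l])
  have hGc : ContinuousAt (fun x : ℝ ↦ G x) l.re := by
    have a1 := h.theta4_add_two
    have a2 := h.theta4_add
    have a3 := h.theta4_sub
    have a4 := h.neg.theta4_add_two
    have a5 := h.two_w
    have a6 := h.neg.two_w
    have a7 := h.two
    have a8 := h.three
    have a9 := h.six
    have a10 := h.neg.theta4_add
    have a11 := h.neg.theta4_sub
    simp only [hG, siteFlat, siteRatio, siteTip, inversionFactor]
    refine ContinuousAt.sub (ContinuousAt.sub (ContinuousAt.sub (ContinuousAt.mul ?_ ?_) ?_) ?_) ?_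
    all_goals
      fun_prop (disch := first | assumption | (simp only [hl]; first | assumption | simp_all))
  by_contra hne
  have hne' : G (l.re : ℂ) ≠ 0 := by rw [hl]; exact hne
  have hS : Dense {x : ℝ | ∃ k : ℤ, x = k * Real.pi / 5}ᶜ := by
    refine Set.Countable.dense_compl ℝ ?_
    refine (Set.countable_range fun k : ℤ ↦ (k * Real.pi / 5 : ℝ)).mono ?_
    rintro x ⟨k, rfl⟩
    exact ⟨k, rfl⟩
  have ev : ∀ᶠ x : ℝ in 𝓝 l.re, G x ≠ 0 ∧ thetaOdd p x ≠ 0 ∧ thetaOdd p (2 * x) ≠ 0 ∧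
      thetaOdd p (3 * x) ≠ 0 ∧ thetaOdd p (6 * x) ≠ 0 := by
    refine (hGc.eventually_ne hne').and ((ContinuousAt.eventually_ne ?_ ?_).and
      ((ContinuousAt.eventually_ne ?_ ?_).and ((ContinuousAt.eventually_ne ?_ ?_).and
      (ContinuousAt.eventually_ne ?_ ?_))))
    all_goals first
      | fun_prop
      | (rw [hl]; first | exact h.one | exact h.two | exact h.three | exact h.six)
  obtain ⟨x, hx, x0, x1, x2, x3, x6⟩ :=
    ((mem_closure_iff_frequently.mp (hS l.re)).and_eventually ev).exists
  have hs : IsSite p t x w := ⟨h.halfPeriod, by simp, h.im_w, x1, x2, x3, x6, h.two_w⟩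
  refine x0 (hs.inversion_flat_of_five ?_ u)
  have := thetaOdd_ofReal_ne_zero hp (x := 5 * x) fun k hk ↦ hx ⟨k, by linarith⟩
  push_cast at this
  exact this

/-- The entry `(a ± 1, a ± 1)` of the inversion relation. A matrix whose off-diagonal entries
vanish and which commutes with a matrix without zero entries is scalar, so this reduces to
`inversion_flat`. -/
lemma inversion_alt (h : IsSite p t l w) (u : ℂ) :
    siteAlt p l w u * siteAlt p l w (-u)
      - siteRatio p l w * (thetaOdd p u ^ 2 * (siteTip p l w u * siteTip p l w (-u)))
      - siteRatio p l w * siteRatio p l (-w)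
        * (thetaOdd p u ^ 2 * (siteCross p l u * siteCross p l (-u)))
      - inversionFactor p l u = 0 := by
  have ht := h.halfPeriod
  have hO := ht.thetaOdd_differentiable
  have hA := (siteAlt_isThetaSum ht l w).differentiable
  have hT := (siteTip_isThetaSum ht l w).differentiable
  have hC := (siteCross_isThetaSum ht l).differentiable
  have hR := (inversionFactor_isThetaSum ht l).differentiable
  have hd : Dense {u | thetaOdd p u * siteTip p l w u ≠ 0} := by
    refine dense_ne_zero (P := fun u ↦ thetaOdd p u * siteTip p l w u) (by fun_prop)
      ⟨3 * l, ?_⟩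
    rw [h.siteTip_three, mul_inv_cancel₀ h.three]
    exact one_ne_zero
  refine congrFun (Continuous.ext_on (f := fun u ↦ siteAlt p l w u * siteAlt p l w (-u)
      - siteRatio p l w * (thetaOdd p u ^ 2 * (siteTip p l w u * siteTip p l w (-u)))
      - siteRatio p l w * siteRatio p l (-w)
        * (thetaOdd p u ^ 2 * (siteCross p l u * siteCross p l (-u)))
      - inversionFactor p l u) (g := fun _ ↦ 0) hd ?_ continuous_const fun u hu ↦ ?_) u
  · exact Differentiable.continuous (𝕜 := ℂ) (by fun_prop)
  have j1 := h.inversion_flat u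
  have j2 := h.inversion_flat_tip u
  have j2' := h.inversion_flat_tip (-u)
  have j2n := h.neg.inversion_flat_tip u
  have j4 := h.inversion_alt_cross u
  rw [siteFlat_neg, neg_neg] at j2n
  rw [neg_neg, thetaOdd_neg] at j2'
  refine (mul_eq_zero.mp ?_).resolve_left hu
  set F := siteFlat p l w u
  set F' := siteFlat p l w (-u)
  set o := thetaOdd p u
  set T := siteTip p l w u
  set T' := siteTip p l w (-u)
  set S := siteTip p l (-w) u
  set S' := siteTip p l (-w) (-u)
  set A := siteAlt p l w u
  set C := siteCross p l u
  set C' := siteCross p l (-u)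
  set r := siteRatio p l w
  set r' := siteRatio p l (-w)
  linear_combination o * T * j1 + o * A * j2 + o * F * j2' - o ^ 2 * r' * C * j2n
    - o ^ 2 * r' * S * j4

end IsSite

/-! ### The face weights in terms of the site weights -/

/-- The weight `W(a, a, a, a ± 1)`, as a function of `w = ±2aλ`. -/
noncomputable def siteSide (p : ℝ) (l w u : ℂ) : ℂ :=
  thetaOdd p (3 * l - u) * theta4 p (w + l - u) / (thetaOdd p (3 * l) * theta4 p (w + l))

/-- The weight `W(a, a ± 1, a ± 1, a)` without its root. -/
noncomputable def siteStep (p : ℝ) (l u : ℂ) : ℂ :=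
  thetaOdd p u * thetaOdd p (3 * l - u) / (thetaOdd p (2 * l) * thetaOdd p (3 * l))

/-- The weight `W(a, a ∓ 1, a, a ± 1)`. -/
noncomputable def siteStraight (p : ℝ) (l u : ℂ) : ℂ :=
  thetaOdd p (2 * l - u) * thetaOdd p (3 * l - u) / (thetaOdd p (2 * l) * thetaOdd p (3 * l))

lemma theta1_mul_div (p : ℝ) (x y z t : ℂ) :
    theta1 p x * theta1 p y / (theta1 p z * theta1 p t)
      = thetaOdd p x * thetaOdd p y / (thetaOdd p z * thetaOdd p t) := by
  simp only [theta1_eq]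
  rw [show theta1Prefactor p * thetaOdd p x * (theta1Prefactor p * thetaOdd p y)
      = theta1Prefactor p ^ 2 * (thetaOdd p x * thetaOdd p y) by ring,
    show theta1Prefactor p * thetaOdd p z * (theta1Prefactor p * thetaOdd p t)
      = theta1Prefactor p ^ 2 * (thetaOdd p z * thetaOdd p t) by ring,
    mul_div_mul_left _ _ (pow_ne_zero 2 (theta1Prefactor_ne_zero p))]

lemma theta1_mul_div_mul (p : ℝ) (x y z t : ℂ) :
    theta1 p x * y / (theta1 p z * t) = thetaOdd p x * y / (thetaOdd p z * t) := by
  simp only [theta1_eq, mul_assoc]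
  rw [mul_div_mul_left _ _ (theta1Prefactor_ne_zero p)]

lemma theta1_div (p : ℝ) (x z : ℂ) : theta1 p x / theta1 p z = thetaOdd p x / thetaOdd p z := by
  simp only [theta1_eq]
  rw [mul_div_mul_left _ _ (theta1Prefactor_ne_zero p)]

lemma theta1_ne_zero_iff (p : ℝ) (x : ℂ) : theta1 p x ≠ 0 ↔ thetaOdd p x ≠ 0 := by
  simp [theta1_eq, theta1Prefactor_ne_zero p]

lemma crossing_div (p lam : ℝ) (a : ℤ) {s : ℤ} (hs : s = 1 ∨ s = -1) :
    crossing p lam (a + s) / crossing p lam a = siteRatio p lam (s * 2 * a * lam) := by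
  have h1 : ((-1 : ℂ)) ^ a ≠ 0 := zpow_ne_zero _ (by norm_num)
  have h2 : ((-1 : ℂ)) ^ (a + s) = -(-1) ^ a := by
    rcases hs with rfl | rfl
    · rw [zpow_add₀ (by norm_num)]; simp
    · rw [zpow_add₀ (by norm_num)]; norm_num
  rw [crossing, crossing, h2, theta1_eq, theta1_eq, div_div_div_eq, siteRatio,
    show -(-1 : ℂ) ^ a * (theta1Prefactor p * thetaOdd p (4 * ((a + s : ℤ) : ℂ) * lam))
      * theta4 p (2 * a * lam) = ((-1) ^ a * theta1Prefactor p)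
      * -(thetaOdd p (4 * ((a + s : ℤ) : ℂ) * lam) * theta4 p (2 * a * lam)) by ring,
    show theta4 p (2 * ((a + s : ℤ) : ℂ) * lam)
      * ((-1 : ℂ) ^ a * (theta1Prefactor p * thetaOdd p (4 * a * lam)))
      = ((-1) ^ a * theta1Prefactor p) * (theta4 p (2 * ((a + s : ℤ) : ℂ) * lam)
        * thetaOdd p (4 * a * lam)) by ring,
    mul_div_mul_left _ _ (mul_ne_zero h1 (theta1Prefactor_ne_zero p))]
  rcases hs with rfl | rfl
  · push_cast
    ring_nf
  · push_cast
    rw [show 2 * (-1 * 2 * (a : ℂ) * lam) + 4 * lam = -(4 * (a + -1) * lam) by ring,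
      show 2 * (-1 * 2 * (a : ℂ) * lam) = -(4 * a * lam) by ring,
      show -1 * 2 * (a : ℂ) * lam + 2 * lam = -(2 * (a + -1) * lam) by ring,
      show -1 * 2 * (a : ℂ) * lam = -(2 * a * lam) by ring]
    simp only [thetaOdd_neg, theta4_neg]
    ring

lemma weightFlat_eq (p lam : ℝ) (a : ℤ) (u : ℂ) :
    weightFlat p lam a u = siteFlat p lam (2 * a * lam) u := by
  have h1 := crossing_div p lam a (Or.inl rfl)
  have h2 := crossing_div p lam a (Or.inr rfl)
  rw [weightFlat, siteFlat, theta1_mul_div, theta1_mul_div, h1, sub_eq_add_neg a, h2]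
  push_cast
  rw [one_mul, show -1 * 2 * (a : ℂ) * lam = -(2 * a * lam) by ring]

lemma weightSide_eq (p lam : ℝ) (a s : ℤ) (u : ℂ) :
    weightSide p lam a s u = siteSide p lam (s * 2 * a * lam) u := by
  rw [weightSide, siteSide, theta1_mul_div_mul]

lemma weightTip_eq (p lam : ℝ) (a s : ℤ) (u : ℂ) :
    weightTip p lam a s u = csqrt (crossing p lam (a + s) / crossing p lam a)
      * (thetaOdd p u * siteTip p lam (s * 2 * a * lam) u) := by
  rw [weightTip, siteTip, theta1_mul_div_mul, mul_div_assoc]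

lemma weightStraight_eq (p lam : ℝ) (u : ℂ) :
    weightStraight p lam u = siteStraight p lam u := by
  rw [weightStraight, siteStraight, theta1_mul_div]

lemma weightAlternate_eq (p lam : ℝ) (a : ℤ) {s : ℤ} (hs : s = 1 ∨ s = -1) (u : ℂ) :
    weightAlternate p lam a s u = siteAlt p lam (s * 2 * a * lam) u := by
  have h1 := crossing_div p lam a hs
  have h2 := crossing_div p lam a (s := -s) (by omega)
  rw [← sub_eq_add_neg] at h2
  push_cast at h2
  rw [show -(s : ℂ) * 2 * a * lam = -(s * 2 * a * lam) by ring] at h2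
  have e : ∀ x : ℂ, (s : ℂ) * 4 * a * lam + x = 2 * (s * 2 * a * lam) + x := fun x ↦ by ring
  have e' : ∀ x : ℂ, (s : ℂ) * 4 * a * lam - x = 2 * (s * 2 * a * lam) - x := fun x ↦ by ring
  rw [weightAlternate, siteAlt]
  simp only [theta1_ne_zero_iff, theta1_mul_div, theta1_div, h1, h2, e, e']

/-- The four corners of a face pairwise linked along its edges are of one of ten kinds. -/
lemma face_cases {H : ℤ → Prop} {Q : ℤ → ℤ → ℤ → ℤ → Prop}
    (flat : ∀ a, H a → Q a a a a)
    (side : ∀ a s, (s = 1 ∨ s = -1) → H a → H (a + s) → Q a a a (a + s))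
    (side' : ∀ a s, (s = 1 ∨ s = -1) → H a → H (a + s) → Q a (a + s) a a)
    (tip : ∀ a s, (s = 1 ∨ s = -1) → H a → H (a + s) → Q (a + s) a a a)
    (tip' : ∀ a s, (s = 1 ∨ s = -1) → H a → H (a + s) → Q a a (a + s) a)
    (step : ∀ a s, (s = 1 ∨ s = -1) → H a → H (a + s) → Q a (a + s) (a + s) a)
    (step' : ∀ a s, (s = 1 ∨ s = -1) → H a → H (a + s) → Q a a (a + s) (a + s))
    (straight : ∀ a s, (s = 1 ∨ s = -1) → H a → H (a + s) → H (a - s) → Q a (a - s) a (a + s))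
    (cross : ∀ a s, (s = 1 ∨ s = -1) → H a → H (a + s) → H (a - s) → Q (a + s) a (a - s) a)
    (alt : ∀ a s, (s = 1 ∨ s = -1) → H a → H (a + s) → Q (a + s) a (a + s) a)
    {a b c d : ℤ} (ha : H a) (hb : H b) (hc : H c) (hd : H d)
    (hab : |a - b| ≤ 1) (hbc : |b - c| ≤ 1) (hcd : |c - d| ≤ 1) (hda : |d - a| ≤ 1) :
    Q a b c d := by
  have unit : ∀ x y : ℤ, |x - y| ≤ 1 → x ≠ y → x - y = 1 ∨ x - y = -1 := by
    intro x y h hne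
    rw [abs_le] at h
    omega
  by_cases h1 : a = b
  · subst h1
    by_cases h2 : a = c
    · subst h2
      by_cases h3 : a = d
      · subst h3; exact flat a ha
      · have := side a (d - a) (unit _ _ hda (Ne.symm h3)) ha (by simpa using hd)
        simpa using this
    · by_cases h3 : a = d
      · subst h3
        have := tip' a (c - a) (unit _ _ hcd (Ne.symm h2)) ha (by simpa using hc)
        simpa using this
      · have h4 : c = d := by rw [abs_le] at *; omega
        subst h4
        have := step' a (c - a) (unit _ _ hda (Ne.symm h2)) ha (by simpa using hc)
        simpa using this
  · by_cases h2 : b = c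
    · subst h2
      by_cases h3 : a = d
      · subst h3
        have := step a (b - a) (by have := unit _ _ hab h1; omega) ha (by simpa using hb)
        simpa using this
      · have h4 : b = d := by rw [abs_le] at *; omega
        subst h4
        have := tip b (a - b) (unit _ _ hab h1) hb (by simpa using ha)
        simpa using this
    · by_cases h3 : a = c
      · subst h3
        by_cases h4 : a = d
        · subst h4
          have := side' a (b - a) (by have := unit _ _ hab h1; omega) ha (by simpa using hb)
          simpa using this
        · by_cases h5 : b = d
          · subst h5
            have := alt b (a - b) (unit _ _ hab h1) hb (by simpa using ha)
            simpa using this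
          · have e : b = a - (d - a) := by rw [abs_le] at *; omega
            have := straight a (d - a) (unit _ _ hda (Ne.symm h4)) ha (by simpa using hd)
              (by rwa [← e])
            rw [← e] at this
            simpa using this
      · by_cases h4 : b = d
        · subst h4
          have e : c = b - (a - b) := by rw [abs_le] at *; omega
          have := cross b (a - b) (unit _ _ hab h1) hb (by simpa using ha) (by rwa [← e])
          rw [← e] at this
          simpa using this
        · have h5 : a = d := by rw [abs_le] at *; omega
          have h6 : b = c := by rw [abs_le] at *; omega
          exact absurd h6 h2

/-- Positive fourth roots `r a` of `S_a` and positive square roots `e a` of `ϑ₄((2a+1)λ)`, up to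
common factors. The root `r` vanishes at the heights `0` and `L + 1`, just outside the allowed
range. -/
structure IsGauge (L : ℕ) (p lam : ℝ) (r e : ℤ → ℝ) (k c : ℂ) : Prop where
  r_pos : ∀ a ∈ heights L, 0 < r a
  r_bot : r 0 = 0
  r_top : r (L + 1) = 0
  e_pos : ∀ a, 0 < e a
  crossing_eq : ∀ a : ℤ, 0 ≤ a → a ≤ L + 1 → crossing p lam a = k * (r a : ℂ) ^ 4
  k_ne : k ≠ 0
  theta4_eq : ∀ a : ℤ, theta4 p (2 * a * lam + lam) = c * (e a : ℂ) ^ 2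
  c_ne : c ≠ 0

lemma csqrt_sq {y : ℝ} (hy : 0 ≤ y) : csqrt ((y : ℂ) ^ 2) = y := by
  rw [csqrt, ← ofReal_pow, show (1 / 2 : ℂ) = ((1 / 2 : ℝ) : ℂ) by push_cast; rfl,
    ← ofReal_cpow (by positivity), ← Real.sqrt_eq_rpow, Real.sqrt_sq hy]

lemma mem_heights {L : ℕ} {a : ℤ} : a ∈ heights L ↔ 1 ≤ a ∧ a ≤ L := Finset.mem_Icc

namespace IsGauge

variable {L : ℕ} {p lam : ℝ} {r e : ℤ → ℝ} {k c : ℂ}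

lemma r_ne (h : IsGauge L p lam r e k c) {a : ℤ} (ha : a ∈ heights L) : (r a : ℂ) ≠ 0 :=
  ofReal_ne_zero.mpr (h.r_pos a ha).ne'

lemma e_ne (h : IsGauge L p lam r e k c) (a : ℤ) : (e a : ℂ) ≠ 0 :=
  ofReal_ne_zero.mpr (h.e_pos a).ne'

lemma r_nonneg (h : IsGauge L p lam r e k c) {a : ℤ} (h0 : 0 ≤ a) (h1 : a ≤ L + 1) : 0 ≤ r a := by
  rcases eq_or_lt_of_le h0 with rfl | h0
  · exact h.r_bot.ge
  · rcases eq_or_lt_of_le h1 with rfl | h1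
    · exact h.r_top.ge
    · exact (h.r_pos a (mem_heights.mpr (by omega))).le

/-- The heights next to an allowed one lie in the closed range `0, …, L + 1`. -/
lemma _root_.DiluteA.step_mem {L : ℕ} {a s : ℤ} (ha : a ∈ heights L) (hs : s = 1 ∨ s = -1) :
    0 ≤ a + s ∧ a + s ≤ L + 1 := by
  rw [mem_heights] at ha; omega

lemma csqrt_crossing (h : IsGauge L p lam r e k c) {a b : ℤ} (ha : a ∈ heights L)
    (h0 : 0 ≤ b) (h1 : b ≤ L + 1) :
    csqrt (crossing p lam b / crossing p lam a) = ((r b : ℂ) / r a) ^ 2 := by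
  have hb := h.r_nonneg h0 h1
  have ha' := h.r_pos a ha
  have := h.k_ne
  have := h.r_ne ha
  rw [mem_heights] at ha
  rw [h.crossing_eq b h0 h1, h.crossing_eq a (by omega) (by omega),
    show k * (r b : ℂ) ^ 4 / (k * (r a : ℂ) ^ 4) = (((r b / r a) ^ 2 : ℝ) : ℂ) ^ 2 by
      push_cast; field_simp, csqrt_sq (by positivity)]
  push_cast
  rfl

lemma siteRatio_eq (h : IsGauge L p lam r e k c) {a s : ℤ} (ha : a ∈ heights L)
    (hs : s = 1 ∨ s = -1) : siteRatio p lam (s * 2 * a * lam) = ((r (a + s) : ℂ) / r a) ^ 4 := by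
  obtain ⟨h0, h1⟩ := step_mem ha hs
  have := h.k_ne
  have := h.r_ne ha
  rw [mem_heights] at ha
  rw [← crossing_div p lam a hs, h.crossing_eq _ h0 h1, h.crossing_eq a (by omega) (by omega)]
  field_simp

lemma csqrt_crossing_mul (h : IsGauge L p lam r e k c) {a s : ℤ} (ha : a ∈ heights L)
    (hs : s = 1 ∨ s = -1) :
    csqrt (crossing p lam (a - 1) * crossing p lam (a + 1) / crossing p lam a ^ 2)
      = ((r (a + s) : ℂ) / r a) ^ 2 * ((r (a - s) : ℂ) / r a) ^ 2 := by
  obtain ⟨h0, h1⟩ := step_mem ha (Or.inl rfl)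
  obtain ⟨h2, h3⟩ := step_mem (s := -1) ha (Or.inr rfl)
  rw [← sub_eq_add_neg] at h2 h3
  have := h.r_nonneg h0 h1
  have := h.r_nonneg h2 h3
  have ha' := h.r_pos a ha
  have := h.k_ne
  have := h.r_ne ha
  rw [mem_heights] at ha
  rw [h.crossing_eq _ h0 h1, h.crossing_eq _ h2 h3, h.crossing_eq a (by omega) (by omega),
    show k * (r (a - 1) : ℂ) ^ 4 * (k * (r (a + 1) : ℂ) ^ 4) / (k * (r a : ℂ) ^ 4) ^ 2
      = (((r (a + 1) / r a) ^ 2 * (r (a - 1) / r a) ^ 2 : ℝ) : ℂ) ^ 2 by push_cast; field_simp,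
    csqrt_sq (by positivity)]
  rcases hs with rfl | rfl
  · push_cast
    rfl
  · rw [sub_neg_eq_add, ← sub_eq_add_neg]
    push_cast
    ring

/-- The root in `W(m, m + 1, m + 1, m)`. -/
noncomputable def _root_.DiluteA.stepRoot (e : ℤ → ℝ) (m : ℤ) : ℂ := e (m + 1) * e (m - 1) / e m ^ 2

lemma csqrt_theta4 (h : IsGauge L p lam r e k c) (m : ℤ) :
    csqrt (theta4 p (2 * m * lam + 3 * lam) * theta4 p (2 * m * lam - lam)
      / theta4 p (2 * m * lam + lam) ^ 2) = stepRoot e m := by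
  have h1 := h.theta4_eq (m + 1)
  have h2 := h.theta4_eq (m - 1)
  push_cast at h1 h2
  have := h.c_ne
  have := h.e_ne m
  have := h.e_pos (m + 1)
  have := h.e_pos (m - 1)
  have := h.e_pos m
  rw [show 2 * (m : ℂ) * lam + 3 * lam = 2 * (m + 1) * lam + lam by ring,
    show 2 * (m : ℂ) * lam - lam = 2 * (m - 1) * lam + lam by ring, h1, h2, h.theta4_eq m,
    show c * (e (m + 1) : ℂ) ^ 2 * (c * (e (m - 1) : ℂ) ^ 2) / (c * (e m : ℂ) ^ 2) ^ 2
      = ((e (m + 1) * e (m - 1) / e m ^ 2 : ℝ) : ℂ) ^ 2 by push_cast; field_simp,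
    csqrt_sq (by positivity), stepRoot]
  push_cast
  rfl

lemma weightStep_eq (h : IsGauge L p lam r e k c) (a : ℤ) {s : ℤ} (hs : s = 1 ∨ s = -1) (u : ℂ) :
    weightStep p lam a s u = stepRoot e (min a (a + s)) * siteStep p lam u := by
  rw [weightStep, siteStep, theta1_mul_div]
  congr 1
  rcases hs with rfl | rfl
  · rw [min_eq_left (by omega), ← h.csqrt_theta4]
    push_cast
    rw [one_mul]
  · rw [min_eq_right (by omega), ← h.csqrt_theta4]
    push_cast
    rw [show -1 * 2 * (a : ℂ) * lam + 3 * lam = -(2 * (a + -1) * lam - lam) by ring,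
      show -1 * 2 * (a : ℂ) * lam - lam = -(2 * (a + -1) * lam + 3 * lam) by ring,
      show -1 * 2 * (a : ℂ) * lam + lam = -(2 * (a + -1) * lam + lam) by ring]
    simp only [theta4_neg]
    rw [mul_comm (theta4 p _)]

/-! #### The face weights -/

lemma _root_.DiluteA.faceWeight_flat (p lam : ℝ) (a : ℤ) (u : ℂ) :
    faceWeight p lam a a a a u = siteFlat p lam (2 * a * lam) u := by
  simp [faceWeight, weightFlat_eq]

lemma _root_.DiluteA.faceWeight_side (p lam : ℝ) (a : ℤ) {s : ℤ} (hs : s = 1 ∨ s = -1) (u : ℂ) :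
    faceWeight p lam a a a (a + s) u = siteSide p lam (s * 2 * a * lam) u := by
  rw [← weightSide_eq]
  rcases hs with rfl | rfl <;> simp [faceWeight]

lemma _root_.DiluteA.faceWeight_side' (p lam : ℝ) (a : ℤ) {s : ℤ} (hs : s = 1 ∨ s = -1) (u : ℂ) :
    faceWeight p lam a (a + s) a a u = siteSide p lam (s * 2 * a * lam) u := by
  rw [← weightSide_eq]
  rcases hs with rfl | rfl <;> simp [faceWeight]

lemma faceWeight_tip (h : IsGauge L p lam r e k c) {a s : ℤ} (ha : a ∈ heights L)
    (hs : s = 1 ∨ s = -1) (u : ℂ) : faceWeight p lam (a + s) a a a u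
      = ((r (a + s) : ℂ) / r a) ^ 2 * (thetaOdd p u * siteTip p lam (s * 2 * a * lam) u) := by
  obtain ⟨h0, h1⟩ := step_mem ha hs
  rw [← h.csqrt_crossing ha h0 h1, ← weightTip_eq]
  rcases hs with rfl | rfl <;> simp [faceWeight]

lemma faceWeight_tip' (h : IsGauge L p lam r e k c) {a s : ℤ} (ha : a ∈ heights L)
    (hs : s = 1 ∨ s = -1) (u : ℂ) : faceWeight p lam a a (a + s) a u
      = ((r (a + s) : ℂ) / r a) ^ 2 * (thetaOdd p u * siteTip p lam (s * 2 * a * lam) u) := by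
  obtain ⟨h0, h1⟩ := step_mem ha hs
  rw [← h.csqrt_crossing ha h0 h1, ← weightTip_eq]
  rcases hs with rfl | rfl <;> simp [faceWeight]

lemma faceWeight_step (h : IsGauge L p lam r e k c) (a : ℤ) {s : ℤ}
    (hs : s = 1 ∨ s = -1) (u : ℂ) : faceWeight p lam a (a + s) (a + s) a u
      = stepRoot e (min a (a + s)) * siteStep p lam u := by
  rw [← h.weightStep_eq a hs]
  rcases hs with rfl | rfl <;> simp [faceWeight]

lemma faceWeight_step' (h : IsGauge L p lam r e k c) (a : ℤ) {s : ℤ}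
    (hs : s = 1 ∨ s = -1) (u : ℂ) : faceWeight p lam a a (a + s) (a + s) u
      = stepRoot e (min a (a + s)) * siteStep p lam u := by
  rw [← h.weightStep_eq a hs]
  rcases hs with rfl | rfl <;> simp [faceWeight]

lemma _root_.DiluteA.faceWeight_straight (p lam : ℝ) (a : ℤ) {s : ℤ} (hs : s = 1 ∨ s = -1)
    (u : ℂ) : faceWeight p lam a (a - s) a (a + s) u = siteStraight p lam u := by
  rw [← weightStraight_eq]
  rcases hs with rfl | rfl
  · have h1 : a - 1 ≠ a + 1 := by omega
    simp [faceWeight, h1]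
  · have h1 : a + 1 ≠ a + -1 := by omega
    simp [faceWeight, h1]

lemma faceWeight_cross (h : IsGauge L p lam r e k c) {a s : ℤ} (ha : a ∈ heights L)
    (hs : s = 1 ∨ s = -1) (u : ℂ) : faceWeight p lam (a + s) a (a - s) a u
      = -(((r (a + s) : ℂ) / r a) ^ 2 * ((r (a - s) : ℂ) / r a) ^ 2)
        * (thetaOdd p u * siteCross p lam u) := by
  have e : faceWeight p lam (a + s) a (a - s) a u = weightCross p lam a u := by
    rcases hs with rfl | rfl
    · have h1 : a + 1 ≠ a - 1 := by omega
      simp [faceWeight, h1]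
    · have h1 : a + -1 ≠ a + 1 := by omega
      simp [faceWeight, h1]
  rw [e, weightCross, h.csqrt_crossing_mul ha hs, theta1_mul_div, siteCross, mul_div_assoc]

lemma _root_.DiluteA.faceWeight_alt (p lam : ℝ) (a : ℤ) {s : ℤ} (hs : s = 1 ∨ s = -1) (u : ℂ) :
    faceWeight p lam (a + s) a (a + s) a u = siteAlt p lam (s * 2 * a * lam) u := by
  rw [← weightAlternate_eq p lam a hs]
  rcases hs with rfl | rfl <;> simp [faceWeight]

end IsGauge

lemma faceWeight_eq_zero {p lam : ℝ} {a b c d : ℤ}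
    (h : ¬(|a - b| ≤ 1 ∧ |b - c| ≤ 1 ∧ |c - d| ≤ 1 ∧ |d - a| ≤ 1)) (u : ℂ) :
    faceWeight p lam a b c d u = 0 := if_neg h

/-- A gauge together with the regularity conditions on `λ` under which the Yang–Baxter equation
is derived. -/
structure IsRegular (L : ℕ) (p : ℝ) (t : ℂ) (lam : ℝ) (r e : ℤ → ℝ) (k c : ℂ) : Prop
    extends IsGauge L p lam r e k c where
  halfPeriod : IsHalfPeriod p t
  one : thetaOdd p lam ≠ 0
  two : thetaOdd p (2 * lam) ≠ 0
  three : thetaOdd p (3 * lam) ≠ 0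
  four : thetaOdd p (4 * lam) ≠ 0
  six : thetaOdd p (6 * lam) ≠ 0
  height : ∀ a ∈ heights L, thetaOdd p (4 * a * lam) ≠ 0

/-- The weight of a triangle `(a, a, a + s)` without the factor `r (a + s)`, see `triangle`. -/
noncomputable def sideRoot (e : ℤ → ℝ) (a s : ℤ) : ℂ :=
  if s = 1 then e (a - 1) / e a else e a / e (a - 1)

/-- The weights at `u = λ` factor into weights of two triangles, with corners `a, b, c` and
`a, c, d`. The weight of a triangle of pairwise linked heights is a symmetric function of its
corners, so that it is a function of their sum. -/
noncomputable def triangle (p lam : ℝ) (r e : ℤ → ℝ) (c : ℂ) (a b d : ℤ) : ℂ :=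
  if |a - b| ≤ 1 ∧ |b - d| ≤ 1 ∧ |a - d| ≤ 1 then
    if (a + b + d) % 3 = 0 then
      r ((a + b + d) / 3) * (thetaOdd p (2 * lam) * theta4 p (2 * ((a + b + d) / 3 : ℤ) * lam))
        / (thetaOdd p lam * (c * (e ((a + b + d) / 3) * e ((a + b + d) / 3 - 1))))
    else if (a + b + d) % 3 = 1 then
      r ((a + b + d) / 3 + 1) * (e ((a + b + d) / 3 - 1) / e ((a + b + d) / 3))
    else r ((a + b + d) / 3) * (e ((a + b + d) / 3 + 1) / e ((a + b + d) / 3))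
  else 0

lemma triangle_swap (p lam : ℝ) (r e : ℤ → ℝ) (c : ℂ) (a b d : ℤ) :
    triangle p lam r e c a b d = triangle p lam r e c b a d := by
  have h : (|a - b| ≤ 1 ∧ |b - d| ≤ 1 ∧ |a - d| ≤ 1) ↔
      (|b - a| ≤ 1 ∧ |a - d| ≤ 1 ∧ |b - d| ≤ 1) := by
    rw [abs_sub_comm a b]; tauto
  simp only [triangle, h, add_comm a b]

lemma triangle_swap' (p lam : ℝ) (r e : ℤ → ℝ) (c : ℂ) (a b d : ℤ) :
    triangle p lam r e c a b d = triangle p lam r e c a d b := by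
  have h : (|a - b| ≤ 1 ∧ |b - d| ≤ 1 ∧ |a - d| ≤ 1) ↔
      (|a - d| ≤ 1 ∧ |d - b| ≤ 1 ∧ |a - b| ≤ 1) := by
    rw [abs_sub_comm b d]; tauto
  simp only [triangle, h, add_right_comm a b]

lemma triangle_same (p lam : ℝ) (r e : ℤ → ℝ) (c : ℂ) (a : ℤ) :
    triangle p lam r e c a a a = r a * (thetaOdd p (2 * lam) * theta4 p (2 * a * lam))
        / (thetaOdd p lam * (c * (e a * e (a - 1)))) := by
  have h1 : (a + a + a) % 3 = 0 := by omega
  have h2 : (a + a + a) / 3 = a := by omega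
  simp [triangle, h1, h2]

lemma triangle_step (p lam : ℝ) (r e : ℤ → ℝ) (c : ℂ) (a : ℤ) {s : ℤ} (hs : s = 1 ∨ s = -1) :
    triangle p lam r e c a a (a + s) = r (a + s) * sideRoot e a s := by
  rcases hs with rfl | rfl
  · have h1 : (a + a + (a + 1)) % 3 = 1 := by omega
    have h2 : (a + a + (a + 1)) / 3 = a := by omega
    simp [triangle, h1, h2, sideRoot]
  · have h1 : (a + a + (a + -1)) % 3 = 2 := by omega
    have h2 : (a + a + (a + -1)) / 3 = a - 1 := by omega
    rw [triangle, if_pos (by simp), h1, h2, if_neg (by norm_num), if_neg (by norm_num)]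
    simp [sideRoot, ← sub_eq_add_neg]

lemma triangle_eq_zero (p lam : ℝ) (r e : ℤ → ℝ) (c : ℂ) {a b d : ℤ} (h : ¬|a - b| ≤ 1) :
    triangle p lam r e c a b d = 0 := if_neg fun h' ↦ h h'.1

lemma sum_heights_two {L : ℕ} {a s : ℤ} (hs : s = 1 ∨ s = -1) (ha : a ∈ heights L)
    (has : a + s ∈ heights L) (f : ℤ → ℂ) (hf : ∀ g, g ≠ a → g ≠ a + s → f g = 0) :
    ∑ g ∈ heights L, f g = f a + f (a + s) :=
  Finset.sum_eq_add_of_mem a (a + s) ha has (by omega) fun g _ hg ↦ hf g hg.1 hg.2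

lemma sum_heights_three {L : ℕ} {a s : ℤ} (hs : s = 1 ∨ s = -1) (ha : a ∈ heights L)
    (f : ℤ → ℂ) (hf : ∀ g, ¬|g - a| ≤ 1 → f g = 0) (h1 : a + s ∉ heights L → f (a + s) = 0)
    (h2 : a - s ∉ heights L → f (a - s) = 0) :
    ∑ g ∈ heights L, f g = f a + f (a + s) + f (a - s) := by
  have h3 : a + s ≠ a - s := by omega
  have h4 : a ≠ a + s := by omega
  have h5 : a ≠ a - s := by omega
  have e : ∑ g ∈ ({a, a + s, a - s} : Finset ℤ), f g = f a + f (a + s) + f (a - s) := by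
    rw [Finset.sum_insert (by simp [h4, h5]), Finset.sum_insert (by simp [h3]),
      Finset.sum_singleton, add_assoc]
  rw [← e]
  have l1 : ∑ g ∈ heights L, f g = ∑ g ∈ heights L ∪ {a, a + s, a - s}, f g := by
    refine Finset.sum_subset Finset.subset_union_left fun g hg hg' ↦ ?_
    simp only [Finset.mem_union, Finset.mem_insert, Finset.mem_singleton] at hg
    rcases hg with hg | rfl | rfl | rfl
    · exact absurd hg hg'
    · exact absurd ha hg'
    · exact h1 hg'
    · exact h2 hg'
  rw [l1]
  refine (Finset.sum_subset Finset.subset_union_right fun g hg hg' ↦ hf g fun hga ↦ hg' ?_).symm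
  simp only [Finset.mem_insert, Finset.mem_singleton]
  rw [abs_le] at hga
  omega

namespace IsGauge

variable {L : ℕ} {p lam : ℝ} {r e : ℤ → ℝ} {k c : ℂ}

lemma r_eq_zero (h : IsGauge L p lam r e k c) {a s : ℤ} (ha : a ∈ heights L)
    (hs : s = 1 ∨ s = -1) (h' : a + s ∉ heights L) : r (a + s) = 0 := by
  rw [mem_heights] at ha h'
  rcases hs with rfl | rfl
  · rw [show a + 1 = (L : ℤ) + 1 by omega, h.r_top]
  · rw [show a + -1 = 0 by omega, h.r_bot]

lemma r_eq_zero' (h : IsGauge L p lam r e k c) {a s : ℤ} (ha : a ∈ heights L)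
    (hs : s = 1 ∨ s = -1) (h' : a - s ∉ heights L) : r (a - s) = 0 := by
  rw [sub_eq_add_neg] at h' ⊢
  exact h.r_eq_zero ha (by omega) h'

lemma sideRoot_ne (h : IsGauge L p lam r e k c) (a s : ℤ) : sideRoot e a s ≠ 0 := by
  rw [sideRoot]
  split_ifs
  · exact div_ne_zero (h.e_ne _) (h.e_ne _)
  · exact div_ne_zero (h.e_ne _) (h.e_ne _)

lemma sideRoot_mul_neg (h : IsGauge L p lam r e k c) (a : ℤ) {s : ℤ} (hs : s = 1 ∨ s = -1) :
    sideRoot e a s * sideRoot e a (-s) = 1 := by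
  have := h.e_ne a
  have := h.e_ne (a - 1)
  rcases hs with rfl | rfl
  · simp [sideRoot]; field_simp
  · simp [sideRoot]; field_simp

lemma theta4_site (h : IsGauge L p lam r e k c) (a : ℤ) {s : ℤ} (hs : s = 1 ∨ s = -1) :
    theta4 p (s * 2 * a * lam + lam) = c * (e a * e (a - 1)) / sideRoot e a s := by
  have := h.e_ne a
  have := h.e_ne (a - 1)
  rcases hs with rfl | rfl
  · rw [show ((1 : ℤ) : ℂ) * 2 * a * lam + lam = 2 * a * lam + lam by push_cast; ring, h.theta4_eq,
      sideRoot, if_pos rfl]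
    field_simp
  · rw [show ((-1 : ℤ) : ℂ) * 2 * a * lam + lam = -(2 * (a - 1 : ℤ) * lam + lam) by
      push_cast; ring, theta4_neg, h.theta4_eq, sideRoot, if_neg (by norm_num)]
    field_simp

lemma theta4_site' (h : IsGauge L p lam r e k c) (a : ℤ) {s : ℤ} (hs : s = 1 ∨ s = -1) :
    theta4 p (s * 2 * a * lam - lam) = c * (e a * e (a - 1)) * sideRoot e a s := by
  have h1 := h.theta4_site a (s := -s) (by omega)
  have h2 := h.sideRoot_mul_neg a hs
  have h3 := h.sideRoot_ne a (-s)
  rw [show (s : ℂ) * 2 * a * lam - lam = -((-s : ℤ) * 2 * a * lam + lam) by push_cast; ring,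
    theta4_neg, h1, div_eq_iff h3, mul_assoc _ (sideRoot e a s), h2, mul_one]

lemma sideRoot_mul (h : IsGauge L p lam r e k c) (a : ℤ) {s : ℤ} (hs : s = 1 ∨ s = -1) :
    sideRoot e a s * sideRoot e (a + s) (-s) = stepRoot e (min a (a + s)) := by
  rcases hs with rfl | rfl
  · have := h.e_ne a
    rw [min_eq_left (by omega)]
    simp [sideRoot, stepRoot]
    field_simp
  · have := h.e_ne (a - 1)
    rw [min_eq_right (by omega), ← sub_eq_add_neg]
    simp [sideRoot, stepRoot]
    field_simp

lemma faceWeight_tip_sub (h : IsGauge L p lam r e k c) {a s : ℤ} (ha : a ∈ heights L)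
    (hs : s = 1 ∨ s = -1) (u : ℂ) : faceWeight p lam (a - s) a a a u
      = ((r (a - s) : ℂ) / r a) ^ 2 * (thetaOdd p u * siteTip p lam (-(s * 2 * a * lam)) u) := by
  rw [sub_eq_add_neg, h.faceWeight_tip ha (by omega)]
  push_cast
  rw [show -(s : ℂ) * 2 * a * lam = -(s * 2 * a * lam) by ring]

lemma faceWeight_tip'_sub (h : IsGauge L p lam r e k c) {a s : ℤ} (ha : a ∈ heights L)
    (hs : s = 1 ∨ s = -1) (u : ℂ) : faceWeight p lam a a (a - s) a u
      = ((r (a - s) : ℂ) / r a) ^ 2 * (thetaOdd p u * siteTip p lam (-(s * 2 * a * lam)) u) := by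
  rw [sub_eq_add_neg, h.faceWeight_tip' ha (by omega)]
  push_cast
  rw [show -(s : ℂ) * 2 * a * lam = -(s * 2 * a * lam) by ring]

lemma faceWeight_cross_sub (h : IsGauge L p lam r e k c) {a s : ℤ} (ha : a ∈ heights L)
    (hs : s = 1 ∨ s = -1) (u : ℂ) : faceWeight p lam (a - s) a (a + s) a u
      = -(((r (a + s) : ℂ) / r a) ^ 2 * ((r (a - s) : ℂ) / r a) ^ 2)
        * (thetaOdd p u * siteCross p lam u) := by
  have := h.faceWeight_cross ha (s := -s) (by omega) u
  rw [sub_neg_eq_add, ← sub_eq_add_neg] at this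
  rw [this]
  ring

lemma _root_.DiluteA.faceWeight_alt_sub (p lam : ℝ) (a : ℤ) {s : ℤ} (hs : s = 1 ∨ s = -1)
    (u : ℂ) : faceWeight p lam (a - s) a (a - s) a u = siteAlt p lam (-(s * 2 * a * lam)) u := by
  rw [sub_eq_add_neg, faceWeight_alt p lam a (by omega)]
  push_cast
  rw [show -(s : ℂ) * 2 * a * lam = -(s * 2 * a * lam) by ring]

lemma _root_.DiluteA.faceWeight_straight_sub (p lam : ℝ) (a : ℤ) {s : ℤ} (hs : s = 1 ∨ s = -1)
    (u : ℂ) : faceWeight p lam a (a + s) a (a - s) u = siteStraight p lam u := by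
  have := faceWeight_straight p lam a (s := -s) (by omega) u
  rwa [sub_neg_eq_add, ← sub_eq_add_neg] at this

lemma faceWeight_step_rev (h : IsGauge L p lam r e k c) (a : ℤ) {s : ℤ}
    (hs : s = 1 ∨ s = -1) (u : ℂ) : faceWeight p lam (a + s) a a (a + s) u
      = stepRoot e (min a (a + s)) * siteStep p lam u := by
  have := h.faceWeight_step (a + s) (s := -s) (by omega) u
  rwa [add_neg_cancel_right, min_comm] at this

lemma faceWeight_step'_rev (h : IsGauge L p lam r e k c) (a : ℤ) {s : ℤ}
    (hs : s = 1 ∨ s = -1) (u : ℂ) : faceWeight p lam (a + s) (a + s) a a u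
      = stepRoot e (min a (a + s)) * siteStep p lam u := by
  have := h.faceWeight_step' (a + s) (s := -s) (by omega) u
  rwa [add_neg_cancel_right, min_comm] at this

lemma _root_.DiluteA.site_opposite (lam : ℝ) (a : ℤ) {s : ℤ} (hs : s = 1 ∨ s = -1) :
    ((-s : ℤ) : ℂ) * 2 * (a + s : ℤ) * lam = -(s * 2 * a * lam) - 2 * lam := by
  rcases hs with rfl | rfl <;> push_cast <;> ring

lemma _root_.DiluteA.faceWeight_alt_rev (p lam : ℝ) (a : ℤ) {s : ℤ} (hs : s = 1 ∨ s = -1)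
    (u : ℂ) : faceWeight p lam a (a + s) a (a + s) u
      = siteAlt p lam (-(s * 2 * a * lam) - 2 * lam) u := by
  have := faceWeight_alt p lam (a + s) (s := -s) (by omega) u
  rwa [add_neg_cancel_right, site_opposite lam a hs] at this

lemma _root_.DiluteA.faceWeight_side_rev (p lam : ℝ) (a : ℤ) {s : ℤ} (hs : s = 1 ∨ s = -1)
    (u : ℂ) : faceWeight p lam (a + s) (a + s) (a + s) a u
      = siteSide p lam (-(s * 2 * a * lam) - 2 * lam) u := by
  have := faceWeight_side p lam (a + s) (s := -s) (by omega) u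
  rwa [add_neg_cancel_right, site_opposite lam a hs] at this

lemma _root_.DiluteA.faceWeight_side'_rev (p lam : ℝ) (a : ℤ) {s : ℤ} (hs : s = 1 ∨ s = -1)
    (u : ℂ) : faceWeight p lam (a + s) a (a + s) (a + s) u
      = siteSide p lam (-(s * 2 * a * lam) - 2 * lam) u := by
  have := faceWeight_side' p lam (a + s) (s := -s) (by omega) u
  rwa [add_neg_cancel_right, site_opposite lam a hs] at this

end IsGauge

/-! ### Properties of the face weights -/

namespace IsRegular

variable {L : ℕ} {p lam : ℝ} {t : ℂ} {r e : ℤ → ℝ} {k c : ℂ}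

lemma isSite (h : IsRegular L p t lam r e k c) {a s : ℤ} (ha : a ∈ heights L)
    (hs : s = 1 ∨ s = -1) : IsSite p t lam (s * 2 * a * lam) where
  halfPeriod := h.halfPeriod
  im_l := by simp
  im_w := by
    rw [show (s : ℂ) * 2 * a * lam = ((s * 2 * a * lam : ℝ) : ℂ) by push_cast; rfl, ofReal_im]
  one := h.one
  two := h.two
  three := h.three
  six := h.six
  two_w := by
    have := h.height a ha
    rcases hs with rfl | rfl
    · rwa [show 2 * (((1 : ℤ) : ℂ) * 2 * a * lam) = 4 * a * lam by push_cast; ring]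
    · rw [show 2 * (((-1 : ℤ) : ℂ) * 2 * a * lam) = -(4 * a * lam) by push_cast; ring]
      exact thetaOdd_ne_zero_neg this

lemma siteFlat_sign (p lam : ℝ) (a : ℤ) {s : ℤ} (hs : s = 1 ∨ s = -1) (u : ℂ) :
    siteFlat p lam (2 * a * lam) u = siteFlat p lam (s * 2 * a * lam) u := by
  rcases hs with rfl | rfl
  · push_cast
    rw [one_mul]
  · rw [show ((-1 : ℤ) : ℂ) * 2 * a * lam = -(2 * a * lam) by push_cast; ring,
      IsSite.siteFlat_neg]

lemma isSite_one (h : IsRegular L p t lam r e k c) {a : ℤ} (ha : a ∈ heights L) :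
    IsSite p t lam (2 * a * lam) := by
  simpa using h.isSite ha (s := 1) (Or.inl rfl)

/-- Reflection in the diagonal through `b` and `d`. -/
lemma faceWeight_reflect (h : IsRegular L p t lam r e k c) {a b c' d : ℤ} (ha : a ∈ heights L)
    (hb : b ∈ heights L) (hc : c' ∈ heights L) (hd : d ∈ heights L) (u : ℂ) :
    faceWeight p lam a b c' d u = faceWeight p lam c' b a d u := by
  by_cases hadj : |a - b| ≤ 1 ∧ |b - c'| ≤ 1 ∧ |c' - d| ≤ 1 ∧ |d - a| ≤ 1
  swap
  · rw [faceWeight_eq_zero hadj, faceWeight_eq_zero]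
    rwa [abs_sub_comm c' b, abs_sub_comm b a, abs_sub_comm a d, abs_sub_comm d c', and_left_comm,
      and_comm (a := |d - a| ≤ 1)]
  refine face_cases (H := (· ∈ heights L)) (Q := fun a b c' d ↦
      faceWeight p lam a b c' d u = faceWeight p lam c' b a d u) ?_ ?_ ?_ ?_ ?_ ?_ ?_ ?_ ?_ ?_
    ha hb hc hd hadj.1 hadj.2.1 hadj.2.2.1 hadj.2.2.2
  · intro a _; rfl
  · intro a s hs _ _; rfl
  · intro a s hs _ _; rfl
  · intro a s hs ha _; rw [h.faceWeight_tip ha hs, h.faceWeight_tip' ha hs]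
  · intro a s hs ha _; rw [h.faceWeight_tip ha hs, h.faceWeight_tip' ha hs]
  · intro a s hs ha _; rw [h.faceWeight_step a hs, h.faceWeight_step'_rev a hs]
  · intro a s hs ha _; rw [h.faceWeight_step' a hs, h.faceWeight_step_rev a hs]
  · intro a s hs _ _ _; rfl
  · intro a s hs ha _ _; rw [h.faceWeight_cross ha hs, h.faceWeight_cross_sub ha hs]
  · intro a s hs _ _; rfl

/-- Reflection in the diagonal through `a` and `c`. -/
lemma faceWeight_reflect' (h : IsRegular L p t lam r e k c) {a b c' d : ℤ} (ha : a ∈ heights L)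
    (hb : b ∈ heights L) (hc : c' ∈ heights L) (hd : d ∈ heights L) (u : ℂ) :
    faceWeight p lam a b c' d u = faceWeight p lam a d c' b u := by
  by_cases hadj : |a - b| ≤ 1 ∧ |b - c'| ≤ 1 ∧ |c' - d| ≤ 1 ∧ |d - a| ≤ 1
  swap
  · rw [faceWeight_eq_zero hadj, faceWeight_eq_zero]
    rw [abs_sub_comm a d, abs_sub_comm d c', abs_sub_comm c' b, abs_sub_comm b a]
    tauto
  refine face_cases (H := (· ∈ heights L)) (Q := fun a b c' d ↦
      faceWeight p lam a b c' d u = faceWeight p lam a d c' b u) ?_ ?_ ?_ ?_ ?_ ?_ ?_ ?_ ?_ ?_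
    ha hb hc hd hadj.1 hadj.2.1 hadj.2.2.1 hadj.2.2.2
  · intro a _; rfl
  · intro a s hs _ _; rw [faceWeight_side p lam a hs, faceWeight_side' p lam a hs]
  · intro a s hs _ _; rw [faceWeight_side p lam a hs, faceWeight_side' p lam a hs]
  · intro a s hs ha _; rfl
  · intro a s hs ha _; rfl
  · intro a s hs ha _; rw [h.faceWeight_step a hs, h.faceWeight_step' a hs]
  · intro a s hs ha _; rw [h.faceWeight_step a hs, h.faceWeight_step' a hs]
  · intro a s hs _ _ _; rw [faceWeight_straight p lam a hs, faceWeight_straight_sub p lam a hs]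
  · intro a s hs ha _ _; rfl
  · intro a s hs _ _; rfl

lemma faceWeight_zero (h : IsRegular L p t lam r e k c) {a b c' d : ℤ} (ha : a ∈ heights L)
    (hb : b ∈ heights L) (hc : c' ∈ heights L) (hd : d ∈ heights L) (hab : |a - b| ≤ 1)
    (hda : |d - a| ≤ 1) : faceWeight p lam a b c' d 0 = if a = c' then 1 else 0 := by
  by_cases hadj : |b - c'| ≤ 1 ∧ |c' - d| ≤ 1
  swap
  · rw [faceWeight_eq_zero (by tauto), if_neg]
    rintro rfl
    exact hadj ⟨abs_sub_comm a b ▸ hab, abs_sub_comm d a ▸ hda⟩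
  refine face_cases (H := (· ∈ heights L)) (Q := fun a b c' d ↦
      faceWeight p lam a b c' d 0 = if a = c' then 1 else 0) ?_ ?_ ?_ ?_ ?_ ?_ ?_ ?_ ?_ ?_
    ha hb hc hd hab hadj.1 hadj.2 hda
  · intro a ha; rw [faceWeight_flat, (h.isSite_one ha).siteFlat_zero, if_pos rfl]
  · intro a s hs ha _
    rw [faceWeight_side p lam a hs, siteSide, sub_zero, sub_zero, if_pos rfl, div_self]
    exact mul_ne_zero h.three (h.isSite ha hs).theta4_add
  · intro a s hs ha _
    rw [faceWeight_side' p lam a hs, siteSide, sub_zero, sub_zero, if_pos rfl, div_self]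
    exact mul_ne_zero h.three (h.isSite ha hs).theta4_add
  · intro a s hs ha _
    rw [h.faceWeight_tip ha hs, thetaOdd_zero, if_neg (by omega)]; ring
  · intro a s hs ha _
    rw [h.faceWeight_tip' ha hs, thetaOdd_zero, if_neg (by omega)]; ring
  · intro a s hs ha _
    rw [h.faceWeight_step a hs, siteStep, thetaOdd_zero, if_neg (by omega)]; ring
  · intro a s hs ha _
    rw [h.faceWeight_step' a hs, siteStep, thetaOdd_zero, if_neg (by omega)]; ring
  · intro a s hs ha _ _
    rw [faceWeight_straight p lam a hs, siteStraight, sub_zero, sub_zero, if_pos rfl, div_self]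
    exact mul_ne_zero h.two h.three
  · intro a s hs ha _ _
    rw [h.faceWeight_cross ha hs, thetaOdd_zero, if_neg (by omega)]; ring
  · intro a s hs ha _
    rw [faceWeight_alt p lam a hs, (h.isSite ha hs).siteAlt_zero, if_pos rfl]

lemma _root_.DiluteA.siteSide_three_sub (p lam : ℝ) (w u : ℂ) : siteSide p lam w (3 * lam - u)
    = thetaOdd p u * siteTip p lam w u := by
  rw [siteSide, siteTip, sub_sub_cancel, show w + lam - (3 * lam - u) = w - 2 * lam + u by ring,
    mul_div_assoc]

lemma _root_.DiluteA.siteTip_three_sub (p lam : ℝ) (w u : ℂ) :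
    thetaOdd p (3 * lam - u) * siteTip p lam w (3 * lam - u) = siteSide p lam w u := by
  rw [← siteSide_three_sub, sub_sub_cancel]

lemma _root_.DiluteA.siteFlat_three_sub (p lam : ℝ) (w u : ℂ) :
    siteFlat p lam w (3 * lam - u) = siteFlat p lam w u := by
  rw [siteFlat, siteFlat, sub_sub_cancel, show 6 * (lam : ℂ) - (3 * lam - u) = 3 * lam + u by ring,
    show 3 * (lam : ℂ) + (3 * lam - u) = 6 * lam - u by ring, mul_comm (thetaOdd p (3 * lam + u)),
    mul_comm (thetaOdd p (3 * lam - u))]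

lemma _root_.DiluteA.siteStep_three_sub (p lam : ℝ) (u : ℂ) :
    siteStep p lam (3 * lam - u) = siteStep p lam u := by
  rw [siteStep, siteStep, sub_sub_cancel, mul_comm (thetaOdd p (3 * lam - u))]

lemma _root_.DiluteA.siteStraight_three_sub (p lam : ℝ) (u : ℂ) :
    siteStraight p lam (3 * lam - u) = -(thetaOdd p u * siteCross p lam u) := by
  rw [siteStraight, siteCross, sub_sub_cancel,
    show 2 * (lam : ℂ) - (3 * lam - u) = -(lam - u) by ring, thetaOdd_neg]
  ring

lemma _root_.DiluteA.siteCross_three_sub (p lam : ℝ) (u : ℂ) :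
    thetaOdd p (3 * lam - u) * siteCross p lam (3 * lam - u) = -siteStraight p lam u := by
  rw [← sub_sub_cancel (3 * (lam : ℂ)) u, siteStraight_three_sub, sub_sub_cancel, neg_neg]

/-- Crossing symmetry. -/
lemma faceWeight_three_sub (h : IsRegular L p t lam r e k c) {a b c' d : ℤ} (ha : a ∈ heights L)
    (hb : b ∈ heights L) (hc : c' ∈ heights L) (hd : d ∈ heights L) (u : ℂ) :
    faceWeight p lam a b c' d (3 * lam - u) * ((r b : ℂ) ^ 2 * (r d : ℂ) ^ 2)
      = (r a : ℂ) ^ 2 * (r c' : ℂ) ^ 2 * faceWeight p lam d a b c' u := by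
  by_cases hadj : |a - b| ≤ 1 ∧ |b - c'| ≤ 1 ∧ |c' - d| ≤ 1 ∧ |d - a| ≤ 1
  swap
  · rw [faceWeight_eq_zero hadj, faceWeight_eq_zero (by tauto), zero_mul, mul_zero]
  refine face_cases (H := (· ∈ heights L)) (Q := fun a b c' d ↦
      faceWeight p lam a b c' d (3 * lam - u) * ((r b : ℂ) ^ 2 * (r d : ℂ) ^ 2)
      = (r a : ℂ) ^ 2 * (r c' : ℂ) ^ 2 * faceWeight p lam d a b c' u) ?_ ?_ ?_ ?_ ?_ ?_ ?_ ?_ ?_ ?_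
    ha hb hc hd hadj.1 hadj.2.1 hadj.2.2.1 hadj.2.2.2
  · intro a ha; rw [faceWeight_flat, faceWeight_flat, siteFlat_three_sub]; ring
  · intro a s hs ha _
    have := h.r_ne ha
    rw [faceWeight_side p lam a hs, h.faceWeight_tip ha hs, siteSide_three_sub]
    field_simp
  · intro a s hs ha _
    have := h.r_ne ha
    rw [faceWeight_side' p lam a hs, h.faceWeight_tip' ha hs, siteSide_three_sub]
    field_simp
  · intro a s hs ha _
    have := h.r_ne ha
    rw [faceWeight_side' p lam a hs, h.faceWeight_tip ha hs, siteTip_three_sub]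
    field_simp
  · intro a s hs ha _
    have := h.r_ne ha
    rw [faceWeight_side p lam a hs, h.faceWeight_tip' ha hs, siteTip_three_sub]
    field_simp
  · intro a s hs ha _
    rw [h.faceWeight_step a hs, h.faceWeight_step' a hs, siteStep_three_sub]
    ring
  · intro a s hs ha _
    rw [h.faceWeight_step' a hs, h.faceWeight_step_rev a hs, siteStep_three_sub]
    ring
  · intro a s hs ha _ _
    have := h.r_ne ha
    rw [faceWeight_straight p lam a hs, h.faceWeight_cross ha hs, siteStraight_three_sub]
    field_simp
  · intro a s hs ha _ _
    have := h.r_ne ha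
    rw [faceWeight_straight_sub p lam a hs, h.faceWeight_cross ha hs, siteCross_three_sub]
    field_simp
  · intro a s hs ha has
    have := h.r_ne ha
    have h4 : thetaOdd p (2 * (s * 2 * a * lam) + 4 * lam) ≠ 0 := by
      have := (h.isSite has (s := -s) (by omega)).two_w
      rw [site_opposite lam a hs,
        show 2 * (-((s : ℂ) * 2 * a * lam) - 2 * lam) = -(2 * (s * 2 * a * lam) + 4 * lam) by ring]
        at this
      exact fun h0 ↦ this (by rw [thetaOdd_neg, h0, neg_zero])
    rw [faceWeight_alt p lam a hs, faceWeight_alt_rev p lam a hs,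
      (h.isSite ha hs).siteAlt_crossing h4, h.siteRatio_eq ha hs]
    field_simp

lemma _root_.DiluteA.siteSide_isThetaSum (ht : IsHalfPeriod p t) (lam : ℝ) (w : ℂ) :
    IsThetaSum p t 2 (-1) (4 * lam + w) (siteSide p lam w) :=
  (((IsThetaSum.odd_sub ht (3 * lam)).mul (IsThetaSum.even_sub ht (w + lam))).div_const _).cast rfl
    (by norm_num) (by ring)

lemma _root_.DiluteA.siteStep_isThetaSum (ht : IsHalfPeriod p t) (lam : ℝ) :
    IsThetaSum p t 2 1 (3 * lam) (siteStep p lam) :=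
  (((IsThetaSum.odd ht).mul (IsThetaSum.odd_sub ht (3 * lam))).div_const _).cast rfl
    (by norm_num) (by ring)

lemma _root_.DiluteA.siteStraight_isThetaSum (ht : IsHalfPeriod p t) (lam : ℝ) :
    IsThetaSum p t 2 1 (5 * lam) (siteStraight p lam) :=
  (((IsThetaSum.odd_sub ht (2 * lam)).mul (IsThetaSum.odd_sub ht (3 * lam))).div_const _).cast rfl
    (by norm_num) (by ring)

/-- The zero sum of a weight depends on the corners through a sum of local terms with alternating
signs. Hence all terms in the Yang–Baxter equation have the same multipliers. -/
lemma faceWeight_isThetaSum (h : IsRegular L p t lam r e k c) {a b c' d : ℤ} (ha : a ∈ heights L)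
    (hb : b ∈ heights L) (hc : c' ∈ heights L) (hd : d ∈ heights L) :
    IsThetaSum p t 2 ((-1) ^ (a + b + c' + d))
      (lam * (3 - (a ^ 2 + c' ^ 2 - b ^ 2 - d ^ 2))) (faceWeight p lam a b c' d) := by
  have ht := h.halfPeriod
  by_cases hadj : |a - b| ≤ 1 ∧ |b - c'| ≤ 1 ∧ |c' - d| ≤ 1 ∧ |d - a| ≤ 1
  swap
  · rw [show faceWeight p lam a b c' d = fun _ ↦ 0 from funext fun u ↦ faceWeight_eq_zero hadj u]
    exact IsTheta.zero
  have even : ∀ {n : ℤ} (_ : n % 2 = 0), (1 : ℂ) = (-1) ^ n := fun h ↦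
    (Even.neg_one_zpow (Int.even_iff.mpr h)).symm
  have odd : ∀ {n : ℤ} (_ : n % 2 = 1), (-1 : ℂ) = (-1) ^ n := fun h ↦
    (Odd.neg_one_zpow (Int.odd_iff.mpr h)).symm
  refine face_cases (H := (· ∈ heights L)) (Q := fun a b c' d ↦
      IsThetaSum p t 2 ((-1) ^ (a + b + c' + d))
      (lam * (3 - (a ^ 2 + c' ^ 2 - b ^ 2 - d ^ 2))) (faceWeight p lam a b c' d))
      ?_ ?_ ?_ ?_ ?_ ?_ ?_ ?_ ?_ ?_
    ha hb hc hd hadj.1 hadj.2.1 hadj.2.2.1 hadj.2.2.2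
  · intro a ha
    exact ((IsSite.siteFlat_isThetaSum ht lam (2 * a * lam)).cast rfl (even (by omega))
      (by ring)).congr fun u ↦ (faceWeight_flat p lam a u).symm
  · intro a s hs ha _
    refine ((siteSide_isThetaSum ht lam (s * 2 * a * lam)).cast rfl (odd (by omega)) ?_).congr
      fun u ↦ (faceWeight_side p lam a hs u).symm
    rcases hs with rfl | rfl <;> push_cast <;> ring
  · intro a s hs ha _
    refine ((siteSide_isThetaSum ht lam (s * 2 * a * lam)).cast rfl (odd (by omega)) ?_).congr
      fun u ↦ (faceWeight_side' p lam a hs u).symm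
    rcases hs with rfl | rfl <;> push_cast <;> ring
  · intro a s hs ha _
    refine ((((IsThetaSum.odd ht).mul
      (IsSite.siteTip_isThetaSum ht lam (s * 2 * a * lam))).const_mul _).cast rfl
      ((by norm_num : (-1 : ℂ) * 1 = -1).trans (odd (by omega))) ?_).congr
      fun u ↦ (h.faceWeight_tip ha hs u).symm
    rcases hs with rfl | rfl <;> push_cast <;> ring
  · intro a s hs ha _
    refine ((((IsThetaSum.odd ht).mul
      (IsSite.siteTip_isThetaSum ht lam (s * 2 * a * lam))).const_mul _).cast rfl
      ((by norm_num : (-1 : ℂ) * 1 = -1).trans (odd (by omega))) ?_).congr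
      fun u ↦ (h.faceWeight_tip' ha hs u).symm
    rcases hs with rfl | rfl <;> push_cast <;> ring
  · intro a s hs ha _
    exact (((siteStep_isThetaSum ht lam).const_mul _).cast rfl (even (by omega))
      (by push_cast; ring)).congr fun u ↦ (h.faceWeight_step a hs u).symm
  · intro a s hs ha _
    exact (((siteStep_isThetaSum ht lam).const_mul _).cast rfl (even (by omega))
      (by push_cast; ring)).congr fun u ↦ (h.faceWeight_step' a hs u).symm
  · intro a s hs ha _ _
    refine ((siteStraight_isThetaSum ht lam).cast rfl (even (by omega)) ?_).congr
      fun u ↦ (faceWeight_straight p lam a hs u).symm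
    rcases hs with rfl | rfl <;> push_cast <;> ring
  · intro a s hs ha _ _
    refine ((((IsThetaSum.odd ht).mul (IsSite.siteCross_isThetaSum ht lam)).const_mul _).cast rfl
      ((by norm_num : (-1 : ℂ) * -1 = 1).trans (even (by omega))) ?_).congr
      fun u ↦ (h.faceWeight_cross ha hs u).symm
    rcases hs with rfl | rfl <;> push_cast <;> ring
  · intro a s hs ha _
    refine ((IsSite.siteAlt_isThetaSum ht lam (s * 2 * a * lam)).cast rfl (even (by omega))
      ?_).congr fun u ↦ (faceWeight_alt p lam a hs u).symm
    rcases hs with rfl | rfl <;> push_cast <;> ring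

end IsRegular

namespace IsRegular

variable {L : ℕ} {p lam : ℝ} {t : ℂ} {r e : ℤ → ℝ} {k c : ℂ}

lemma stepRoot_sq (h : IsRegular L p t lam r e k c) (a : ℤ) {s : ℤ} (hs : s = 1 ∨ s = -1) :
    stepRoot e (min a (a + s)) ^ 2 * theta4 p (s * 2 * a * lam + lam) ^ 2
      = theta4 p (s * 2 * a * lam + 3 * lam) * theta4 p (s * 2 * a * lam - lam) := by
  have h1 := h.theta4_site a hs
  have h2 := h.theta4_site' a hs
  have h3 := h.theta4_site (a + s) (s := -s) (by omega)
  have h4 := h.theta4_site' (a + s) (s := -s) (by omega)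
  rw [site_opposite lam a hs, show -((s : ℂ) * 2 * a * lam) - 2 * lam + lam
    = -(s * 2 * a * lam + lam) by ring, theta4_neg] at h3
  rw [site_opposite lam a hs, show -((s : ℂ) * 2 * a * lam) - 2 * lam - lam
    = -(s * 2 * a * lam + 3 * lam) by ring, theta4_neg] at h4
  have n1 := h.sideRoot_ne a s
  have n2 := h.sideRoot_ne (a + s) (-s)
  rw [h2, h4, ← h.sideRoot_mul a hs]
  nth_rewrite 1 [pow_two (theta4 p _)]
  nth_rewrite 1 [h1]
  rw [h3]
  field_simp

lemma side_mul_side (h : IsRegular L p t lam r e k c) {a s : ℤ} (ha : a ∈ heights L)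
    (hs : s = 1 ∨ s = -1) (u : ℂ) :
    siteSide p lam (s * 2 * a * lam) u * siteSide p lam (s * 2 * a * lam) (-u)
      + stepRoot e (min a (a + s)) * siteStep p lam u
        * (stepRoot e (min a (a + s)) * siteStep p lam (-u)) = inversionFactor p lam u := by
  have J := IsSite.inversion_side h.halfPeriod lam (s * 2 * a * lam) u
  have h2 := h.two
  have h3 := h.three
  have h4 := (h.isSite ha hs).theta4_add
  have K := h.stepRoot_sq a hs
  rw [← K] at J
  rw [siteSide, siteSide, siteStep, siteStep, inversionFactor]
  simp only [sub_neg_eq_add, thetaOdd_neg]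
  generalize theta4 p (s * 2 * a * lam + lam) = q at *
  generalize thetaOdd p (2 * lam) = x at *
  generalize thetaOdd p (3 * lam) = y at *
  generalize theta4 p (s * 2 * a * lam + lam - u) = q' at *
  generalize theta4 p (s * 2 * a * lam + lam + u) = q'' at *
  generalize thetaOdd p (2 * lam - u) = x' at *
  generalize thetaOdd p (2 * lam + u) = x'' at *
  generalize thetaOdd p (3 * lam - u) = y' at *
  generalize thetaOdd p (3 * lam + u) = y'' at *
  field_simp
  linear_combination (y' * y'') * J

lemma side_mul_step (p lam : ℝ) (a s : ℤ) (u : ℂ) :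
    siteSide p lam (s * 2 * a * lam) u * siteStep p lam (-u)
      + siteStep p lam u * siteSide p lam (-(s * 2 * a * lam) - 2 * lam) (-u) = 0 := by
  rw [siteSide, siteSide, siteStep, siteStep, sub_neg_eq_add, sub_neg_eq_add, thetaOdd_neg,
    show -((s : ℂ) * 2 * a * lam) - 2 * lam + lam + u = -(s * 2 * a * lam + lam - u) by ring,
    show -((s : ℂ) * 2 * a * lam) - 2 * lam + lam = -(s * 2 * a * lam + lam) by ring,
    theta4_neg, theta4_neg]
  ring

/-- The inversion relation. -/
lemma faceWeight_inversion (h : IsRegular L p t lam r e k c) {a b c' d : ℤ} (ha : a ∈ heights L)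
    (hb : b ∈ heights L) (hc : c' ∈ heights L) (hd : d ∈ heights L) (hab : |a - b| ≤ 1)
    (hda : |d - a| ≤ 1) (u : ℂ) :
    ∑ g ∈ heights L, faceWeight p lam a b g d u * faceWeight p lam g b c' d (-u)
      = if a = c' then inversionFactor p lam u else 0 := by
  by_cases hadj : |b - c'| ≤ 1 ∧ |c' - d| ≤ 1
  swap
  · rw [if_neg (by rintro rfl; exact hadj ⟨abs_sub_comm a b ▸ hab, abs_sub_comm d a ▸ hda⟩)]
    refine Finset.sum_eq_zero fun g _ ↦ ?_
    rw [faceWeight_eq_zero (a := g) (by tauto), mul_zero]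
  refine face_cases (H := (· ∈ heights L)) (Q := fun a b c' d ↦
      ∑ g ∈ heights L, faceWeight p lam a b g d u * faceWeight p lam g b c' d (-u)
      = if a = c' then inversionFactor p lam u else 0) ?_ ?_ ?_ ?_ ?_ ?_ ?_ ?_ ?_ ?_
    ha hb hc hd hab hadj.1 hadj.2 hda
  · intro a ha
    have r0 := h.r_ne ha
    have hs : (1 : ℤ) = 1 ∨ (1 : ℤ) = -1 := Or.inl rfl
    have ef := siteFlat_sign p lam a hs
    have er := h.siteRatio_eq ha hs
    have er' := h.siteRatio_eq ha (s := -1) (by omega)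
    rw [← sub_eq_add_neg, show ((-1 : ℤ) : ℂ) * 2 * a * lam = -((1 : ℤ) * 2 * a * lam) by
      push_cast; ring] at er'
    have J := (h.isSite ha hs).inversion_flat u
    rw [er, er', ← ef, ← ef] at J
    rw [sum_heights_three hs ha, faceWeight_flat, faceWeight_flat, h.faceWeight_tip ha hs,
      h.faceWeight_tip' ha hs, h.faceWeight_tip_sub ha hs, h.faceWeight_tip'_sub ha hs, if_pos rfl,
      thetaOdd_neg]
    · linear_combination J
    · intro g hg; rw [faceWeight_eq_zero (by rw [abs_sub_comm] at hg; tauto), zero_mul]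
    · intro hn; rw [h.faceWeight_tip ha hs, h.r_eq_zero ha hs hn]; simp
    · intro hn; rw [h.faceWeight_tip_sub ha hs, h.r_eq_zero' ha hs hn]; simp
  · intro a s hs ha has
    rw [sum_heights_two hs ha has, faceWeight_side p lam a hs, faceWeight_side p lam a hs,
      h.faceWeight_step' a hs, h.faceWeight_step_rev a hs, if_pos rfl]
    · exact h.side_mul_side ha hs u
    · intro g h1 h2
      rw [faceWeight_eq_zero, zero_mul]
      rintro ⟨i1, i2, i3, i4⟩
      rw [abs_le] at i2 i3
      omega
  · intro a s hs ha has
    rw [sum_heights_two hs ha has, faceWeight_side' p lam a hs, faceWeight_side' p lam a hs,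
      h.faceWeight_step a hs, h.faceWeight_step'_rev a hs, if_pos rfl]
    · exact h.side_mul_side ha hs u
    · intro g h1 h2
      rw [faceWeight_eq_zero, zero_mul]
      rintro ⟨i1, i2, i3, i4⟩
      rw [abs_le] at i2 i3
      omega
  · intro a s hs ha has
    have r0 := h.r_ne ha
    have er' := h.siteRatio_eq ha (s := -s) (by omega)
    rw [← sub_eq_add_neg, show ((-s : ℤ) : ℂ) * 2 * a * lam = -(s * 2 * a * lam) by
      push_cast; ring] at er'
    have J := (h.isSite ha hs).inversion_flat_tip (-u)
    rw [er', neg_neg, thetaOdd_neg] at J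
    rw [sum_heights_three hs ha, faceWeight_flat, siteFlat_sign p lam a hs, h.faceWeight_tip ha hs,
      h.faceWeight_tip ha hs, h.faceWeight_tip_sub ha hs, faceWeight_alt p lam a hs,
      h.faceWeight_cross ha hs, if_neg (by omega), thetaOdd_neg]
    · linear_combination (-(((r (a + s) : ℂ) / r a) ^ 2 * thetaOdd p u)) * J
    · intro g hg; rw [faceWeight_eq_zero (by rw [abs_sub_comm] at hg; tauto), zero_mul]
    · intro hn; exact absurd has hn
    · intro hn; rw [h.faceWeight_tip_sub ha hs, h.r_eq_zero' ha hs hn]; simp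
  · intro a s hs ha has
    have r0 := h.r_ne ha
    have er' := h.siteRatio_eq ha (s := -s) (by omega)
    rw [← sub_eq_add_neg, show ((-s : ℤ) : ℂ) * 2 * a * lam = -(s * 2 * a * lam) by
      push_cast; ring] at er'
    have J := (h.isSite ha hs).inversion_flat_tip u
    rw [er'] at J
    rw [sum_heights_three hs ha, faceWeight_flat, siteFlat_sign p lam a hs, h.faceWeight_tip' ha hs,
      h.faceWeight_tip' ha hs, h.faceWeight_tip'_sub ha hs, faceWeight_alt p lam a hs,
      h.faceWeight_cross_sub ha hs, if_neg (by omega), thetaOdd_neg]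
    · linear_combination (((r (a + s) : ℂ) / r a) ^ 2 * thetaOdd p u) * J
    · intro g hg; rw [faceWeight_eq_zero (by rw [abs_sub_comm] at hg; tauto), zero_mul]
    · intro hn; exact absurd has hn
    · intro hn; rw [h.faceWeight_tip'_sub ha hs, h.r_eq_zero' ha hs hn]; simp
  · intro a s hs ha has
    rw [sum_heights_two hs ha has, faceWeight_side' p lam a hs, faceWeight_side_rev p lam a hs,
      h.faceWeight_step a hs, h.faceWeight_step a hs, if_neg (by omega)]
    · linear_combination stepRoot e (min a (a + s)) * side_mul_step p lam a s u
    · intro g h1 h2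
      rw [faceWeight_eq_zero, zero_mul]
      rintro ⟨i1, i2, i3, i4⟩
      rw [abs_le] at i2 i3
      omega
  · intro a s hs ha has
    rw [sum_heights_two hs ha has, faceWeight_side p lam a hs, faceWeight_side'_rev p lam a hs,
      h.faceWeight_step' a hs, h.faceWeight_step' a hs, if_neg (by omega)]
    · linear_combination stepRoot e (min a (a + s)) * side_mul_step p lam a s u
    · intro g h1 h2
      rw [faceWeight_eq_zero, zero_mul]
      rintro ⟨i1, i2, i3, i4⟩
      rw [abs_le] at i2 i3
      omega
  · intro a s hs ha has _
    have h2 := h.two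
    have h3 := h.three
    rw [Finset.sum_eq_single a, faceWeight_straight p lam a hs, faceWeight_straight p lam a hs,
      siteStraight, siteStraight, inversionFactor, if_pos rfl, sub_neg_eq_add, sub_neg_eq_add]
    · ring
    · intro g _ hg
      rw [faceWeight_eq_zero, zero_mul]
      rintro ⟨-, h1, h2, -⟩
      rw [abs_le] at h1 h2
      omega
    · exact fun hn ↦ absurd ha hn
  · intro a s hs ha has has'
    have J := (h.isSite ha hs).inversion_alt_cross u
    rw [sum_heights_three hs ha, h.faceWeight_tip ha hs, h.faceWeight_tip'_sub ha hs,
      faceWeight_alt p lam a hs, faceWeight_alt_sub p lam a hs, h.faceWeight_cross ha hs,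
      h.faceWeight_cross ha hs, if_neg (by omega), thetaOdd_neg]
    · linear_combination (((r (a + s) : ℂ) / r a) ^ 2 * ((r (a - s) : ℂ) / r a) ^ 2
        * thetaOdd p u) * J
    · intro g hg; rw [faceWeight_eq_zero (by rw [abs_sub_comm] at hg; tauto), zero_mul]
    · intro hn; exact absurd has hn
    · intro hn; exact absurd has' hn
  · intro a s hs ha has
    have er := h.siteRatio_eq ha hs
    have er' := h.siteRatio_eq ha (s := -s) (by omega)
    rw [← sub_eq_add_neg, show ((-s : ℤ) : ℂ) * 2 * a * lam = -(s * 2 * a * lam) by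
      push_cast; ring] at er'
    have J := (h.isSite ha hs).inversion_alt u
    rw [er, er'] at J
    rw [sum_heights_three hs ha, h.faceWeight_tip ha hs, h.faceWeight_tip' ha hs,
      faceWeight_alt p lam a hs, faceWeight_alt p lam a hs, h.faceWeight_cross ha hs,
      h.faceWeight_cross_sub ha hs, if_pos rfl, thetaOdd_neg]
    · linear_combination J
    · intro g hg; rw [faceWeight_eq_zero (by rw [abs_sub_comm] at hg; tauto), zero_mul]
    · intro hn; exact absurd has hn
    · intro hn; rw [h.faceWeight_cross ha hs, h.r_eq_zero' ha hs hn]; simp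

lemma siteTip_one (h : IsRegular L p t lam r e k c) (a : ℤ) {s : ℤ} (hs : s = 1 ∨ s = -1) :
    siteTip p lam (s * 2 * a * lam) lam = sideRoot e a s ^ 2 / thetaOdd p (3 * lam) := by
  have n := h.sideRoot_ne a s
  have e1 := h.e_ne a
  have e2 := h.e_ne (a - 1)
  have h3 := h.three
  have hc := h.c_ne
  rw [siteTip, show (s : ℂ) * 2 * a * lam - 2 * lam + lam = s * 2 * a * lam - lam by ring,
    h.theta4_site a hs, h.theta4_site' a hs]
  generalize thetaOdd p (3 * lam) = y at *
  field_simp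

/-- The weights at `u = λ` factor into weights of two triangles. -/
lemma faceWeight_one (h : IsRegular L p t lam r e k c) {a b c' d : ℤ} (ha : a ∈ heights L)
    (hb : b ∈ heights L) (hc : c' ∈ heights L) (hd : d ∈ heights L) :
    faceWeight p lam a b c' d lam * (r b * r d)
      = thetaOdd p lam / thetaOdd p (3 * lam)
        * (triangle p lam r e c a c' b * triangle p lam r e c a c' d) := by
  have h1 := h.one
  have h2 := h.two
  have h3 := h.three
  have hc0 := h.c_ne
  by_cases hadj : |a - b| ≤ 1 ∧ |b - c'| ≤ 1 ∧ |c' - d| ≤ 1 ∧ |d - a| ≤ 1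
  swap
  · rw [faceWeight_eq_zero hadj, zero_mul]
    suffices H : triangle p lam r e c a c' b = 0 ∨ triangle p lam r e c a c' d = 0 by
      rcases H with H | H <;> rw [H] <;> ring
    by_contra! hcon
    obtain ⟨i1, i2⟩ := hcon
    rw [triangle] at i1 i2
    have j1 := (ite_ne_right_iff.mp i1).1
    have j2 := (ite_ne_right_iff.mp i2).1
    rw [abs_sub_comm b c', abs_sub_comm d a] at hadj
    tauto
  refine face_cases (H := (· ∈ heights L)) (Q := fun a b c' d ↦
    faceWeight p lam a b c' d lam * (r b * r d)
      = thetaOdd p lam / thetaOdd p (3 * lam)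
        * (triangle p lam r e c a c' b * triangle p lam r e c a c' d)) ?_ ?_ ?_ ?_ ?_ ?_ ?_ ?_ ?_ ?_
    ha hb hc hd hadj.1 hadj.2.1 hadj.2.2.1 hadj.2.2.2
  · intro a ha
    have hs : (1 : ℤ) = 1 ∨ (1 : ℤ) = -1 := Or.inl rfl
    have q1 := h.theta4_site a hs
    have q2 := h.theta4_site' a hs
    have n := h.sideRoot_ne a 1
    have e1 := h.e_ne a
    have e2 := h.e_ne (a - 1)
    have F := (h.isSite_one ha).siteFlat_two
    push_cast at q1 q2
    rw [one_mul] at q1 q2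
    rw [q1, q2] at F
    rw [faceWeight_flat, ← siteFlat_three_sub, show 3 * (lam : ℂ) - lam = 2 * lam by ring, F,
      triangle_same]
    generalize thetaOdd p lam = o at *
    generalize thetaOdd p (2 * lam) = x at *
    generalize thetaOdd p (3 * lam) = y at *
    field_simp
  · intro a s hs ha has
    have q1 := h.theta4_site a hs
    have n := h.sideRoot_ne a s
    have e1 := h.e_ne a
    have e2 := h.e_ne (a - 1)
    have e3 : theta4 p (s * 2 * a * lam) = theta4 p (2 * a * lam) := by
      rcases hs with rfl | rfl
      · push_cast; rw [one_mul]
      · rw [← theta4_neg]; congr 1; push_cast; ring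
    rw [faceWeight_side p lam a hs, siteSide, add_sub_cancel_right,
      show 3 * (lam : ℂ) - lam = 2 * lam by ring, triangle_same, triangle_step _ _ _ _ _ _ hs,
      q1, e3]
    generalize thetaOdd p lam = o at *
    generalize thetaOdd p (2 * lam) = x at *
    generalize thetaOdd p (3 * lam) = y at *
    field_simp
  · intro a s hs ha has
    have q1 := h.theta4_site a hs
    have n := h.sideRoot_ne a s
    have e1 := h.e_ne a
    have e2 := h.e_ne (a - 1)
    have e3 : theta4 p (s * 2 * a * lam) = theta4 p (2 * a * lam) := by
      rcases hs with rfl | rfl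
      · push_cast; rw [one_mul]
      · rw [← theta4_neg]; congr 1; push_cast; ring
    rw [faceWeight_side' p lam a hs, siteSide, add_sub_cancel_right,
      show 3 * (lam : ℂ) - lam = 2 * lam by ring, triangle_same, triangle_step _ _ _ _ _ _ hs,
      q1, e3]
    generalize thetaOdd p lam = o at *
    generalize thetaOdd p (2 * lam) = x at *
    generalize thetaOdd p (3 * lam) = y at *
    field_simp
  · intro a s hs ha has
    have T := h.siteTip_one a hs
    have r0 := h.r_ne ha
    rw [h.faceWeight_tip ha hs, triangle_swap, triangle_swap', triangle_step _ _ _ _ _ _ hs, T]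
    field_simp
  · intro a s hs ha has
    have T := h.siteTip_one a hs
    have r0 := h.r_ne ha
    rw [h.faceWeight_tip' ha hs, triangle_swap', triangle_step _ _ _ _ _ _ hs, T]
    field_simp
  · intro a s hs ha has
    have T := triangle_step p lam r e c (a + s) (s := -s) (by omega)
    rw [add_neg_cancel_right, triangle_swap', triangle_swap] at T
    rw [h.faceWeight_step a hs, T, triangle_swap', triangle_step _ _ _ _ _ _ hs,
      ← h.sideRoot_mul a hs, siteStep, show 3 * (lam : ℂ) - lam = 2 * lam by ring]
    generalize thetaOdd p lam = o at *
    generalize thetaOdd p (2 * lam) = x at *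
    generalize thetaOdd p (3 * lam) = y at *
    field_simp
  · intro a s hs ha has
    have T := triangle_step p lam r e c (a + s) (s := -s) (by omega)
    rw [add_neg_cancel_right, triangle_swap', triangle_swap] at T
    rw [h.faceWeight_step' a hs, T, triangle_swap', triangle_step _ _ _ _ _ _ hs,
      ← h.sideRoot_mul a hs, siteStep, show 3 * (lam : ℂ) - lam = 2 * lam by ring]
    generalize thetaOdd p lam = o at *
    generalize thetaOdd p (2 * lam) = x at *
    generalize thetaOdd p (3 * lam) = y at *
    field_simp
  · intro a s hs ha has _
    have T := triangle_step p lam r e c a (s := -s) (by omega)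
    rw [← sub_eq_add_neg] at T
    have S := h.sideRoot_mul_neg a hs
    rw [faceWeight_straight p lam a hs, T, triangle_step _ _ _ _ _ _ hs, siteStraight,
      show 3 * (lam : ℂ) - lam = 2 * lam by ring, show 2 * (lam : ℂ) - lam = lam by ring]
    generalize thetaOdd p lam = o at *
    generalize thetaOdd p (2 * lam) = x at *
    generalize thetaOdd p (3 * lam) = y at *
    field_simp
    linear_combination (-(r (a + s) * r (a - s) : ℂ)) * S
  · intro a s hs ha has _
    rw [h.faceWeight_cross ha hs, siteCross, sub_self, thetaOdd_zero, triangle_eq_zero]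
    · ring
    · rw [abs_le]; omega
  · intro a s hs ha has
    have T := triangle_step p lam r e c (a + s) (s := -s) (by omega)
    rw [add_neg_cancel_right] at T
    have A := h.faceWeight_three_sub (a := a + s) (b := a) (c' := a + s) (d := a) has ha has ha
      (2 * lam)
    rw [show 3 * (lam : ℂ) - 2 * lam = lam by ring, faceWeight_alt_rev p lam a hs,
      ← site_opposite lam a hs, (h.isSite has (s := -s) (by omega)).siteAlt_two,
      h.siteRatio_eq has (s := -s) (by omega), h.theta4_site _ (s := -s) (by omega),
      h.theta4_site' _ (s := -s) (by omega), add_neg_cancel_right] at A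
    have r0 := h.r_ne ha
    have r1 := h.r_ne has
    have n := h.sideRoot_ne (a + s) (-s)
    have e1 := h.e_ne (a + s)
    have e2 := h.e_ne (a + s - 1)
    rw [T]
    generalize faceWeight p lam (a + s) a (a + s) a lam = W at *
    generalize thetaOdd p lam = o at *
    generalize thetaOdd p (3 * lam) = y at *
    field_simp at A ⊢
    linear_combination A

end IsRegular

/-! ### The Yang–Baxter equation of the elementary weights -/

lemma adj_of_faceWeight_ne_zero {p lam : ℝ} {a b c d : ℤ} {u : ℂ}
    (h : faceWeight p lam a b c d u ≠ 0) :
    |a - b| ≤ 1 ∧ |b - c| ≤ 1 ∧ |c - d| ≤ 1 ∧ |d - a| ≤ 1 := by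
  by_contra hn
  exact h (faceWeight_eq_zero hn u)

lemma inversionFactor_neg (p lam : ℝ) (u : ℂ) :
    inversionFactor p lam (-u) = inversionFactor p lam u := by
  rw [inversionFactor, inversionFactor, sub_neg_eq_add, sub_neg_eq_add, ← sub_eq_add_neg,
    ← sub_eq_add_neg]
  ring

/-- The difference of the two sides of the Yang–Baxter equation. -/
noncomputable def ybeDefect (L : ℕ) (p lam : ℝ) (a b c d e f : ℤ) (u v : ℂ) : ℂ :=
  ∑ g ∈ heights L, faceWeight p lam a b g f u * faceWeight p lam f g d e v
      * faceWeight p lam g b c d (v - u)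
    - ∑ g ∈ heights L, faceWeight p lam f a g e (v - u) * faceWeight p lam a b c g v
      * faceWeight p lam g c d e u

/-- The corners of a hexagon, linked along its sides. -/
structure IsHexagon (L : ℕ) (a b c d e f : ℤ) : Prop where
  a_mem : a ∈ heights L
  b_mem : b ∈ heights L
  c_mem : c ∈ heights L
  d_mem : d ∈ heights L
  e_mem : e ∈ heights L
  f_mem : f ∈ heights L
  ab : |a - b| ≤ 1
  bc : |b - c| ≤ 1
  cd : |c - d| ≤ 1
  de : |d - e| ≤ 1
  ef : |e - f| ≤ 1
  fa : |f - a| ≤ 1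

lemma ybeDefect_eq_zero_of_not_linked {L : ℕ} {p lam : ℝ} {a b c d e f : ℤ} {u v : ℂ}
    (h : ¬(|a - b| ≤ 1 ∧ |b - c| ≤ 1 ∧ |c - d| ≤ 1 ∧ |d - e| ≤ 1 ∧ |e - f| ≤ 1 ∧ |f - a| ≤ 1)) :
    ybeDefect L p lam a b c d e f u v = 0 := by
  rw [ybeDefect, Finset.sum_eq_zero, Finset.sum_eq_zero, sub_zero]
  · intro g _
    by_contra hne
    obtain ⟨h12, h3⟩ := mul_ne_zero_iff.mp hne
    obtain ⟨h1, h2⟩ := mul_ne_zero_iff.mp h12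
    have i1 := adj_of_faceWeight_ne_zero h1
    have i2 := adj_of_faceWeight_ne_zero h2
    have i3 := adj_of_faceWeight_ne_zero h3
    tauto
  · intro g _
    by_contra hne
    obtain ⟨h12, h3⟩ := mul_ne_zero_iff.mp hne
    obtain ⟨h1, h2⟩ := mul_ne_zero_iff.mp h12
    have i1 := adj_of_faceWeight_ne_zero h1
    have i2 := adj_of_faceWeight_ne_zero h2
    have i3 := adj_of_faceWeight_ne_zero h3
    tauto

namespace IsRegular

variable {L : ℕ} {p lam : ℝ} {t : ℂ} {r e : ℤ → ℝ} {k c : ℂ} {a b c' d e' f : ℤ}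

lemma faceWeight_crossing (h : IsRegular L p t lam r e k c) (ha : a ∈ heights L)
    (hb : b ∈ heights L) (hc : c' ∈ heights L) (hd : d ∈ heights L) (u : ℂ) :
    faceWeight p lam a b c' d u * ((r b : ℂ) ^ 2 * (r d : ℂ) ^ 2)
      = (r a : ℂ) ^ 2 * (r c' : ℂ) ^ 2 * faceWeight p lam d a b c' (3 * lam - u) := by
  rw [← h.faceWeight_three_sub ha hb hc hd, sub_sub_cancel]

lemma faceWeight_three (h : IsRegular L p t lam r e k c) (ha : a ∈ heights L)
    (hb : b ∈ heights L) (hc : c' ∈ heights L) (hd : d ∈ heights L) (hab : |a - b| ≤ 1)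
    (hbc : |b - c'| ≤ 1) :
    faceWeight p lam a b c' d (3 * lam)
      = if b = d then (r a : ℂ) ^ 2 * (r c' : ℂ) ^ 2 / (r b : ℂ) ^ 4 else 0 := by
  have h0 := h.faceWeight_three_sub ha hb hc hd 0
  have hb0 := h.r_ne hb
  have hd0 := h.r_ne hd
  rw [sub_zero, h.faceWeight_reflect hd ha hb hc, h.faceWeight_zero hb ha hd hc
    (abs_sub_comm a b ▸ hab) (abs_sub_comm b c' ▸ hbc)] at h0
  split_ifs at h0 ⊢ with hbd
  · subst hbd
    field_simp
    linear_combination h0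
  · rw [mul_zero] at h0
    exact (mul_eq_zero.mp h0).resolve_right
      (mul_ne_zero (pow_ne_zero 2 hb0) (pow_ne_zero 2 hd0))

/-! #### Special points -/

/-- At `u = 0` two weights are Kronecker symbols and each sum reduces to a single term, the
same on both sides. -/
lemma ybeDefect_left_zero (h : IsRegular L p t lam r e k c) (H : IsHexagon L a b c' d e' f)
    (v : ℂ) : ybeDefect L p lam a b c' d e' f 0 v = 0 := by
  obtain ⟨ha, hb, hc, hd, he, hf, ab, bc, cd, de, ef, fa⟩ := H
  rw [ybeDefect, Finset.sum_eq_single a, Finset.sum_eq_single d, sub_zero,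
    h.faceWeight_zero ha hb ha hf ab fa, h.faceWeight_zero hd hc hd he (abs_sub_comm c' d ▸ cd)
      (abs_sub_comm d e' ▸ de), if_pos rfl, if_pos rfl]
  · ring
  · intro g hg hgd
    rw [h.faceWeight_reflect hg hc hd he, h.faceWeight_zero hd hc hg he (abs_sub_comm c' d ▸ cd)
      (abs_sub_comm d e' ▸ de), if_neg (Ne.symm hgd), mul_zero]
  · exact fun hn ↦ absurd hd hn
  · intro g hg hga
    rw [h.faceWeight_zero ha hb hg hf ab fa, if_neg (Ne.symm hga), zero_mul, zero_mul]
  · exact fun hn ↦ absurd ha hn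

/-- At `u = v` the two weights at `v - u` are Kronecker symbols. -/
lemma ybeDefect_diag (h : IsRegular L p t lam r e k c) (H : IsHexagon L a b c' d e' f)
    (u : ℂ) : ybeDefect L p lam a b c' d e' f u u = 0 := by
  obtain ⟨ha, hb, hc, hd, he, hf, ab, bc, cd, de, ef, fa⟩ := H
  rw [ybeDefect, sub_self, Finset.sum_eq_single c', Finset.sum_eq_single f,
    h.faceWeight_zero hc hb hc hd (abs_sub_comm b c' ▸ bc) (abs_sub_comm c' d ▸ cd),
    h.faceWeight_zero hf ha hf he fa ef, if_pos rfl, if_pos rfl]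
  · ring
  · intro g hg hgf
    rw [h.faceWeight_zero hf ha hg he fa ef, if_neg (Ne.symm hgf), zero_mul, zero_mul]
  · exact fun hn ↦ absurd hf hn
  · intro g hg hgc
    rw [h.faceWeight_reflect hg hb hc hd, h.faceWeight_zero hc hb hg hd (abs_sub_comm b c' ▸ bc)
      (abs_sub_comm c' d ▸ cd), if_neg (Ne.symm hgc), mul_zero]
  · exact fun hn ↦ absurd hc hn

/-- The Yang–Baxter equation at `v = 0` is the inversion relation. -/
lemma ybeDefect_right_zero (h : IsRegular L p t lam r e k c) (H : IsHexagon L a b c' d e' f)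
    (u : ℂ) : ybeDefect L p lam a b c' d e' f u 0 = 0 := by
  obtain ⟨ha, hb, hc, hd, he, hf, ab, bc, cd, de, ef, fa⟩ := H
  have t1 : ∀ g ∈ heights L, faceWeight p lam a b g f u * faceWeight p lam f g d e' 0
      * faceWeight p lam g b c' d (0 - u) = (if f = d then 1 else 0)
        * (faceWeight p lam a b g f u * faceWeight p lam g b c' d (-u)) := fun g hg ↦ by
    by_cases hfg : |g - f| ≤ 1
    · rw [h.faceWeight_zero hf hg hd he (abs_sub_comm g f ▸ hfg) ef, zero_sub]; ring
    · rw [faceWeight_eq_zero (c := g) (d := f) (by tauto)]; ring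
  have t2 : ∀ g ∈ heights L, faceWeight p lam f a g e' (0 - u) * faceWeight p lam a b c' g 0
      * faceWeight p lam g c' d e' u = (if a = c' then 1 else 0)
        * (faceWeight p lam f a g e' (-u) * faceWeight p lam g c' d e' (- -u)) := fun g hg ↦ by
    by_cases hag : |a - g| ≤ 1
    · rw [h.faceWeight_zero ha hb hc hg ab (abs_sub_comm a g ▸ hag), zero_sub, neg_neg]; ring
    · rw [zero_sub, faceWeight_eq_zero (b := a) (c := g) (by tauto)]; ring
  rw [ybeDefect, Finset.sum_congr rfl t1, Finset.sum_congr rfl t2, ← Finset.mul_sum,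
    ← Finset.mul_sum]
  by_cases h1 : f = d
  · subst h1
    rw [h.faceWeight_inversion ha hb hc hf ab fa, if_pos rfl]
    by_cases h2 : a = c'
    · subst h2
      rw [if_pos rfl, if_pos rfl, h.faceWeight_inversion hf ha hf he fa ef, if_pos rfl,
        inversionFactor_neg, sub_self]
    · rw [if_neg h2, if_neg h2]; ring
  · rw [if_neg h1]
    by_cases h2 : a = c'
    · subst h2
      rw [h.faceWeight_inversion hf ha hd he fa ef, if_neg h1]; ring
    · rw [if_neg h2]; ring

/-- At `u = 3λ`, crossing turns two weights into Kronecker symbols and the others into an inversion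
relation. -/
lemma ybeDefect_left_three (h : IsRegular L p t lam r e k c) (H : IsHexagon L a b c' d e' f)
    (v : ℂ) : ybeDefect L p lam a b c' d e' f (3 * lam) v = 0 := by
  obtain ⟨ha, hb, hc, hd, he, hf, ab, bc, cd, de, ef, fa⟩ := H
  have a0 := h.r_ne ha
  have b0 := h.r_ne hb
  have c0 := h.r_ne hc
  have d0 := h.r_ne hd
  have e0 := h.r_ne he
  set K : ℂ := (r a : ℂ) ^ 2 * (r d : ℂ) ^ 2 / ((r b : ℂ) ^ 2 * (r e' : ℂ) ^ 2) with hK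
  have t1 : ∀ g ∈ heights L, faceWeight p lam a b g f (3 * lam) * faceWeight p lam f g d e' v
      * faceWeight p lam g b c' d (v - 3 * lam) = (if b = f then K else 0)
        * (faceWeight p lam e' b g d (3 * lam - v)
          * faceWeight p lam g b c' d (-(3 * lam - v))) := fun g hg ↦ by
    have g0 := h.r_ne hg
    by_cases hbg : |b - g| ≤ 1
    · rw [h.faceWeight_three ha hb hg hf ab hbg]
      split_ifs with hbf
      · subst hbf
        have X := h.faceWeight_crossing hb hg hd he v
        rw [neg_sub, hK]
        generalize faceWeight p lam b g d e' v = x at *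
        generalize faceWeight p lam e' b g d (3 * lam - v) = y at *
        field_simp
        linear_combination (faceWeight p lam g b c' d (v - 3 * lam)) * X
      · ring
    · rw [abs_sub_comm] at hbg
      rw [neg_sub, faceWeight_eq_zero (a := g) (b := b) (by tauto)]; ring
  have t2 : ∀ g ∈ heights L, faceWeight p lam f a g e' (v - 3 * lam) * faceWeight p lam a b c' g v
      * faceWeight p lam g c' d e' (3 * lam) = (if c' = e' then K else 0)
        * (faceWeight p lam f a g e' (v - 3 * lam)
          * faceWeight p lam g a b e' (-(v - 3 * lam))) := fun g hg ↦ by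
    have g0 := h.r_ne hg
    by_cases hcg : |g - c'| ≤ 1
    · rw [h.faceWeight_three hg hc hd he hcg cd]
      split_ifs with hce
      · subst hce
        have X := h.faceWeight_crossing ha hb hc hg v
        rw [neg_sub, hK]
        generalize faceWeight p lam a b c' g v = x at *
        generalize faceWeight p lam g a b c' (3 * lam - v) = y at *
        field_simp
        linear_combination (faceWeight p lam f a g c' (v - 3 * lam)) * X
      · ring
    · rw [faceWeight_eq_zero (a := g) (b := c') (by tauto)]
      by_cases hce : c' = e'
      · subst hce
        rw [faceWeight_eq_zero (c := g) (d := c') (by tauto)]; ring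
      · rw [if_neg hce]; ring
  rw [ybeDefect, Finset.sum_congr rfl t1, Finset.sum_congr rfl t2, ← Finset.mul_sum,
    ← Finset.mul_sum]
  by_cases h1 : b = f
  · subst h1
    rw [h.faceWeight_inversion he hb hc hd ef de, if_pos rfl]
    by_cases h2 : c' = e'
    · subst h2
      rw [if_pos rfl, if_pos rfl, h.faceWeight_inversion hb ha hb hc fa ef, if_pos rfl,
        ← inversionFactor_neg, neg_sub, sub_self]
    · rw [if_neg h2, if_neg (Ne.symm h2)]; ring
  · rw [if_neg h1]
    by_cases h2 : c' = e'
    · subst h2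
      rw [h.faceWeight_inversion hf ha hb hc fa ef, if_neg (Ne.symm h1)]; ring
    · rw [if_neg h2]; ring

/-- At `v = 3λ`, crossing turns two weights into Kronecker symbols, so that one term is left on each
side. -/
lemma ybeDefect_right_three (h : IsRegular L p t lam r e k c) (H : IsHexagon L a b c' d e' f)
    (u : ℂ) : ybeDefect L p lam a b c' d e' f u (3 * lam) = 0 := by
  obtain ⟨ha, hb, hc, hd, he, hf, ab, bc, cd, de, ef, fa⟩ := H
  have a0 := h.r_ne ha
  have b0 := h.r_ne hb
  have c0 := h.r_ne hc
  have d0 := h.r_ne hd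
  have e0 := h.r_ne he
  have f0 := h.r_ne hf
  have X := h.faceWeight_three_sub he hb hc hd u
  have Y := h.faceWeight_three_sub hf ha hb he u
  rw [h.faceWeight_reflect hd he hb hc, h.faceWeight_reflect' hb he hd hc] at X
  rw [h.faceWeight_reflect he hf ha hb, h.faceWeight_reflect' ha hf he hb] at Y
  rw [ybeDefect, Finset.sum_eq_single e', Finset.sum_eq_single b,
    h.faceWeight_three hf he hd he (abs_sub_comm e' f ▸ ef) (abs_sub_comm d e' ▸ de), if_pos rfl,
    h.faceWeight_three ha hb hc hb ab bc, if_pos rfl]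
  · generalize faceWeight p lam e' b c' d (3 * lam - u) = x at *
    generalize faceWeight p lam f a b e' (3 * lam - u) = y at *
    generalize faceWeight p lam b c' d e' u = x' at *
    generalize faceWeight p lam a b e' f u = y' at *
    have X' : x = (r e' : ℂ) ^ 2 * (r c' : ℂ) ^ 2 * x' / ((r b : ℂ) ^ 2 * (r d : ℂ) ^ 2) := by
      rw [← X]; field_simp
    have Y' : y = (r f : ℂ) ^ 2 * (r b : ℂ) ^ 2 * y' / ((r a : ℂ) ^ 2 * (r e' : ℂ) ^ 2) := by
      rw [← Y]; field_simp
    rw [X', Y']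
    field_simp
    ring
  · intro g hg hgb
    rw [h.faceWeight_three ha hb hc hg ab bc, if_neg (Ne.symm hgb), mul_zero, zero_mul]
  · exact fun hn ↦ absurd hb hn
  · intro g hg hge
    rw [h.faceWeight_reflect' hf hg hd he, h.faceWeight_three hf he hd hg (abs_sub_comm e' f ▸ ef)
      (abs_sub_comm d e' ▸ de), if_neg (Ne.symm hge), mul_zero, zero_mul]
  · exact fun hn ↦ absurd he hn

/-- At `v = u + 3λ`, crossing turns two weights into Kronecker symbols and the others into an
inversion relation. -/
lemma ybeDefect_add_three (h : IsRegular L p t lam r e k c) (H : IsHexagon L a b c' d e' f)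
    (u : ℂ) : ybeDefect L p lam a b c' d e' f u (u + 3 * lam) = 0 := by
  obtain ⟨ha, hb, hc, hd, he, hf, ab, bc, cd, de, ef, fa⟩ := H
  have a0 := h.r_ne ha
  have b0 := h.r_ne hb
  have c0 := h.r_ne hc
  have d0 := h.r_ne hd
  have e0 := h.r_ne he
  set K : ℂ := (r c' : ℂ) ^ 2 * (r f : ℂ) ^ 2 / ((r b : ℂ) ^ 2 * (r e' : ℂ) ^ 2) with hK
  have hu : (3 : ℂ) * lam - (u + 3 * lam) = -u := by ring
  have t1 : ∀ g ∈ heights L, faceWeight p lam a b g f u * faceWeight p lam f g d e' (u + 3 * lam)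
      * faceWeight p lam g b c' d (u + 3 * lam - u) = (if b = d then K else 0)
        * (faceWeight p lam a b g f u * faceWeight p lam g b e' f (-u)) := fun g hg ↦ by
    have g0 := h.r_ne hg
    by_cases hbg : |g - b| ≤ 1
    · rw [add_sub_cancel_left, h.faceWeight_three hg hb hc hd hbg bc]
      split_ifs with hbd
      · subst hbd
        have X := h.faceWeight_crossing hf hg hb he (u + 3 * lam)
        rw [hu, h.faceWeight_reflect he hf hg hb, h.faceWeight_reflect' hg hf he hb] at X
        rw [hK]
        generalize faceWeight p lam f g b e' (u + 3 * lam) = x at *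
        generalize faceWeight p lam g b e' f (-u) = y at *
        field_simp
        linear_combination (faceWeight p lam a b g f u) * X
      · ring
    · rw [faceWeight_eq_zero (a := g) (b := b) (c := c') (by tauto),
        faceWeight_eq_zero (a := g) (b := b) (by tauto)]
      ring
  have t2 : ∀ g ∈ heights L, faceWeight p lam f a g e' (u + 3 * lam - u)
      * faceWeight p lam a b c' g (u + 3 * lam)
      * faceWeight p lam g c' d e' u = (if a = e' then K else 0)
        * (faceWeight p lam d a g c' u
          * faceWeight p lam g a b c' (-u)) := fun g hg ↦ by
    have g0 := h.r_ne hg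
    by_cases hag : |a - g| ≤ 1
    · rw [add_sub_cancel_left, h.faceWeight_three hf ha hg he fa hag]
      split_ifs with hae
      · subst hae
        have X := h.faceWeight_crossing ha hb hc hg (u + 3 * lam)
        rw [hu] at X
        rw [hK, h.faceWeight_reflect hg hc hd ha, h.faceWeight_reflect' hd hc hg ha]
        generalize faceWeight p lam a b c' g (u + 3 * lam) = x at *
        generalize faceWeight p lam g a b c' (-u) = y at *
        field_simp
        linear_combination ((r f : ℂ) ^ 2 * faceWeight p lam d a g c' u) * X
      · ring
    · rw [faceWeight_eq_zero (b := a) (c := g) (by tauto)]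
      rw [faceWeight_eq_zero (a := d) (b := a) (c := g) (by tauto)]
      ring
  rw [ybeDefect, Finset.sum_congr rfl t1, Finset.sum_congr rfl t2, ← Finset.mul_sum,
    ← Finset.mul_sum, h.faceWeight_inversion ha hb he hf ab fa]
  by_cases h1 : a = e'
  · subst h1
    rw [h.faceWeight_inversion hd ha hb hc de cd, if_pos rfl, if_pos rfl]
    simp only [eq_comm (a := d)]
    split_ifs <;> ring
  · rw [if_neg h1, if_neg h1]; ring

lemma _root_.DiluteA.triangle_reverse (p lam : ℝ) (r e : ℤ → ℝ) (c : ℂ) (a b d : ℤ) :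
    triangle p lam r e c a b d = triangle p lam r e c d b a := by
  rw [triangle_swap, triangle_swap', triangle_swap]

lemma _root_.DiluteA.triangle_rotate (p lam : ℝ) (r e : ℤ → ℝ) (c : ℂ) (a b d : ℤ) :
    triangle p lam r e c a b d = triangle p lam r e c b d a := by
  rw [triangle_swap, triangle_swap']

lemma faceWeight_one_eq (h : IsRegular L p t lam r e k c) (ha : a ∈ heights L)
    (hb : b ∈ heights L) (hc : c' ∈ heights L) (hd : d ∈ heights L) :
    faceWeight p lam a b c' d lam = thetaOdd p lam / thetaOdd p (3 * lam)
        * (triangle p lam r e c a c' b * triangle p lam r e c a c' d) / (r b * r d) := by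
  have := h.r_ne hb
  have := h.r_ne hd
  rw [← h.faceWeight_one ha hb hc hd]
  field_simp

/-- The factorization at `u = λ`, carried to `u = 2λ` by crossing. -/
lemma faceWeight_two_eq (h : IsRegular L p t lam r e k c) (ha : a ∈ heights L)
    (hb : b ∈ heights L) (hc : c' ∈ heights L) (hd : d ∈ heights L) :
    faceWeight p lam a b c' d (2 * lam) = thetaOdd p lam / thetaOdd p (3 * lam) * (r a * r c')
        * (triangle p lam r e c d b a * triangle p lam r e c d b c')
        / ((r b : ℂ) ^ 2 * (r d : ℂ) ^ 2) := by
  have a0 := h.r_ne ha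
  have b0 := h.r_ne hb
  have c0 := h.r_ne hc
  have d0 := h.r_ne hd
  have X := h.faceWeight_crossing ha hb hc hd (2 * lam)
  rw [show 3 * (lam : ℂ) - 2 * lam = lam by ring, h.faceWeight_one_eq hd ha hb hc] at X
  rw [eq_div_iff (mul_ne_zero (pow_ne_zero 2 b0) (pow_ne_zero 2 d0)), X]
  field_simp

/-- At `u = λ`, `v = 2λ` the weights on both sides factor into the six triangles around `g`. -/
lemma ybeDefect_one_two (h : IsRegular L p t lam r e k c) (H : IsHexagon L a b c' d e' f) :
    ybeDefect L p lam a b c' d e' f lam (2 * lam) = 0 := by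
  obtain ⟨ha, hb, hc, hd, he, hf, ab, bc, cd, de, ef, fa⟩ := H
  rw [ybeDefect, ← Finset.sum_sub_distrib]
  refine Finset.sum_eq_zero fun g hg ↦ sub_eq_zero.mpr ?_
  have a0 := h.r_ne ha
  have b0 := h.r_ne hb
  have c0 := h.r_ne hc
  have d0 := h.r_ne hd
  have e0 := h.r_ne he
  have f0 := h.r_ne hf
  have g0 := h.r_ne hg
  rw [show 2 * (lam : ℂ) - lam = lam by ring, h.faceWeight_one_eq ha hb hg hf,
    h.faceWeight_two_eq hf hg hd he, h.faceWeight_one_eq hg hb hc hd,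
    h.faceWeight_one_eq hf ha hg he, h.faceWeight_two_eq ha hb hc hg,
    h.faceWeight_one_eq hg hc hd he, triangle_reverse p lam r e c f g a,
    triangle_reverse p lam r e c f g e', triangle_swap p lam r e c g b a,
    triangle_swap' p lam r e c b g a, triangle_rotate p lam r e c b a g,
    triangle_swap' p lam r e c g b c', triangle_swap' p lam r e c g d c',
    ← triangle_rotate p lam r e c e' g d]
  generalize triangle p lam r e c = T at *
  field_simp

end IsRegular

namespace IsRegular

variable {L : ℕ} {p lam : ℝ} {t : ℂ} {r e : ℤ → ℝ} {k c : ℂ} {a b c' d e' f : ℤ}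

lemma _root_.DiluteA.neg_one_zpow_mul {m n q : ℤ} (hmn : (m + n - q) % 2 = 0) :
    (-1 : ℂ) ^ m * (-1) ^ n = (-1) ^ q := by
  obtain ⟨j, hj⟩ := Int.dvd_of_emod_eq_zero hmn
  rw [← zpow_add₀ (by norm_num), show m + n = q + 2 * j by omega, zpow_add₀ (by norm_num),
    zpow_mul]
  norm_num

lemma ybeDefect_isThetaSum_right (h : IsRegular L p t lam r e k c)
    (H : IsHexagon L a b c' d e' f) (u : ℂ) :
    IsThetaSum p t 4 ((-1) ^ (f + e' + b + c'))
      (lam * (6 - (f ^ 2 - e' ^ 2 + c' ^ 2 - b ^ 2)) + 2 * u)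
      (fun v ↦ ybeDefect L p lam a b c' d e' f u v) := by
  obtain ⟨ha, hb, hc, hd, he, hf, -⟩ := H
  refine IsThetaSum.sub (IsTheta.sum _ fun g hg ↦ ?_) (IsTheta.sum _ fun g hg ↦ ?_)
  · have A := h.faceWeight_isThetaSum hf hg hd he
    have B := (h.faceWeight_isThetaSum hg hb hc hd).comp_sub u
    refine (((A.mul B).const_mul (faceWeight p lam a b g f u)).cast rfl
      (neg_one_zpow_mul (by omega)) ?_).congr
      fun v ↦ by ring
    push_cast
    ring
  · have A := h.faceWeight_isThetaSum ha hb hc hg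
    have B := (h.faceWeight_isThetaSum hf ha hg he).comp_sub u
    refine (((A.mul B).const_mul (faceWeight p lam g c' d e' u)).cast rfl
      (neg_one_zpow_mul (by omega)) ?_).congr
      fun v ↦ by ring
    push_cast
    ring

lemma ybeDefect_isThetaSum_left (h : IsRegular L p t lam r e k c)
    (H : IsHexagon L a b c' d e' f) (v : ℂ) :
    IsThetaSum p t 4 ((-1) ^ (a + f + c' + d))
      (lam * (f ^ 2 - a ^ 2 + c' ^ 2 - d ^ 2) + 2 * v)
      (fun u ↦ ybeDefect L p lam a b c' d e' f u v) := by
  obtain ⟨ha, hb, hc, hd, he, hf, -⟩ := H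
  refine IsThetaSum.sub (IsTheta.sum _ fun g hg ↦ ?_) (IsTheta.sum _ fun g hg ↦ ?_)
  · have A := h.faceWeight_isThetaSum ha hb hg hf
    have B := (h.faceWeight_isThetaSum hg hb hc hd).comp_const_sub h.halfPeriod
      ((neg_one_zpow_mul (q := 0) (by omega)).trans (zpow_zero _)) v
    refine (((A.mul B).const_mul (faceWeight p lam f g d e' v)).cast rfl
      (neg_one_zpow_mul (by omega)) ?_).congr
      fun v ↦ by ring
    push_cast
    ring
  · have A := h.faceWeight_isThetaSum hg hc hd he
    have B := (h.faceWeight_isThetaSum hf ha hg he).comp_const_sub h.halfPeriod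
      ((neg_one_zpow_mul (q := 0) (by omega)).trans (zpow_zero _)) v
    refine (((A.mul B).const_mul (faceWeight p lam a b c' g v)).cast rfl
      (neg_one_zpow_mul (by omega)) ?_).congr
      fun v ↦ by ring
    push_cast
    ring

lemma _root_.DiluteA.norm_neg_one_zpow (n : ℤ) : ‖(-1 : ℂ) ^ n‖ = 1 := by
  rw [norm_zpow]; simp

/-- The Yang–Baxter equation at `u = λ`: the defect is a theta function of degree four in `v` with
the zeros `0`, `λ`, `3λ`, `4λ` and `2λ`. -/
lemma ybeDefect_left_one (h : IsRegular L p t lam r e k c) (H : IsHexagon L a b c' d e' f)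
    (v : ℂ) : ybeDefect L p lam a b c' d e' f lam v = 0 := by
  have h1 := h.one
  have h2 := h.two
  have h3 := h.three
  have h4 := h.four
  refine IsThetaSum.eq_zero_of_extra_zero (zs := [0, 3 * lam, lam, 4 * lam]) h.halfPeriod
    (h.ybeDefect_isThetaSum_right H lam) ?_ ?_ (norm_neg_one_zpow _) ?_ (w := 2 * lam)
    (h.ybeDefect_one_two H) ?_ v
  · simp only [List.pairwise_cons, List.mem_cons, List.not_mem_nil, or_false, forall_eq_or_imp,
      forall_eq, List.Pairwise.nil, and_true, IsEmpty.forall_iff, implies_true]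
    refine ⟨⟨?_, ?_, ?_⟩, ⟨?_, ?_⟩, ?_⟩
    · rw [zero_sub]; exact thetaOdd_ne_zero_neg h3
    · rw [zero_sub]; exact thetaOdd_ne_zero_neg h1
    · rw [zero_sub]; exact thetaOdd_ne_zero_neg h4
    · rwa [show 3 * (lam : ℂ) - lam = 2 * lam by ring]
    · rw [show 3 * (lam : ℂ) - 4 * lam = -lam by ring]; exact thetaOdd_ne_zero_neg h1
    · rw [show (lam : ℂ) - 4 * lam = -(3 * lam) by ring]; exact thetaOdd_ne_zero_neg h3
  · simp only [List.mem_cons, List.not_mem_nil, or_false, forall_eq_or_imp, forall_eq]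
    refine ⟨h.ybeDefect_right_zero H _, h.ybeDefect_right_three H _, h.ybeDefect_diag H _, ?_⟩
    rw [show 4 * (lam : ℂ) = lam + 3 * lam by ring]
    exact h.ybeDefect_add_three H _
  · rw [show (lam : ℂ) * (6 - (f ^ 2 - e' ^ 2 + c' ^ 2 - b ^ 2)) + 2 * lam
      = ((lam * (6 - (f ^ 2 - e' ^ 2 + c' ^ 2 - b ^ 2)) + 2 * lam : ℝ) : ℂ) by push_cast; rfl,
      ofReal_im]
    simp
  · simp only [List.mem_cons, List.not_mem_nil, or_false, forall_eq_or_imp, forall_eq]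
    refine ⟨?_, ?_, ?_, ?_⟩
    · rwa [sub_zero]
    · rw [show 2 * (lam : ℂ) - 3 * lam = -lam by ring]; exact thetaOdd_ne_zero_neg h1
    · rwa [show 2 * (lam : ℂ) - lam = lam by ring]
    · rw [show 2 * (lam : ℂ) - 4 * lam = -(2 * lam) by ring]; exact thetaOdd_ne_zero_neg h2

/-- For generic `v` the defect is a theta function of degree four in `u` with the zeros `0`, `3λ`,
`v`, `v - 3λ` and `λ`. -/
lemma ybeDefect_eq_zero (h : IsRegular L p t lam r e k c) (ha : a ∈ heights L)
    (hb : b ∈ heights L) (hc : c' ∈ heights L) (hd : d ∈ heights L) (he : e' ∈ heights L)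
    (hf : f ∈ heights L) (u v : ℂ) : ybeDefect L p lam a b c' d e' f u v = 0 := by
  by_cases hadj : |a - b| ≤ 1 ∧ |b - c'| ≤ 1 ∧ |c' - d| ≤ 1 ∧ |d - e'| ≤ 1 ∧ |e' - f| ≤ 1 ∧
    |f - a| ≤ 1
  swap
  · exact ybeDefect_eq_zero_of_not_linked hadj
  have H : IsHexagon L a b c' d e' f := ⟨ha, hb, hc, hd, he, hf, hadj.1, hadj.2.1, hadj.2.2.1,
    hadj.2.2.2.1, hadj.2.2.2.2.1, hadj.2.2.2.2.2⟩
  have ht := h.halfPeriod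
  have h1 := h.one
  have h2 := h.two
  have h3 := h.three
  have hden : Dense ({v | thetaOdd p (1 * v + 0) ≠ 0} ∩ ({v | thetaOdd p (1 * v + -(3 * lam)) ≠ 0}
      ∩ ({v | thetaOdd p ((-1) * v + 6 * lam) ≠ 0} ∩ ({v | thetaOdd p ((-1) * v + lam) ≠ 0}
      ∩ {v | thetaOdd p ((-1) * v + 4 * lam) ≠ 0})))) := by
    have o := isOpen_thetaOdd_ne_zero ht
    have d1 := fun b ↦ dense_thetaOdd_ne_zero ht one_ne_zero b
    have d2 := fun b ↦ dense_thetaOdd_ne_zero ht (a := -1) (by norm_num) b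
    exact (d1 _).inter_of_isOpen_left ((d1 _).inter_of_isOpen_left ((d2 _).inter_of_isOpen_left
      ((d2 _).inter_of_isOpen_left (d2 _) (o _ _)) (o _ _)) (o _ _)) (o _ _)
  refine congrFun (Continuous.ext_on (f := fun v ↦ ybeDefect L p lam a b c' d e' f u v)
    (g := fun _ ↦ 0) hden (h.ybeDefect_isThetaSum_right H u).differentiable.continuous
    continuous_const fun v hv ↦ ?_) v
  obtain ⟨v1, v2, v3, v4, v5⟩ := hv
  simp only [Set.mem_ofPred_eq, one_mul, add_zero, neg_mul] at v1 v2 v3 v4 v5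
  rw [← sub_eq_add_neg] at v2
  rw [neg_add_eq_sub] at v3 v4 v5
  refine IsThetaSum.eq_zero_of_extra_zero (zs := [0, 3 * lam, v, v - 3 * lam]) h.halfPeriod
    (h.ybeDefect_isThetaSum_left H v) ?_ ?_ (norm_neg_one_zpow _) ?_ (w := lam)
    (h.ybeDefect_left_one H v) ?_ u
  · simp only [List.pairwise_cons, List.mem_cons, List.not_mem_nil, or_false, forall_eq_or_imp,
      forall_eq, List.Pairwise.nil, and_true, IsEmpty.forall_iff, implies_true]
    refine ⟨⟨?_, ?_, ?_⟩, ⟨?_, ?_⟩, ?_⟩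
    · rw [zero_sub]; exact thetaOdd_ne_zero_neg h3
    · rw [zero_sub]; exact thetaOdd_ne_zero_neg v1
    · rw [zero_sub]; exact thetaOdd_ne_zero_neg v2
    · rw [← neg_sub]; exact thetaOdd_ne_zero_neg v2
    · rwa [show 3 * (lam : ℂ) - (v - 3 * lam) = 6 * lam - v by ring]
    · rwa [sub_sub_cancel]
  · simp only [List.mem_cons, List.not_mem_nil, or_false, forall_eq_or_imp, forall_eq]
    refine ⟨h.ybeDefect_left_zero H _, h.ybeDefect_left_three H _, h.ybeDefect_diag H _, ?_⟩
    have := h.ybeDefect_add_three H (v - 3 * lam)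
    rwa [sub_add_cancel] at this
  · rw [show (lam : ℂ) * (f ^ 2 - a ^ 2 + c' ^ 2 - d ^ 2) + 2 * v
      = ((lam * (f ^ 2 - a ^ 2 + c' ^ 2 - d ^ 2) : ℝ) : ℂ) + 2 * v by push_cast; rfl, add_im,
      ofReal_im, show [0, 3 * (lam : ℂ), v, v - 3 * lam].sum = 2 * v by simp; ring, zero_add]
  · simp only [List.mem_cons, List.not_mem_nil, or_false, forall_eq_or_imp, forall_eq]
    refine ⟨?_, ?_, ?_, ?_⟩
    · rwa [sub_zero]
    · rw [show (lam : ℂ) - 3 * lam = -(2 * lam) by ring]; exact thetaOdd_ne_zero_neg h2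
    · exact v4
    · rwa [show (lam : ℂ) - (v - 3 * lam) = 4 * lam - v by ring]

/-- The Yang–Baxter equation of the elementary weights. -/
lemma faceWeight_yang_baxter (h : IsRegular L p t lam r e k c) (ha : a ∈ heights L)
    (hb : b ∈ heights L) (hc : c' ∈ heights L) (hd : d ∈ heights L) (he : e' ∈ heights L)
    (hf : f ∈ heights L) (u v : ℂ) :
    ∑ g ∈ heights L, faceWeight p lam a b g f u * faceWeight p lam f g d e' v
        * faceWeight p lam g b c' d (v - u)
      = ∑ g ∈ heights L, faceWeight p lam f a g e' (v - u) * faceWeight p lam a b c' g v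
        * faceWeight p lam g c' d e' u :=
  sub_eq_zero.mp (h.ybeDefect_eq_zero ha hb hc hd he hf u v)

end IsRegular

/-! ### Independent paths -/

/-- Pairs of heights, by the set of two-step paths between them: two heights more than two apart, at
distance two or one, a boundary height, or an interior one. -/
lemma path_cases {L : ℕ} (hL : 2 ≤ L) {a b : ℤ} (ha : a ∈ heights L) (hb : b ∈ heights L) :
    2 < |a - b| ∨ (∃ s : ℤ, (s = 1 ∨ s = -1) ∧ b = a + 2 * s) ∨
      (∃ s : ℤ, (s = 1 ∨ s = -1) ∧ b = a + s) ∨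
      (b = a ∧ ∃ s : ℤ, (s = 1 ∨ s = -1) ∧ a + s ∈ heights L ∧ a - s ∉ heights L) ∨
      (b = a ∧ a + 1 ∈ heights L ∧ a - 1 ∈ heights L) := by
  simp only [mem_heights] at *
  by_cases h0 : b = a
  · subst h0
    by_cases h1 : b = 1
    · exact Or.inr (Or.inr (Or.inr (Or.inl ⟨rfl, 1, by omega⟩)))
    · by_cases h2 : b = L
      · exact Or.inr (Or.inr (Or.inr (Or.inl ⟨rfl, -1, by omega⟩)))
      · exact Or.inr (Or.inr (Or.inr (Or.inr (by omega))))
  · by_cases h1 : b - a = 1 ∨ b - a = -1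
    · exact Or.inr (Or.inr (Or.inl ⟨b - a, h1, by omega⟩))
    · by_cases h2 : b - a = 2
      · exact Or.inr (Or.inl ⟨1, by omega⟩)
      · by_cases h3 : b - a = -2
        · exact Or.inr (Or.inl ⟨-1, by omega⟩)
        · left
          rw [lt_abs]
          omega

lemma sum_effAdj {L : ℕ} {a b : ℤ} (ha : a ∈ heights L) (hb : b ∈ heights L) {S : Finset ℤ}
    (hS : ∀ x, IsPath L a x b ↔ x ∈ S) : ∑ g ∈ heights L, effAdj a g * effAdj g b = S.card := by
  have e : ∀ g ∈ heights L, effAdj a g * effAdj g b = if g ∈ S then 1 else 0 := fun g hg ↦ by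
    have : g ∈ S ↔ |a - g| ≤ 1 ∧ |g - b| ≤ 1 := by
      rw [← hS]; exact ⟨fun h ↦ h.2.2.2, fun h ↦ ⟨ha, hg, hb, h⟩⟩
    simp only [effAdj, this, ite_and]
    split_ifs <;> rfl
  rw [Finset.sum_congr rfl e, Finset.sum_ite_mem, Finset.sum_const, nsmul_eq_mul, mul_one,
    Finset.inter_eq_right.mpr fun x hx ↦ ((hS x).mpr hx).2.1]

lemma fusedAdj20_eq {L : ℕ} {a b : ℤ} (ha : a ∈ heights L) (hb : b ∈ heights L) {S : Finset ℤ}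
    (hS : ∀ x, IsPath L a x b ↔ x ∈ S) :
    fusedAdj20 L a b = S.card - if |a - b| ≤ 1 then 1 else 0 := by
  rw [fusedAdj20, sum_effAdj ha hb hS, effAdj]
  split_ifs <;> omega

lemma valence_eq {L : ℕ} {a : ℤ} (ha : a ∈ heights L) {S : Finset ℤ}
    (hS : ∀ x, IsPath L a x a ↔ x ∈ S) : valence L a = S.card := by
  rw [valence, ← sum_effAdj ha ha hS]
  refine Finset.sum_congr rfl fun g _ ↦ ?_
  rw [effAdj, effAdj, abs_sub_comm g a]
  split_ifs <;> rfl

section paths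

variable {L : ℕ} {a b s : ℤ}

lemma isPath_far (h : 2 < |a - b|) (x : ℤ) : ¬IsPath L a x b := by
  rintro ⟨-, -, -, h1, h2⟩
  rw [abs_le] at h1 h2
  rw [lt_abs] at h
  omega

lemma isPath_two (hs : s = 1 ∨ s = -1) (ha : a ∈ heights L) (hb : a + 2 * s ∈ heights L) (x : ℤ) :
    IsPath L a x (a + 2 * s) ↔ x = a + s := by
  simp only [IsPath, mem_heights, abs_le] at *
  omega

lemma isPath_one (hs : s = 1 ∨ s = -1) (ha : a ∈ heights L) (hb : a + s ∈ heights L) (x : ℤ) :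
    IsPath L a x (a + s) ↔ x = max a (a + s) ∨ x = min a (a + s) := by
  simp only [IsPath, mem_heights, abs_le] at *
  omega

lemma isPath_boundary (hs : s = 1 ∨ s = -1) (ha : a ∈ heights L) (h1 : a + s ∈ heights L)
    (h2 : a - s ∉ heights L) (x : ℤ) : IsPath L a x a ↔ x = a + s ∨ x = a := by
  simp only [IsPath, mem_heights, abs_le] at *
  omega

lemma isPath_interior (h1 : a + 1 ∈ heights L)
    (h2 : a - 1 ∈ heights L) (x : ℤ) : IsPath L a x a ↔ x = a + 1 ∨ x = a - 1 ∨ x = a := by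
  simp only [IsPath, mem_heights, abs_le] at *
  omega

lemma indPath20_far (h : 2 < |a - b|) : indPath20 L a b = [] := by
  simp [indPath20, isPath_far h]

lemma indPath20_two (hs : s = 1 ∨ s = -1) (ha : a ∈ heights L) (hb : a + 2 * s ∈ heights L) :
    indPath20 L a (a + 2 * s) = [a + s] := by
  simp only [indPath20, isPath_two hs ha hb]
  rcases hs with rfl | rfl
  · have h1 : ¬a - 1 = a + 1 := by omega
    have h2 : ¬a = a + 1 := by omega
    simp [h1, h2]
  · have h1 : ¬a + 1 = a + -1 := by omega
    have h2 : ¬a = a + -1 := by omega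
    have h3 : a - 1 = a + -1 := by omega
    simp [h3]

lemma indPath20_one (hs : s = 1 ∨ s = -1) (ha : a ∈ heights L) (hb : a + s ∈ heights L) :
    indPath20 L a (a + s) = [max a (a + s)] := by
  simp only [indPath20, isPath_one hs ha hb]
  rcases hs with rfl | rfl
  · have h1 : ¬a - 1 = a + 1 := by omega
    have h2 : ¬a - 1 = a := by omega
    simp [h1, h2]
  · simp

lemma indPath20_boundary (hs : s = 1 ∨ s = -1) (ha : a ∈ heights L) (h1 : a + s ∈ heights L)
    (h2 : a - s ∉ heights L) : indPath20 L a a = [a + s] := by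
  simp only [indPath20, isPath_boundary hs ha h1 h2]
  rcases hs with rfl | rfl
  · have h1 : ¬a - 1 = a + 1 := by omega
    simp [h1]
  · have h1 : ¬a + 1 = a + -1 := by omega
    simp [h1, sub_eq_add_neg]

lemma indPath20_interior (h1 : a + 1 ∈ heights L)
    (h2 : a - 1 ∈ heights L) : indPath20 L a a = [a + 1, a - 1] := by
  simp only [indPath20, isPath_interior h1 h2]
  have h1 : ¬a - 1 = a + 1 := by omega
  simp

lemma fusedAdj20_far (ha : a ∈ heights L) (hb : b ∈ heights L) (h : 2 < |a - b|) :
    fusedAdj20 L a b = 0 := by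
  rw [fusedAdj20_eq ha hb (S := ∅) fun x ↦ by simp [isPath_far h]]
  simp

lemma fusedAdj20_two (hs : s = 1 ∨ s = -1) (ha : a ∈ heights L) (hb : a + 2 * s ∈ heights L) :
    fusedAdj20 L a (a + 2 * s) = 1 := by
  rw [fusedAdj20_eq ha hb (S := {a + s}) fun x ↦ by simp [isPath_two hs ha hb], if_neg,
    Finset.card_singleton]
  rw [abs_le]; omega

lemma fusedAdj20_one (hs : s = 1 ∨ s = -1) (ha : a ∈ heights L) (hb : a + s ∈ heights L) :
    fusedAdj20 L a (a + s) = 1 := by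
  rw [fusedAdj20_eq ha hb (S := {max a (a + s), min a (a + s)}) fun x ↦ by
    simp only [isPath_one hs ha hb, Finset.mem_insert, Finset.mem_singleton], if_pos,
    Finset.card_pair]
  · omega
  · rw [abs_le]; omega

lemma fusedAdj20_boundary (hs : s = 1 ∨ s = -1) (ha : a ∈ heights L) (h1 : a + s ∈ heights L)
    (h2 : a - s ∉ heights L) : fusedAdj20 L a a = 1 := by
  rw [fusedAdj20_eq ha ha (S := {a + s, a}) fun x ↦ by
    simp only [isPath_boundary hs ha h1 h2, Finset.mem_insert, Finset.mem_singleton], if_pos,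
    Finset.card_pair]
  · omega
  · simp

lemma card_interior (a : ℤ) : ({a + 1, a - 1, a} : Finset ℤ).card = 3 :=
  Finset.card_eq_three.mpr ⟨_, _, _, by omega, by omega, by omega, rfl⟩

lemma fusedAdj20_interior (ha : a ∈ heights L) (h1 : a + 1 ∈ heights L)
    (h2 : a - 1 ∈ heights L) : fusedAdj20 L a a = 2 := by
  rw [fusedAdj20_eq ha ha (S := {a + 1, a - 1, a}) fun x ↦ by
    simp only [isPath_interior h1 h2, Finset.mem_insert, Finset.mem_singleton], if_pos,
    card_interior]
  simp

lemma valence_boundary (hs : s = 1 ∨ s = -1) (ha : a ∈ heights L) (h1 : a + s ∈ heights L)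
    (h2 : a - s ∉ heights L) : valence L a = 2 := by
  rw [valence_eq ha (S := {a + s, a}) fun x ↦ by
    simp only [isPath_boundary hs ha h1 h2, Finset.mem_insert, Finset.mem_singleton],
    Finset.card_pair]
  · rfl
  · omega

lemma valence_interior (ha : a ∈ heights L) (h1 : a + 1 ∈ heights L)
    (h2 : a - 1 ∈ heights L) : valence L a = 3 := by
  rw [valence_eq ha (S := {a + 1, a - 1, a}) fun x ↦ by
    simp only [isPath_interior h1 h2, Finset.mem_insert, Finset.mem_singleton], card_interior]
  rfl

lemma length_indPath20 (hL : 2 ≤ L) (ha : a ∈ heights L) (hb : b ∈ heights L) :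
    (indPath20 L a b).length = fusedAdj20 L a b := by
  rcases path_cases hL ha hb with h | ⟨s, hs, rfl⟩ | ⟨s, hs, rfl⟩ | ⟨rfl, s, hs, h1, h2⟩ |
    ⟨rfl, h1, h2⟩
  · rw [indPath20_far h, fusedAdj20_far ha hb h]; rfl
  · rw [indPath20_two hs ha hb, fusedAdj20_two hs ha hb]; rfl
  · rw [indPath20_one hs ha hb, fusedAdj20_one hs ha hb]; rfl
  · rw [indPath20_boundary hs ha h1 h2, fusedAdj20_boundary hs ha h1 h2]; rfl
  · rw [indPath20_interior h1 h2, fusedAdj20_interior ha h1 h2]; rfl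

end paths

/-! ### The coefficients of the fused path space -/

section coefficients

variable {L : ℕ} {p lam : ℝ} {a b s : ℤ}

lemma phi20_of_not_isPath {x : ℤ} (h : ¬IsPath L a x b) (α : ℕ) : phi20 L p lam a x b α = 0 := by
  simp [phi20, h]

/-- The coefficient `φ(a, a, a | α)` in terms of the middle height `y` of the path `α`. -/
noncomputable def turnCoeff (p lam : ℝ) (a y : ℤ) : ℂ :=
  -(theta1 p lam / theta1 p (2 * lam) * (crossing2 p lam y a / crossing2 p lam a a))

lemma phi20_two (hs : s = 1 ∨ s = -1) (ha : a ∈ heights L) (hb : a + 2 * s ∈ heights L) :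
    phi20 L p lam a (a + s) (a + 2 * s) 1 = 1 := by
  have h1 : |a - (a + 2 * s)| = 2 := by rcases hs with rfl | rfl <;> simp
  rw [phi20, if_neg (not_not.mpr ((isPath_two hs ha hb _).mpr rfl)), if_pos h1, if_pos rfl]

lemma phi20_one_max (hs : s = 1 ∨ s = -1) (ha : a ∈ heights L) (hb : a + s ∈ heights L) :
    phi20 L p lam a (max a (a + s)) (a + s) 1 = 1 := by
  have h1 : |a - (a + s)| = 1 := by rcases hs with rfl | rfl <;> simp
  have h2 : IsPath L a (max a (a + s)) (a + s) := (isPath_one hs ha hb _).mpr (Or.inl rfl)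
  have h3 : indMid20 L a (a + s) 1 = max a (a + s) := by
    simp [indMid20, indPath20_one hs ha hb]
  rw [phi20, if_neg (not_not.mpr h2), if_neg (by omega), if_pos h1, h3, sub_self, zpow_zero,
    if_pos rfl, mul_one]

lemma phi20_one_min (hs : s = 1 ∨ s = -1) (ha : a ∈ heights L) (hb : a + s ∈ heights L) :
    phi20 L p lam a (min a (a + s)) (a + s) 1
      = -csqrt (theta4 p (2 * (max a (a + s) : ℤ) * lam + lam)
        / theta4 p (2 * (max a (a + s) : ℤ) * lam - 3 * lam)) := by
  have h1 : |a - (a + s)| = 1 := by rcases hs with rfl | rfl <;> simp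
  have h2 : IsPath L a (min a (a + s)) (a + s) := (isPath_one hs ha hb _).mpr (Or.inr rfl)
  have h3 : indMid20 L a (a + s) 1 = max a (a + s) := by
    simp [indMid20, indPath20_one hs ha hb]
  rw [phi20, if_neg (not_not.mpr h2), if_neg (by omega), if_pos h1, h3,
    show max a (a + s) - min a (a + s) = 1 by omega, zpow_one, if_pos rfl, mul_one]

lemma phi20_boundary (hs : s = 1 ∨ s = -1) (ha : a ∈ heights L) (h1 : a + s ∈ heights L)
    (h2 : a - s ∉ heights L) {x : ℤ} (hx : IsPath L a x a) :
    phi20 L p lam a x a 1 = if a = x then turnCoeff p lam a (a + s) else 1 := by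
  have h3 : indMid20 L a a 1 = a + s := by
    simp [indMid20, indPath20_boundary hs ha h1 h2]
  rw [phi20, if_neg (not_not.mpr hx), if_neg (by simp), if_neg (by simp),
    if_pos ⟨rfl, valence_boundary hs ha h1 h2⟩, if_pos rfl, mul_one, h3, turnCoeff]

lemma phi20_interior (ha : a ∈ heights L) (h1 : a + 1 ∈ heights L) (h2 : a - 1 ∈ heights L)
    {x : ℤ} (hx : IsPath L a x a) (α : ℕ) :
    phi20 L p lam a x a α = if |indMid20 L a a α - x| < 2 then
      (if a = x then turnCoeff p lam a (indMid20 L a a α) else 1) else 0 := by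
  rw [phi20, if_neg (not_not.mpr hx), if_neg (by simp), if_neg (by simp), if_neg (by
    rw [valence_interior ha h1 h2]; norm_num)]
  simp only [true_and, valence_interior ha h1 h2]
  rfl

end coefficients

/-- The vector spanning the range of the weights at `u = 2λ` on the paths from `a` to `b`. -/
noncomputable def fusionVector (p lam : ℝ) (r e : ℤ → ℝ) (c : ℂ) (a b x : ℤ) : ℂ :=
  r x * triangle p lam r e c b a x

namespace IsRegular

variable {L : ℕ} {p lam : ℝ} {t : ℂ} {r e : ℤ → ℝ} {k c : ℂ} {a b s : ℤ}

/-- The principal root is multiplicative if one factor is positive. -/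
lemma _root_.DiluteA.csqrt_mul_pow_four (k : ℂ) {x : ℝ} (hx : 0 < x) :
    csqrt (k * (x : ℂ) ^ 4) = csqrt k * (x : ℂ) ^ 2 := by
  rcases eq_or_ne k 0 with rfl | hk
  · simp [csqrt]
  have h4 : (0 : ℝ) < x ^ 4 := by positivity
  have hx4 : ((x ^ 4 : ℝ) : ℂ) ≠ 0 := ofReal_ne_zero.mpr h4.ne'
  have e1 := csqrt_sq (y := x ^ 2) (by positivity)
  rw [csqrt, ofReal_pow, ← pow_mul, ← ofReal_pow, cpow_def_of_ne_zero hx4, ← ofReal_log h4.le] at e1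
  rw [csqrt, csqrt, ← ofReal_pow, mul_comm, cpow_def_of_ne_zero (mul_ne_zero hx4 hk),
    log_ofReal_mul h4 hk, add_mul, exp_add, ← cpow_def_of_ne_zero hk, e1]
  ring

lemma turnCoeff_eq (h : IsRegular L p t lam r e k c) (hs : s = 1 ∨ s = -1) (ha : a ∈ heights L)
    (hb : a + s ∈ heights L) : turnCoeff p lam a (a + s)
      = -(thetaOdd p lam / thetaOdd p (2 * lam) * ((r (a + s) : ℂ) / r a) ^ 2
        * (c * (e a * e (a - 1)) * sideRoot e a s / theta4 p (2 * a * lam))) := by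
  have hk : csqrt k ≠ 0 := by rw [csqrt]; simp [h.k_ne]
  have a0 := h.r_ne ha
  have q0 := (h.isSite_one ha).theta4_w
  have e1 := h.theta4_site' a hs
  have e2 : theta4 p (2 * a * lam + (a - (a + s : ℤ)) * lam)
      = theta4 p (s * 2 * a * lam - lam) := by
    rcases hs with rfl | rfl
    · congr 1; push_cast; ring
    · rw [← theta4_neg]; congr 1; push_cast; ring
  have ha' := mem_heights.mp ha
  have hb' := mem_heights.mp hb
  rw [turnCoeff, theta1_div, crossing2, crossing2, e2, e1, h.crossing_eq a (by omega) (by omega),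
    h.crossing_eq (a + s) (by omega) (by omega), csqrt_mul_pow_four k (h.r_pos a ha),
    csqrt_mul_pow_four k (h.r_pos _ hb), sub_self, zero_mul, add_zero]
  field_simp

lemma fusionVector_two (hs : s = 1 ∨ s = -1) (x : ℤ) :
    fusionVector p lam r e c a (a + 2 * s) x = 0 := by
  rw [fusionVector, triangle_eq_zero, mul_zero]
  rw [abs_le]; omega

lemma fusionVector_same (h : IsRegular L p t lam r e k c) (hs : s = 1 ∨ s = -1)
    (ha : a ∈ heights L) (hb : a + s ∈ heights L) :
    turnCoeff p lam a (a + s) * fusionVector p lam r e c a a a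
      + fusionVector p lam r e c a a (a + s) = 0 := by
  have a0 := h.r_ne ha
  have q0 := (h.isSite_one ha).theta4_w
  have o := h.one
  have o2 := h.two
  have e1 := h.e_ne a
  have e2 := h.e_ne (a - 1)
  have c0 := h.c_ne
  rw [h.turnCoeff_eq hs ha hb, fusionVector, fusionVector, triangle_same,
    triangle_step _ _ _ _ _ _ hs]
  generalize thetaOdd p (2 * lam) = x at *
  generalize theta4 p (2 * a * lam) = y at *
  field_simp
  ring

lemma fusionVector_same_ne (h : IsRegular L p t lam r e k c) (ha : a ∈ heights L) :
    fusionVector p lam r e c a a a ≠ 0 := by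
  rw [fusionVector, triangle_same]
  exact mul_ne_zero (h.r_ne ha) (div_ne_zero (mul_ne_zero (h.r_ne ha)
    (mul_ne_zero h.two (h.isSite_one ha).theta4_w))
    (mul_ne_zero h.one (mul_ne_zero h.c_ne (mul_ne_zero (h.e_ne _) (h.e_ne _)))))

lemma fusionVector_one (h : IsRegular L p t lam r e k c) (hs : s = 1 ∨ s = -1)
    (ha : a ∈ heights L) (hb : a + s ∈ heights L) :
    fusionVector p lam r e c a (a + s) (min a (a + s)) ≠ 0 ∧
    phi20 L p lam a (min a (a + s)) (a + s) 1
      * fusionVector p lam r e c a (a + s) (min a (a + s))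
      + fusionVector p lam r e c a (a + s) (max a (a + s)) = 0 := by
  have key : ∀ m, m ∈ heights L → m + 1 ∈ heights L →
      fusionVector p lam r e c m (m + 1) m ≠ 0 ∧
      -csqrt (theta4 p (2 * (m + 1 : ℤ) * lam + lam) / theta4 p (2 * (m + 1 : ℤ) * lam - 3 * lam))
      * fusionVector p lam r e c m (m + 1) m + fusionVector p lam r e c m (m + 1) (m + 1) = 0 := by
    intro m hm hm1
    have m0 := h.r_ne hm
    have m1 := h.r_ne hm1
    have e0 := h.e_ne m
    have e1 := h.e_ne (m - 1)
    have p1 := h.e_pos (m + 1)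
    have p2 := h.e_pos (m - 1)
    have c0 := h.c_ne
    have t1 := triangle_step p lam r e c m (s := 1) (Or.inl rfl)
    have t2 := triangle_step p lam r e c (m + 1) (s := -1) (Or.inr rfl)
    rw [triangle_rotate, triangle_rotate] at t1
    rw [add_neg_cancel_right, triangle_swap'] at t2
    have e3 : csqrt (theta4 p (2 * (m + 1 : ℤ) * lam + lam)
        / theta4 p (2 * (m + 1 : ℤ) * lam - 3 * lam)) = e (m + 1) / e (m - 1) := by
      rw [show 2 * ((m + 1 : ℤ) : ℂ) * lam - 3 * lam = 2 * ((m - 1 : ℤ) : ℂ) * lam + lam by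
        push_cast; ring, h.theta4_eq, h.theta4_eq,
        show c * (e (m + 1) : ℂ) ^ 2 / (c * (e (m - 1) : ℂ) ^ 2)
          = ((e (m + 1) / e (m - 1) : ℝ) : ℂ) ^ 2 by push_cast; field_simp,
        csqrt_sq (by positivity)]
      push_cast
      rfl
    rw [e3, fusionVector, fusionVector, t1, t2]
    simp only [sideRoot]
    refine ⟨mul_ne_zero m0 (mul_ne_zero m1 (by simp [e0, e1])), ?_⟩
    simp
    field_simp
    ring
  have sym : ∀ x, fusionVector p lam r e c (a + s) a x = fusionVector p lam r e c a (a + s) x := by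
    intro x; rw [fusionVector, fusionVector, triangle_swap]
  rw [phi20_one_min hs ha hb]
  rcases hs with rfl | rfl
  · rw [min_eq_left (by omega), max_eq_right (by omega)]
    exact key a ha hb
  · have := key (a + -1) hb (by simpa using ha)
    rw [neg_add_cancel_right] at this
    rw [min_eq_right (by omega), max_eq_left (by omega), ← sym, ← sym]
    exact this

end IsRegular

namespace IsRegular

variable {L : ℕ} {p lam : ℝ} {t : ℂ} {r e : ℤ → ℝ} {k c : ℂ} {a b : ℤ}

/-- The coefficients of a fused path annihilate the fusion vector. -/
lemma sum_phi20_mul_fusionVector (h : IsRegular L p t lam r e k c) (hL : 2 ≤ L)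
    (ha : a ∈ heights L) (hb : b ∈ heights L) {α : ℕ} (hα : α ∈ Finset.Icc 1 (fusedAdj20 L a b)) :
    ∑ x ∈ heights L, phi20 L p lam a x b α * fusionVector p lam r e c a b x = 0 := by
  rw [Finset.mem_Icc] at hα
  rcases path_cases hL ha hb with hf | ⟨s, hs, rfl⟩ | ⟨s, hs, rfl⟩ | ⟨rfl, s, hs, h1, h2⟩ |
    ⟨rfl, h1, h2⟩
  · rw [fusedAdj20_far ha hb hf] at hα
    omega
  · exact Finset.sum_eq_zero fun x _ ↦ by rw [fusionVector_two hs, mul_zero]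
  · rw [fusedAdj20_one hs ha hb] at hα
    obtain rfl : α = 1 := by omega
    rw [Finset.sum_eq_add_of_mem (max a (a + s)) (min a (a + s)), phi20_one_max hs ha hb]
    · linear_combination (h.fusionVector_one hs ha hb).2
    · rcases max_choice a (a + s) with e | e <;> rw [e] <;> assumption
    · rcases min_choice a (a + s) with e | e <;> rw [e] <;> assumption
    · omega
    · intro x _ hx
      rw [phi20_of_not_isPath, zero_mul]
      rw [isPath_one hs ha hb]
      tauto
  · rw [fusedAdj20_boundary hs ha h1 h2] at hα
    obtain rfl : α = 1 := by omega
    have P := isPath_boundary hs ha h1 h2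
    rw [Finset.sum_eq_add_of_mem (b + s) b h1 ha (by omega),
      phi20_boundary hs ha h1 h2 ((P _).mpr (Or.inl rfl)),
      phi20_boundary hs ha h1 h2 ((P _).mpr (Or.inr rfl)), if_neg (by omega), if_pos rfl]
    · linear_combination h.fusionVector_same hs ha h1
    · intro x _ hx
      rw [phi20_of_not_isPath, zero_mul]
      rw [P]
      tauto
  · rw [fusedAdj20_interior ha h1 h2] at hα
    have P := isPath_interior h1 h2
    have Q1 := (P _).mpr (Or.inl rfl)
    have Q2 := (P _).mpr (Or.inr (Or.inl rfl))
    have Q3 := (P _).mpr (Or.inr (Or.inr rfl))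
    rw [sum_heights_three (s := 1) (Or.inl rfl) ha _ ?_ (fun hn ↦ absurd h1 hn)
      (fun hn ↦ absurd h2 hn), phi20_interior ha h1 h2 Q1, phi20_interior ha h1 h2 Q2,
      phi20_interior ha h1 h2 Q3]
    · obtain rfl | rfl : α = 1 ∨ α = 2 := by omega
      · have h3 : indMid20 L b b 1 = b + 1 := by simp [indMid20, indPath20_interior h1 h2]
        rw [h3]
        simp only [sub_self, add_sub_cancel_left, add_sub_sub_cancel]
        norm_num
        linear_combination h.fusionVector_same (Or.inl rfl) ha h1
      · have h3 : indMid20 L b b 2 = b - 1 := by simp [indMid20, indPath20_interior h1 h2]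
        rw [h3]
        have e1 : b - 1 - b = -1 := by omega
        have e2 : b - 1 - (b + 1) = -2 := by omega
        have e3 : b ≠ b - 1 := by omega
        have F := h.fusionVector_same (s := -1) (Or.inr rfl) ha h2
        rw [← sub_eq_add_neg] at F
        simp only [sub_self, e1, e2, e3, if_false]
        norm_num
        linear_combination F
    · intro g hg
      rw [phi20_of_not_isPath, zero_mul]
      rw [P]
      rw [abs_le] at hg
      omega

/-- A function on the paths from `a` to `b` which annihilates the fusion vector is determined by
its values on the independent paths. -/
lemma sum_phi20_mul_indMid20 (h : IsRegular L p t lam r e k c) (hL : 2 ≤ L)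
    (ha : a ∈ heights L) (hb : b ∈ heights L) {F : ℤ → ℂ} (hF : ∀ x, ¬IsPath L a x b → F x = 0)
    (hsum : ∑ x ∈ heights L, F x * fusionVector p lam r e c a b x = 0) (y : ℤ) :
    ∑ β ∈ Finset.Icc 1 (fusedAdj20 L a b), phi20 L p lam a y b β * F (indMid20 L a b β) = F y := by
  by_cases hy : IsPath L a y b
  swap
  · rw [hF y hy]
    exact Finset.sum_eq_zero fun β _ ↦ by rw [phi20_of_not_isPath hy, zero_mul]
  rcases path_cases hL ha hb with hf | ⟨s, hs, rfl⟩ | ⟨s, hs, rfl⟩ | ⟨rfl, s, hs, h1, h2⟩ |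
    ⟨rfl, h1, h2⟩
  · exact absurd hy (isPath_far hf y)
  · rw [isPath_two hs ha hb] at hy
    subst hy
    have h3 : indMid20 L a (a + 2 * s) 1 = a + s := by simp [indMid20, indPath20_two hs ha hb]
    rw [fusedAdj20_two hs ha hb, Finset.Icc_self, Finset.sum_singleton, phi20_two hs ha hb, h3,
      one_mul]
  · have h3 : indMid20 L a (a + s) 1 = max a (a + s) := by simp [indMid20, indPath20_one hs ha hb]
    rw [fusedAdj20_one hs ha hb, Finset.Icc_self, Finset.sum_singleton, h3]
    rcases (isPath_one hs ha hb y).mp hy with rfl | rfl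
    · rw [phi20_one_max hs ha hb, one_mul]
    · obtain ⟨n, k⟩ := h.fusionVector_one hs ha hb
      rw [Finset.sum_eq_add_of_mem (max a (a + s)) (min a (a + s))] at hsum
      · refine mul_right_cancel₀ n ?_
        linear_combination F (max a (a + s)) * k - hsum
      · rcases max_choice a (a + s) with e | e <;> rw [e] <;> assumption
      · rcases min_choice a (a + s) with e | e <;> rw [e] <;> assumption
      · omega
      · intro x _ hx
        rw [hF, zero_mul]
        rw [isPath_one hs ha hb]
        tauto
  · have P := isPath_boundary hs ha h1 h2
    have h3 : indMid20 L b b 1 = b + s := by simp [indMid20, indPath20_boundary hs ha h1 h2]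
    rw [fusedAdj20_boundary hs ha h1 h2, Finset.Icc_self, Finset.sum_singleton, h3,
      phi20_boundary hs ha h1 h2 hy]
    rcases (P y).mp hy with rfl | rfl
    · rw [if_neg (by omega), one_mul]
    · rw [if_pos rfl]
      have n := h.fusionVector_same_ne ha
      have k := h.fusionVector_same hs ha h1
      rw [Finset.sum_eq_add_of_mem (y + s) y h1 ha (by omega)] at hsum
      · refine mul_right_cancel₀ n ?_
        linear_combination F (y + s) * k - hsum
      · intro x _ hx
        rw [hF, zero_mul]
        rw [P]
        tauto
  · have P := isPath_interior h1 h2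
    have h3 : indMid20 L b b 1 = b + 1 := by simp [indMid20, indPath20_interior h1 h2]
    have h4 : indMid20 L b b 2 = b - 1 := by simp [indMid20, indPath20_interior h1 h2]
    rw [fusedAdj20_interior ha h1 h2, show Finset.Icc 1 2 = {1, 2} from rfl,
      Finset.sum_pair (by norm_num), phi20_interior ha h1 h2 hy, phi20_interior ha h1 h2 hy, h3, h4]
    have e1 : b - 1 - b = -1 := by omega
    have e2 : b - 1 - (b + 1) = -2 := by omega
    have e3 : b ≠ b - 1 := by omega
    rcases (P y).mp hy with rfl | rfl | rfl
    · simp [e2]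
    · simp [e3]
    · simp only [e1, add_sub_cancel_left]
      norm_num
      have n := h.fusionVector_same_ne ha
      have k1 := h.fusionVector_same (Or.inl rfl) ha h1
      have k2 := h.fusionVector_same (s := -1) (Or.inr rfl) ha h2
      rw [← sub_eq_add_neg] at k2
      rw [sum_heights_three (s := 1) (Or.inl rfl) ha _ ?_ (fun hn ↦ absurd h1 hn)
        (fun hn ↦ absurd h2 hn)] at hsum
      · refine mul_right_cancel₀ n ?_
        linear_combination F (y + 1) * k1 + F (y - 1) * k2 - hsum
      · intro g hg
        rw [hF, zero_mul]
        rw [P]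
        rw [abs_le] at hg
        omega

/-- At `u = 2λ` the weights form a matrix of rank one in the middle heights of the two paths
from `a` to `b`. -/
lemma faceWeight_two_eq_fusionVector (h : IsRegular L p t lam r e k c) {x y : ℤ}
    (ha : a ∈ heights L) (hb : b ∈ heights L) (hx : x ∈ heights L) (hy : y ∈ heights L) :
    faceWeight p lam x a y b (2 * lam) = thetaOdd p lam / thetaOdd p (3 * lam)
      / ((r a : ℂ) ^ 2 * (r b : ℂ) ^ 2)
      * (fusionVector p lam r e c a b x * fusionVector p lam r e c a b y) := by
  rw [h.faceWeight_two_eq hx ha hy hb, fusionVector, fusionVector]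
  ring

lemma sum_phi20_mul_faceWeight (h : IsRegular L p t lam r e k c) (hL : 2 ≤ L)
    (ha : a ∈ heights L) (hb : b ∈ heights L) {α : ℕ} (hα : α ∈ Finset.Icc 1 (fusedAdj20 L a b))
    {y : ℤ} (hy : y ∈ heights L) :
    ∑ x ∈ heights L, phi20 L p lam a x b α * faceWeight p lam x a y b (2 * lam) = 0 := by
  have e1 : ∀ x ∈ heights L, phi20 L p lam a x b α * faceWeight p lam x a y b (2 * lam)
      = phi20 L p lam a x b α * fusionVector p lam r e c a b x
        * (thetaOdd p lam / thetaOdd p (3 * lam)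
      / ((r a : ℂ) ^ 2 * (r b : ℂ) ^ 2) * fusionVector p lam r e c a b y) := fun x hx ↦ by
    rw [h.faceWeight_two_eq_fusionVector ha hb hx hy]; ring
  rw [Finset.sum_congr rfl e1, ← Finset.sum_mul, h.sum_phi20_mul_fusionVector hL ha hb hα,
    zero_mul]

/-- The two-row weight with bond variable `α` on the lower edge, along the path `(d, y, c')` on the
upper edge. -/
noncomputable def _root_.DiluteA.halfFused (L : ℕ) (p lam : ℝ) (a b c' d : ℤ) (α : ℕ) (y : ℤ)
    (u : ℂ) : ℂ :=
  ∑ x ∈ heights L, phi20 L p lam a x b α * faceWeight p lam a x y d u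
    * faceWeight p lam x b c' y (u + 2 * lam)

lemma _root_.DiluteA.fusedWeight20_eq (L : ℕ) (p lam : ℝ) (a b c' d : ℤ) (α β : ℕ) (u : ℂ) :
    fusedWeight20 L p lam a b c' d α β u = halfFused L p lam a b c' d α (indMid20 L d c' β) u := rfl

variable {c' d : ℤ}

lemma halfFused_of_not_isPath (hc : c' ∈ heights L) (hd : d ∈ heights L) {α : ℕ} {y : ℤ} (u : ℂ)
    (hyH : y ∈ heights L) (hy : ¬IsPath L d y c') : halfFused L p lam a b c' d α y u = 0 := by
  refine Finset.sum_eq_zero fun x _ ↦ ?_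
  by_contra hne
  obtain ⟨h12, h3⟩ := mul_ne_zero_iff.mp hne
  obtain ⟨h1, h2⟩ := mul_ne_zero_iff.mp h12
  have i2 := adj_of_faceWeight_ne_zero h2
  have i3 := adj_of_faceWeight_ne_zero h3
  refine hy ⟨hd, hyH, hc, ?_, ?_⟩
  · rw [abs_sub_comm]; tauto
  · rw [abs_sub_comm]; tauto

/-- By the Yang–Baxter equation the fusion vector of the lower edge is carried to the upper edge. -/
lemma sum_halfFused_mul_fusionVector (h : IsRegular L p t lam r e k c) (hL : 2 ≤ L)
    (ha : a ∈ heights L) (hb : b ∈ heights L) (hc : c' ∈ heights L) (hd : d ∈ heights L) {α : ℕ}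
    (hα : α ∈ Finset.Icc 1 (fusedAdj20 L a b)) (u : ℂ) :
    ∑ y ∈ heights L, halfFused L p lam a b c' d α y u * fusionVector p lam r e c d c' y = 0 := by
  set K := thetaOdd p lam / thetaOdd p (3 * lam) / ((r d : ℂ) ^ 2 * (r c' : ℂ) ^ 2) with hK
  have K0 : K ≠ 0 := div_ne_zero (div_ne_zero h.one h.three)
    (mul_ne_zero (pow_ne_zero 2 (h.r_ne hd)) (pow_ne_zero 2 (h.r_ne hc)))
  have key : ∀ z ∈ heights L, (∑ y ∈ heights L, halfFused L p lam a b c' d α y u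
      * fusionVector p lam r e c d c' y) * fusionVector p lam r e c d c' z = 0 := by
    intro z hz
    refine mul_left_cancel₀ K0 ?_
    have e1 : K * ((∑ y ∈ heights L, halfFused L p lam a b c' d α y u
        * fusionVector p lam r e c d c' y) * fusionVector p lam r e c d c' z)
        = ∑ x ∈ heights L, phi20 L p lam a x b α * ∑ y ∈ heights L, faceWeight p lam a d y x u
          * faceWeight p lam x y c' b (u + 2 * lam)
          * faceWeight p lam y d z c' (u + 2 * lam - u) := by
      rw [Finset.sum_mul, Finset.mul_sum]
      simp only [halfFused, Finset.sum_mul, Finset.mul_sum]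
      rw [Finset.sum_comm]
      refine Finset.sum_congr rfl fun x hx ↦ Finset.sum_congr rfl fun y hy ↦ ?_
      rw [add_sub_cancel_left, h.faceWeight_two_eq_fusionVector hd hc hy hz,
        h.faceWeight_reflect' ha hd hy hx, h.faceWeight_reflect' hx hy hc hb]
      ring
    rw [e1, mul_zero]
    have e2 : ∀ x ∈ heights L, phi20 L p lam a x b α * ∑ y ∈ heights L, faceWeight p lam a d y x u
          * faceWeight p lam x y c' b (u + 2 * lam)
          * faceWeight p lam y d z c' (u + 2 * lam - u)
        = ∑ g ∈ heights L, phi20 L p lam a x b α * faceWeight p lam x a g b (2 * lam)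
          * (faceWeight p lam a d z g (u + 2 * lam) * faceWeight p lam g z c' b u) := fun x hx ↦ by
      rw [h.faceWeight_yang_baxter ha hd hz hc hb hx, Finset.mul_sum]
      refine Finset.sum_congr rfl fun g _ ↦ ?_
      rw [add_sub_cancel_left]
      ring
    rw [Finset.sum_congr rfl e2, Finset.sum_comm]
    refine Finset.sum_eq_zero fun g hg ↦ ?_
    rw [← Finset.sum_mul, h.sum_phi20_mul_faceWeight hL ha hb hα hg, zero_mul]
  by_cases hz : ∃ z ∈ heights L, fusionVector p lam r e c d c' z ≠ 0
  · obtain ⟨z, hz, hz0⟩ := hz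
    exact (mul_eq_zero.mp (key z hz)).resolve_right hz0
  · push Not at hz
    exact Finset.sum_eq_zero fun y hy ↦ by rw [hz y hy, mul_zero]

end IsRegular

/-! ### Fusion -/

lemma indMid20_spec {L : ℕ} (hL : 2 ≤ L) {a b : ℤ} (ha : a ∈ heights L) (hb : b ∈ heights L)
    {β : ℕ} (hβ : β ∈ Finset.Icc 1 (fusedAdj20 L a b)) :
    IsPath L a (indMid20 L a b β) b ∧ indMid20 L a b β ≠ min a b := by
  rw [Finset.mem_Icc, ← length_indPath20 hL ha hb] at hβ
  have h1 : β - 1 < (indPath20 L a b).length := by omega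
  have h2 : indMid20 L a b β ∈ indPath20 L a b := by
    rw [indMid20, List.getD_eq_getElem _ _ h1]
    exact List.getElem_mem h1
  simp only [indPath20, List.mem_filter, decide_eq_true_eq] at h2
  exact h2.2

lemma isPath_indMid20 {L : ℕ} (hL : 2 ≤ L) {a b : ℤ} (ha : a ∈ heights L) (hb : b ∈ heights L)
    {β : ℕ} (hβ : β ∈ Finset.Icc 1 (fusedAdj20 L a b)) : IsPath L a (indMid20 L a b β) b :=
  (indMid20_spec hL ha hb hβ).1

lemma indMid20_mem {L : ℕ} (hL : 2 ≤ L) {a b : ℤ} (ha : a ∈ heights L) (hb : b ∈ heights L)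
    {β : ℕ} (hβ : β ∈ Finset.Icc 1 (fusedAdj20 L a b)) : indMid20 L a b β ∈ heights L :=
  (isPath_indMid20 hL ha hb hβ).2.1

namespace IsRegular

variable {L : ℕ} {p lam : ℝ} {t : ℂ} {r e : ℤ → ℝ} {k c : ℂ} {a b c' d e' f m n : ℤ}

/-- The fused weights extend to all paths on the upper edge by means of the coefficients, since the
two-row weight annihilates the fusion vector. -/
lemma sum_phi20_mul_fusedWeight20 (h : IsRegular L p t lam r e k c) (hL : 2 ≤ L)
    (ha : a ∈ heights L) (hb : b ∈ heights L) (hc : c' ∈ heights L) (hd : d ∈ heights L) {α : ℕ}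
    (hα : α ∈ Finset.Icc 1 (fusedAdj20 L a b)) (u : ℂ) {y : ℤ} (hy : y ∈ heights L) :
    ∑ β ∈ Finset.Icc 1 (fusedAdj20 L d c'), phi20 L p lam d y c' β
      * fusedWeight20 L p lam a b c' d α β u = halfFused L p lam a b c' d α y u := by
  set F : ℤ → ℂ := fun y ↦ if y ∈ heights L then halfFused L p lam a b c' d α y u else 0 with hF
  have e1 : ∀ y ∈ heights L, F y = halfFused L p lam a b c' d α y u := fun y hy ↦ if_pos hy
  rw [← e1 y hy, ← h.sum_phi20_mul_indMid20 hL hd hc (F := F) ?_ ?_ y]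
  · refine Finset.sum_congr rfl fun β hβ ↦ ?_
    rw [e1 _ (indMid20_mem hL hd hc hβ), fusedWeight20_eq]
  · intro x hx
    simp only [hF]
    split_ifs with hxH
    · exact halfFused_of_not_isPath hc hd u hxH hx
    · rfl
  · rw [← h.sum_halfFused_mul_fusionVector hL ha hb hc hd hα u]
    exact Finset.sum_congr rfl fun x hx ↦ by rw [e1 x hx]

/-- Summation over the bond variables of two fused weights on top of each other amounts to a
summation over the middle heights. -/
lemma sum_fusedWeight20_mul (h : IsRegular L p t lam r e k c) (hL : 2 ≤ L)
    (ha : a ∈ heights L) (hb : b ∈ heights L) (hc : c' ∈ heights L) (hd : d ∈ heights L) {α : ℕ}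
    (hα : α ∈ Finset.Icc 1 (fusedAdj20 L a b)) (γ : ℕ) (u v : ℂ) :
    ∑ β ∈ Finset.Icc 1 (fusedAdj20 L d c'), fusedWeight20 L p lam a b c' d α β u
        * fusedWeight20 L p lam d c' m n β γ v
      = ∑ y ∈ heights L, halfFused L p lam a b c' d α y u
        * (faceWeight p lam d y (indMid20 L n m γ) n v
          * faceWeight p lam y c' m (indMid20 L n m γ) (v + 2 * lam)) := by
  have e1 : ∀ y ∈ heights L, halfFused L p lam a b c' d α y u
        * (faceWeight p lam d y (indMid20 L n m γ) n v
          * faceWeight p lam y c' m (indMid20 L n m γ) (v + 2 * lam))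
      = ∑ β ∈ Finset.Icc 1 (fusedAdj20 L d c'), fusedWeight20 L p lam a b c' d α β u
        * (phi20 L p lam d y c' β * faceWeight p lam d y (indMid20 L n m γ) n v
          * faceWeight p lam y c' m (indMid20 L n m γ) (v + 2 * lam)) := fun y hy ↦ by
    rw [← h.sum_phi20_mul_fusedWeight20 hL ha hb hc hd hα u hy, Finset.sum_mul]
    exact Finset.sum_congr rfl fun β _ ↦ by ring
  rw [Finset.sum_congr rfl e1, Finset.sum_comm]
  exact Finset.sum_congr rfl fun β _ ↦ by rw [fusedWeight20.eq_def L p lam d c', Finset.mul_sum]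

/-- The Yang–Baxter equation of the fused weights, by two moves with the elementary one. -/
theorem fusedWeight20_yang_baxter (h : IsRegular L p t lam r e k c) (hL : 2 ≤ L)
    (ha : a ∈ heights L) (hb : b ∈ heights L) (hc : c' ∈ heights L) (hd : d ∈ heights L)
    (he : e' ∈ heights L) (hf : f ∈ heights L) {α γ : ℕ}
    (hα : α ∈ Finset.Icc 1 (fusedAdj20 L a b)) (hγ : γ ∈ Finset.Icc 1 (fusedAdj20 L e' d))
    (u v : ℂ) :
    ∑ g ∈ heights L, ∑ β ∈ Finset.Icc 1 (fusedAdj20 L f g),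
        fusedWeight20 L p lam a b g f α β u * fusedWeight20 L p lam f g d e' β γ v
          * faceWeight p lam g b c' d (v - u)
      = ∑ g ∈ heights L, ∑ β ∈ Finset.Icc 1 (fusedAdj20 L g c'),
        faceWeight p lam f a g e' (v - u) * fusedWeight20 L p lam a b c' g α β v
          * fusedWeight20 L p lam g c' d e' β γ u := by
  have hz := indMid20_mem hL he hd hγ
  set z := indMid20 L e' d γ with hz_def
  have left : ∑ g ∈ heights L, ∑ β ∈ Finset.Icc 1 (fusedAdj20 L f g),
        fusedWeight20 L p lam a b g f α β u * fusedWeight20 L p lam f g d e' β γ v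
          * faceWeight p lam g b c' d (v - u)
      = ∑ x ∈ heights L, ∑ y ∈ heights L, phi20 L p lam a x b α
        * (faceWeight p lam a x y f u * faceWeight p lam f y z e' v)
        * ∑ g ∈ heights L, faceWeight p lam x b g y (u + 2 * lam)
          * faceWeight p lam y g d z (v + 2 * lam)
          * faceWeight p lam g b c' d (v + 2 * lam - (u + 2 * lam)) := by
    rw [add_sub_add_right_eq_sub]
    calc _ = ∑ g ∈ heights L, ∑ y ∈ heights L, ∑ x ∈ heights L, phi20 L p lam a x b α
        * (faceWeight p lam a x y f u * faceWeight p lam f y z e' v)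
        * (faceWeight p lam x b g y (u + 2 * lam)
          * faceWeight p lam y g d z (v + 2 * lam) * faceWeight p lam g b c' d (v - u)) := by
          refine Finset.sum_congr rfl fun g hg ↦ ?_
          rw [← Finset.sum_mul, h.sum_fusedWeight20_mul hL ha hb hg hf hα, ← hz_def,
            Finset.sum_mul]
          refine Finset.sum_congr rfl fun y _ ↦ ?_
          rw [halfFused, Finset.sum_mul, Finset.sum_mul]
          exact Finset.sum_congr rfl fun x _ ↦ by ring
      _ = _ := by
          rw [Finset.sum_comm]
          simp only [Finset.mul_sum]
          rw [Finset.sum_comm (s := heights L) (t := heights L)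
            (f := fun x y ↦ ∑ g ∈ heights L, phi20 L p lam a x b α
        * (faceWeight p lam a x y f u * faceWeight p lam f y z e' v)
        * (faceWeight p lam x b g y (u + 2 * lam)
          * faceWeight p lam y g d z (v + 2 * lam) * faceWeight p lam g b c' d (v - u)))]
          exact Finset.sum_congr rfl fun y _ ↦ Finset.sum_comm
  have right : ∑ g ∈ heights L, ∑ β ∈ Finset.Icc 1 (fusedAdj20 L g c'),
        faceWeight p lam f a g e' (v - u) * fusedWeight20 L p lam a b c' g α β v
          * fusedWeight20 L p lam g c' d e' β γ u
      = ∑ x ∈ heights L, ∑ g ∈ heights L, phi20 L p lam a x b α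
        * (faceWeight p lam x b c' g (v + 2 * lam) * faceWeight p lam g c' d z (u + 2 * lam))
        * ∑ q ∈ heights L, faceWeight p lam f a q e' (v - u) * faceWeight p lam a x g q v
          * faceWeight p lam q g z e' u := by
    calc _ = ∑ q ∈ heights L, ∑ g ∈ heights L, ∑ x ∈ heights L, phi20 L p lam a x b α
        * (faceWeight p lam x b c' g (v + 2 * lam) * faceWeight p lam g c' d z (u + 2 * lam))
        * (faceWeight p lam f a q e' (v - u) * faceWeight p lam a x g q v
          * faceWeight p lam q g z e' u) := by
          refine Finset.sum_congr rfl fun q hq ↦ ?_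
          simp only [mul_assoc (faceWeight p lam f a q e' (v - u))]
          rw [← Finset.mul_sum, h.sum_fusedWeight20_mul hL ha hb hc hq hα, ← hz_def,
            Finset.mul_sum]
          refine Finset.sum_congr rfl fun y _ ↦ ?_
          rw [halfFused, Finset.sum_mul, Finset.mul_sum]
          exact Finset.sum_congr rfl fun x _ ↦ by ring
      _ = _ := by
          rw [Finset.sum_comm]
          simp only [Finset.mul_sum]
          rw [Finset.sum_comm (s := heights L) (t := heights L)
            (f := fun x g ↦ ∑ q ∈ heights L, phi20 L p lam a x b α
        * (faceWeight p lam x b c' g (v + 2 * lam) * faceWeight p lam g c' d z (u + 2 * lam))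
        * (faceWeight p lam f a q e' (v - u) * faceWeight p lam a x g q v
          * faceWeight p lam q g z e' u))]
          exact Finset.sum_congr rfl fun y _ ↦ Finset.sum_comm
  rw [left, right]
  refine Finset.sum_congr rfl fun x hx ↦ ?_
  calc _ = ∑ y ∈ heights L, phi20 L p lam a x b α
        * (faceWeight p lam a x y f u * faceWeight p lam f y z e' v)
        * ∑ g ∈ heights L, faceWeight p lam y x g z (v - u)
          * faceWeight p lam x b c' g (v + 2 * lam)
          * faceWeight p lam g c' d z (u + 2 * lam) := by
        refine Finset.sum_congr rfl fun y hy ↦ ?_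
        rw [h.faceWeight_yang_baxter hx hb hc hd hz hy, add_sub_add_right_eq_sub]
    _ = ∑ g ∈ heights L, phi20 L p lam a x b α
        * (faceWeight p lam x b c' g (v + 2 * lam) * faceWeight p lam g c' d z (u + 2 * lam))
        * ∑ y ∈ heights L, faceWeight p lam a x y f u * faceWeight p lam f y z e' v
          * faceWeight p lam y x g z (v - u) := by
        simp only [Finset.mul_sum]
        rw [Finset.sum_comm]
        exact Finset.sum_congr rfl fun g _ ↦ Finset.sum_congr rfl fun y _ ↦ by ring
    _ = _ := by
        refine Finset.sum_congr rfl fun g hg ↦ ?_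
        rw [h.faceWeight_yang_baxter ha hx hg hz he hf]

/-- At `u = 0` the lower weight is a Kronecker symbol and the upper one has rank one. -/
lemma fusedWeight20_zero (h : IsRegular L p t lam r e k c) (hL : 2 ≤ L)
    (ha : a ∈ heights L) (hb : b ∈ heights L) (hc : c' ∈ heights L) (hd : d ∈ heights L)
    {α β : ℕ} (hα : α ∈ Finset.Icc 1 (fusedAdj20 L a b))
    (hβ : β ∈ Finset.Icc 1 (fusedAdj20 L d c')) :
    fusedWeight20 L p lam a b c' d α β 0 = 0 := by
  have hy := indMid20_mem hL hd hc hβ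
  rw [fusedWeight20_eq]
  set y := indMid20 L d c' β
  have e1 : ∀ x ∈ heights L, phi20 L p lam a x b α * faceWeight p lam a x y d 0
      * faceWeight p lam x b c' y (0 + 2 * lam)
      = (if a = y ∧ |d - a| ≤ 1 then 1 else 0)
        * (phi20 L p lam a x b α * faceWeight p lam x a c' b (2 * lam)) := fun x hx ↦ by
    by_cases hp : IsPath L a x b
    swap
    · rw [phi20_of_not_isPath hp]; ring
    by_cases hda : |d - a| ≤ 1
    · rw [h.faceWeight_zero ha hx hy hd hp.2.2.2.1 hda, zero_add]
      by_cases hay : a = y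
      · rw [if_pos hay, if_pos ⟨hay, hda⟩, ← hay, h.faceWeight_reflect' hx hb hc ha]; ring
      · rw [if_neg hay, if_neg (by tauto)]; ring
    · rw [faceWeight_eq_zero (a := a) (d := d) (by tauto), if_neg (by tauto)]; ring
  rw [halfFused, Finset.sum_congr rfl e1, ← Finset.mul_sum,
    h.sum_phi20_mul_faceWeight hL ha hb hα hc, mul_zero]

/-- At `u = λ` the upper weight has spectral parameter `3λ`, hence is a Kronecker symbol up to
crossing factors, and the lower one is crossed to `2λ`. -/
lemma fusedWeight20_lam (h : IsRegular L p t lam r e k c) (hL : 2 ≤ L)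
    (ha : a ∈ heights L) (hb : b ∈ heights L) (hc : c' ∈ heights L) (hd : d ∈ heights L)
    {α β : ℕ} (hα : α ∈ Finset.Icc 1 (fusedAdj20 L a b))
    (hβ : β ∈ Finset.Icc 1 (fusedAdj20 L d c')) :
    fusedWeight20 L p lam a b c' d α β lam = 0 := by
  have hy := indMid20_mem hL hd hc hβ
  have a0 := h.r_ne ha
  have b0 := h.r_ne hb
  have c0 := h.r_ne hc
  have d0 := h.r_ne hd
  rw [fusedWeight20_eq]
  set y := indMid20 L d c' β
  have e1 : ∀ x ∈ heights L, phi20 L p lam a x b α * faceWeight p lam a x y d lam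
      * faceWeight p lam x b c' y (lam + 2 * lam)
      = (if b = y ∧ |b - c'| ≤ 1 then (r a : ℂ) ^ 2 * (r c' : ℂ) ^ 2 / ((r b : ℂ) ^ 2 * (r d) ^ 2)
          else 0) * (phi20 L p lam a x b α * faceWeight p lam x a d b (2 * lam)) := fun x hx ↦ by
    have x0 := h.r_ne hx
    by_cases hp : IsPath L a x b
    swap
    · rw [phi20_of_not_isPath hp]; ring
    by_cases hbc : |b - c'| ≤ 1
    · rw [show (lam : ℂ) + 2 * lam = 3 * lam by ring,
        h.faceWeight_three hx hb hc hy hp.2.2.2.2 hbc]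
      by_cases hay : b = y
      · rw [if_pos hay, if_pos ⟨hay, hbc⟩, ← hay]
        have X := h.faceWeight_crossing ha hx hb hd lam
        rw [show 3 * (lam : ℂ) - lam = 2 * lam by ring, h.faceWeight_reflect hd ha hx hb] at X
        generalize faceWeight p lam a x b d lam = x1 at *
        generalize faceWeight p lam x a d b (2 * lam) = x2 at *
        field_simp
        linear_combination phi20 L p lam a x b α * X
      · rw [if_neg hay, if_neg (by tauto)]; ring
    · rw [faceWeight_eq_zero (a := x) (b := b) (by tauto), if_neg (by tauto)]; ring
  rw [halfFused, Finset.sum_congr rfl e1, ← Finset.mul_sum,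
    h.sum_phi20_mul_faceWeight hL ha hb hα hd, mul_zero]

end IsRegular

/-! ### The crossing parameter of the model -/

lemma thetaOdd_add_int_mul_pi (p : ℝ) (u : ℂ) (n : ℤ) :
    thetaOdd p (u + n * Real.pi) = (-1) ^ n * thetaOdd p u := by
  have ha : Function.Antiperiodic (thetaOdd p) (Real.pi : ℂ) := thetaOdd_add_pi p
  rw [ha.add_int_mul_eq, Int.cast_negOnePow]

lemma thetaOdd_ne_zero_of_between {p : ℝ} (hp : |p| < 1) {x : ℝ} (n : ℤ) (h1 : n * Real.pi < x)
    (h2 : x < (n + 1) * Real.pi) : thetaOdd p x ≠ 0 := by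
  refine thetaOdd_ofReal_ne_zero hp fun m hm ↦ ?_
  have hpi := Real.pi_pos
  rw [hm] at h1 h2
  have h3 := lt_of_mul_lt_mul_right h1 hpi.le
  have h4 := lt_of_mul_lt_mul_right h2 hpi.le
  norm_cast at h3 h4
  omega

/-- The two values of the crossing parameter, written as `4λ = π - σπ/(L+1)` with `σ = ±1`. -/
structure IsCrossingParameter (L : ℕ) (lam σ : ℝ) : Prop where
  three_le : 3 ≤ L
  sign : σ = 1 ∨ σ = -1
  eq : 4 * lam = Real.pi - σ * (Real.pi / (L + 1))

lemma exists_isCrossingParameter {L : ℕ} (hL : 3 ≤ L) {lam : ℝ}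
    (hlam : lam = Real.pi / 4 * ((L : ℝ) / ((L : ℝ) + 1)) ∨
      lam = Real.pi / 4 * (((L : ℝ) + 2) / ((L : ℝ) + 1))) : ∃ σ, IsCrossingParameter L lam σ := by
  have h1 : (L : ℝ) + 1 ≠ 0 := by positivity
  rcases hlam with rfl | rfl
  · exact ⟨1, hL, Or.inl rfl, by field_simp; ring⟩
  · exact ⟨-1, hL, Or.inr rfl, by field_simp; ring⟩

namespace IsCrossingParameter

variable {L : ℕ} {p lam σ : ℝ}

lemma angle_pos (L : ℕ) : 0 < Real.pi / (L + 1) :=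
  div_pos Real.pi_pos (by positivity)

lemma angle_mul (L : ℕ) : Real.pi / (L + 1) * (L + 1) = Real.pi :=
  div_mul_cancel₀ _ (by positivity)

lemma thetaOdd_height (h : IsCrossingParameter L lam σ) (p : ℝ) (a : ℤ) :
    thetaOdd p (4 * a * lam)
      = (-1) ^ a * (-σ * thetaOdd p ((a * (Real.pi / (L + 1)) : ℝ) : ℂ)) := by
  have h1 : (4 : ℂ) * lam = Real.pi - σ * (Real.pi / (L + 1) : ℝ) := by
    have := congrArg (fun x : ℝ ↦ (x : ℂ)) h.eq
    push_cast at this ⊢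
    exact this
  rw [show (4 : ℂ) * a * lam = -(σ * ((a * (Real.pi / (L + 1)) : ℝ) : ℂ)) + a * Real.pi by
    push_cast at h1 ⊢; linear_combination (a : ℂ) * h1, thetaOdd_add_int_mul_pi, thetaOdd_neg]
  rcases h.sign with rfl | rfl
  · simp
  · simp [thetaOdd_neg]

lemma angle_mem {a : ℤ} (ha : a ∈ heights L) :
    (a * (Real.pi / (L + 1)) : ℝ) ∈ Set.Ioo 0 Real.pi := by
  rw [mem_heights] at ha
  have h1 := angle_pos L
  have h2 := angle_mul L
  have ha1 : (1 : ℝ) ≤ a := by exact_mod_cast ha.1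
  have ha2 : (a : ℝ) ≤ L := by exact_mod_cast ha.2
  constructor
  · positivity
  · nlinarith

lemma height_ne (h : IsCrossingParameter L lam σ) (hp : |p| < 1) {a : ℤ} (ha : a ∈ heights L) :
    thetaOdd p (4 * a * lam) ≠ 0 := by
  obtain ⟨h1, h2⟩ := angle_mem ha
  rw [h.thetaOdd_height]
  refine mul_ne_zero (zpow_ne_zero _ (by norm_num)) (mul_ne_zero ?_
    (thetaOdd_ne_zero_of_between hp 0 (by simpa using h1) (by simpa using h2)))
  rcases h.sign with rfl | rfl <;> simp

lemma angle_le (h : IsCrossingParameter L lam σ) : 4 * (Real.pi / (L + 1)) ≤ Real.pi := by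
  have h1 := angle_pos L
  have h2 := angle_mul L
  have h3 : (3 : ℝ) ≤ L := by exact_mod_cast h.three_le
  nlinarith

lemma mul_ne (hp : |p| < 1) (lam m : ℝ) (n : ℤ)
    (h1 : n * Real.pi < m * lam) (h2 : m * lam < (n + 1) * Real.pi) :
    thetaOdd p (m * lam) ≠ 0 := by
  have := thetaOdd_ne_zero_of_between hp n h1 h2
  push_cast at this
  exact this

lemma one_ne (h : IsCrossingParameter L lam σ) (hp : |p| < 1) : thetaOdd p lam ≠ 0 := by
  have h1 := angle_pos L
  have h2 := h.angle_le
  have h3 := h.eq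
  have := mul_ne hp lam 1 0 (by rcases h.sign with rfl | rfl <;> push_cast <;> linarith)
    (by rcases h.sign with rfl | rfl <;> push_cast <;> linarith)
  simpa using this

lemma two_ne (h : IsCrossingParameter L lam σ) (hp : |p| < 1) : thetaOdd p (2 * lam) ≠ 0 := by
  have h1 := angle_pos L
  have h2 := h.angle_le
  have h3 := h.eq
  have := mul_ne hp lam 2 0 (by rcases h.sign with rfl | rfl <;> push_cast <;> linarith)
    (by rcases h.sign with rfl | rfl <;> push_cast <;> linarith)
  simpa using this

lemma three_ne (h : IsCrossingParameter L lam σ) (hp : |p| < 1) : thetaOdd p (3 * lam) ≠ 0 := by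
  have h1 := angle_pos L
  have h2 := h.angle_le
  have h3 := h.eq
  have := mul_ne hp lam 3 0 (by rcases h.sign with rfl | rfl <;> push_cast <;> linarith)
    (by rcases h.sign with rfl | rfl <;> push_cast <;> linarith)
  simpa using this

lemma four_ne (h : IsCrossingParameter L lam σ) (hp : |p| < 1) : thetaOdd p (4 * lam) ≠ 0 := by
  have hL := h.three_le
  have := h.height_ne hp (a := 1) (mem_heights.mpr (by omega))
  simpa using this

lemma six_ne (h : IsCrossingParameter L lam σ) (hp : |p| < 1) : thetaOdd p (6 * lam) ≠ 0 := by
  have h1 := angle_pos L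
  have h2 := h.angle_le
  have h3 := h.eq
  have := mul_ne hp lam 6 1 (by rcases h.sign with rfl | rfl <;> push_cast <;> linarith)
    (by rcases h.sign with rfl | rfl <;> push_cast <;> linarith)
  simpa using this

/-- The ratios `S_a / S_b` are positive, since `ϑ₁(4aλ)` agrees with `ϑ₁(aπ/(L+1))` up to a sign
which is the same for `(-1)^a` times it at all heights. -/
lemma exists_isGauge (h : IsCrossingParameter L lam σ) (hp : |p| < 1) :
    ∃ r e k c, IsGauge L p lam r e k c := by
  have hL := h.three_le
  have one_mem : (1 : ℤ) ∈ heights L := mem_heights.mpr (by omega)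
  set A : ℤ → ℝ := fun a ↦ (thetaOdd p ((a * (Real.pi / (L + 1)) : ℝ) : ℂ)).re with hA
  set B : ℝ → ℝ := fun x ↦ (theta4 p x).re with hB
  set Q : ℤ → ℝ := fun a ↦ A a / A 1 / (B (2 * a * lam) / B 0) with hQ
  have A1 : A 1 ≠ 0 := fun h0 ↦ by
    have := thetaOdd_re_mul_pos hp (angle_mem one_mem) (angle_mem one_mem)
    rw [show (thetaOdd p ((((1 : ℤ) : ℝ) * (Real.pi / (L + 1)) : ℝ) : ℂ)).re = A 1 from rfl, h0]
      at this
    simp at this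
  have Bpos : ∀ x, 0 < B x / B 0 := fun x ↦ by
    have h1 := theta4_re_mul_pos hp x 0
    have h2 : 0 < B x * B 0 := h1
    rcases mul_pos_iff.mp h2 with ⟨i, j⟩ | ⟨i, j⟩
    · exact div_pos i j
    · exact div_pos_of_neg_of_neg i j
  have Bne : ∀ x, B x ≠ 0 := fun x h0 ↦ by
    have := Bpos x
    rw [h0, zero_div] at this
    exact lt_irrefl _ this
  have Qpos : ∀ a ∈ heights L, 0 < Q a := fun a ha ↦ by
    have h2 : 0 < A a * A 1 := thetaOdd_re_mul_pos hp (angle_mem ha) (angle_mem one_mem)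
    refine div_pos ?_ (Bpos _)
    rcases mul_pos_iff.mp h2 with ⟨i, j⟩ | ⟨i, j⟩
    · exact div_pos i j
    · exact div_pos_of_neg_of_neg i j
  have Q0 : Q 0 = 0 := by simp [hQ, hA, thetaOdd_zero]
  have Q1 : Q (L + 1) = 0 := by
    have : A (L + 1) = 0 := by
      have e : (((L + 1 : ℤ) : ℝ) * (Real.pi / (L + 1)) : ℝ) = Real.pi := by
        have := angle_mul L
        push_cast
        linarith
      have e2 := thetaOdd_add_pi p 0
      rw [zero_add, thetaOdd_zero, neg_zero] at e2
      simp only [hA, e, e2, zero_re]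
    simp [hQ, this]
  have Qnn : ∀ a : ℤ, 0 ≤ a → a ≤ L + 1 → 0 ≤ Q a := fun a h0 h1 ↦ by
    by_cases ha0 : a = 0
    · rw [ha0, Q0]
    · by_cases ha1 : a = L + 1
      · rw [ha1, Q1]
      · exact (Qpos a (mem_heights.mpr (by omega))).le
  refine ⟨fun a ↦ √√(Q a), fun a ↦ √(B (2 * a * lam + lam) / B 0),
    -σ * theta1Prefactor p * (A 1 / B 0), B 0, ?_, ?_, ?_, ?_, ?_, ?_, ?_, ?_⟩
  · exact fun a ha ↦ Real.sqrt_pos.mpr (Real.sqrt_pos.mpr (Qpos a ha))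
  · simp [Q0]
  · simp [Q1]
  · exact fun a ↦ Real.sqrt_pos.mpr (Bpos _)
  · intro a h0 h1
    have e1 : ((√√(Q a) : ℝ) : ℂ) ^ 4 = Q a := by
      rw [← ofReal_pow, show √√(Q a) ^ 4 = (√√(Q a) ^ 2) ^ 2 by ring,
        Real.sq_sqrt (Real.sqrt_nonneg _), Real.sq_sqrt (Qnn a h0 h1)]
    have e2 : theta4 p (2 * a * lam) = B (2 * a * lam) := by
      rw [← theta4_ofReal]; push_cast; rfl
    have e3 : ((-1 : ℂ) ^ a) * (-1) ^ a = 1 := by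
      rw [← mul_zpow]; norm_num
    have n1 : (A 1 : ℂ) ≠ 0 := ofReal_ne_zero.mpr A1
    have n2 : (B 0 : ℂ) ≠ 0 := ofReal_ne_zero.mpr (Bne _)
    have n3 : (B (2 * a * lam) : ℂ) ≠ 0 := ofReal_ne_zero.mpr (Bne _)
    rw [e1, crossing, theta1_eq, h.thetaOdd_height, e2, thetaOdd_ofReal, hQ]
    push_cast
    rw [show (thetaOdd p (a * (Real.pi / (L + 1)))).re = A a by
      simp only [hA]; push_cast; rfl]
    field_simp
    linear_combination (-theta1Prefactor p * σ * A a : ℂ) * e3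
  · refine mul_ne_zero (mul_ne_zero ?_ (theta1Prefactor_ne_zero p))
      (div_ne_zero (ofReal_ne_zero.mpr A1) (ofReal_ne_zero.mpr (Bne _)))
    rcases h.sign with rfl | rfl <;> simp
  · intro a
    have e2 : theta4 p (2 * a * lam + lam) = B (2 * a * lam + lam) := by
      rw [← theta4_ofReal]; push_cast; rfl
    have n2 : (B 0 : ℂ) ≠ 0 := ofReal_ne_zero.mpr (Bne _)
    rw [e2, ← ofReal_pow, Real.sq_sqrt (Bpos _).le]
    push_cast
    field_simp
  · exact ofReal_ne_zero.mpr (Bne _)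

lemma exists_isRegular (h : IsCrossingParameter L lam σ) (hp : |p| < 1) (hp0 : p ≠ 0) :
    ∃ t r e k c, IsRegular L p t lam r e k c := by
  obtain ⟨r, e, k, c, hg⟩ := h.exists_isGauge hp
  obtain ⟨t, ht⟩ := exists_isHalfPeriod hp hp0
  exact ⟨t, r, e, k, c, hg, ht, h.one_ne hp, h.two_ne hp, h.three_ne hp, h.four_ne hp, h.six_ne hp,
    fun a ha ↦ h.height_ne hp ha⟩

end IsCrossingParameter

end DiluteA

namespace DiluteA

open Complex Filter Topology

/-! ### Continuity of the weights at nome zero -/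

lemma csqrt_continuousAt {f : ℝ → ℂ} (hf : ContinuousAt f 0) (h0 : f 0 ∈ slitPlane) :
    ContinuousAt (fun p ↦ csqrt (f p)) 0 :=
  hf.cpow continuousAt_const h0

lemma theta4_nome_zero_ne (u : ℂ) : theta4 0 u ≠ 0 := by
  rw [theta4_nome_zero]; exact one_ne_zero

lemma theta4_div_continuousAt_nome (u v : ℂ) :
    ContinuousAt (fun p : ℝ ↦ theta4 p u / theta4 p v) 0 :=
  (theta4_continuousAt_nome u).div (theta4_continuousAt_nome v) (theta4_nome_zero_ne v)

lemma thetaOdd_div_continuousAt_nome (u : ℂ) {v : ℂ} (hv : thetaOdd 0 v ≠ 0) :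
    ContinuousAt (fun p : ℝ ↦ thetaOdd p u / thetaOdd p v) 0 :=
  (thetaOdd_continuousAt_nome u).div (thetaOdd_continuousAt_nome v) hv

lemma thetaOdd_mul_div_continuousAt_nome (x y : ℂ) {z w : ℂ} (hz : thetaOdd 0 z ≠ 0)
    (hw : thetaOdd 0 w ≠ 0) : ContinuousAt
      (fun p : ℝ ↦ thetaOdd p x * thetaOdd p y / (thetaOdd p z * thetaOdd p w)) 0 :=
  ((thetaOdd_continuousAt_nome x).mul (thetaOdd_continuousAt_nome y)).div
    ((thetaOdd_continuousAt_nome z).mul (thetaOdd_continuousAt_nome w)) (mul_ne_zero hz hw)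

lemma eventually_nome : ∀ᶠ p : ℝ in 𝓝 0, |p| < 1 := by
  have := Metric.ball_mem_nhds (0 : ℝ) one_pos
  filter_upwards [this] with p hp
  simpa using hp

lemma IsGauge.csqrt_siteRatio {L : ℕ} {p lam : ℝ} {r e : ℤ → ℝ} {k c : ℂ}
    (h : IsGauge L p lam r e k c) {a s : ℤ} (ha : a ∈ heights L) (hs : s = 1 ∨ s = -1) :
    csqrt (siteRatio p lam (s * 2 * a * lam)) = ((r (a + s) : ℂ) / r a) ^ 2 := by
  obtain ⟨h0, h1⟩ := step_mem ha hs
  rw [← crossing_div p lam a hs, h.csqrt_crossing ha h0 h1]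

namespace IsCrossingParameter

variable {L : ℕ} {lam σ : ℝ} {a b c d s : ℤ}

lemma zero_nome : |(0 : ℝ)| < 1 := by simp

lemma siteRatio_continuousAt_nome (h : IsCrossingParameter L lam σ) (ha : a ∈ heights L)
    (hs : s = 1 ∨ s = -1) :
    ContinuousAt (fun p : ℝ ↦ siteRatio p lam (s * 2 * a * lam)) 0 := by
  have h1 : thetaOdd 0 (2 * (s * 2 * a * lam)) ≠ 0 := by
    have h2 := h.height_ne zero_nome ha
    rcases hs with rfl | rfl
    · convert h2 using 2; push_cast; ring
    · rw [show 2 * (((-1 : ℤ) : ℂ) * 2 * a * lam) = -(4 * a * lam) by push_cast; ring]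
      exact thetaOdd_ne_zero_neg h2
  exact ((thetaOdd_continuousAt_nome _).mul (theta4_continuousAt_nome _)).neg.div
    ((theta4_continuousAt_nome _).mul (thetaOdd_continuousAt_nome _))
    (mul_ne_zero (theta4_nome_zero_ne _) h1)

lemma csqrt_siteRatio_continuousAt_nome (h : IsCrossingParameter L lam σ) (ha : a ∈ heights L)
    (hs : s = 1 ∨ s = -1) (hb : a + s ∈ heights L) :
    ContinuousAt (fun p : ℝ ↦ csqrt (siteRatio p lam (s * 2 * a * lam))) 0 := by
  refine csqrt_continuousAt (h.siteRatio_continuousAt_nome ha hs) ?_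
  obtain ⟨r, e, k, c, hg⟩ := h.exists_isGauge zero_nome
  have h1 := hg.r_pos _ ha
  have h2 := hg.r_pos _ hb
  rw [hg.siteRatio_eq ha hs, ← ofReal_div, ← ofReal_pow]
  exact ofReal_mem_slitPlane.mpr (by positivity)

lemma siteSide_continuousAt_nome (h : IsCrossingParameter L lam σ) (w u : ℂ) :
    ContinuousAt (fun p : ℝ ↦ siteSide p lam w u) 0 :=
  ((thetaOdd_continuousAt_nome _).mul (theta4_continuousAt_nome _)).div
    ((thetaOdd_continuousAt_nome _).mul (theta4_continuousAt_nome _))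
    (mul_ne_zero (h.three_ne zero_nome) (theta4_nome_zero_ne _))

lemma siteTip_continuousAt_nome (h : IsCrossingParameter L lam σ) (w u : ℂ) :
    ContinuousAt (fun p : ℝ ↦ thetaOdd p u * siteTip p lam w u) 0 :=
  (thetaOdd_continuousAt_nome _).mul ((theta4_continuousAt_nome _).div
    ((thetaOdd_continuousAt_nome _).mul (theta4_continuousAt_nome _))
    (mul_ne_zero (h.three_ne zero_nome) (theta4_nome_zero_ne _)))

lemma siteFlat_continuousAt_nome (h : IsCrossingParameter L lam σ) (ha : a ∈ heights L) (u : ℂ) :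
    ContinuousAt (fun p : ℝ ↦ siteFlat p lam (2 * a * lam) u) 0 := by
  have h1 := h.siteRatio_continuousAt_nome ha (Or.inl rfl)
  have h2 := h.siteRatio_continuousAt_nome ha (Or.inr rfl)
  push_cast at h1 h2
  rw [one_mul] at h1
  rw [show -1 * 2 * (a : ℂ) * lam = -(2 * a * lam) by ring] at h2
  have h3 := h.three_ne zero_nome
  have h6 := h.six_ne zero_nome
  exact (thetaOdd_mul_div_continuousAt_nome _ _ h6 h3).sub
    (((h1.mul (theta4_div_continuousAt_nome _ _)).add
      (h2.mul (theta4_div_continuousAt_nome _ _))).mul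
        (thetaOdd_mul_div_continuousAt_nome _ _ h6 h3))

/-- The case distinction in the weight is the same for all nomes close to zero. -/
lemma siteAlt_continuousAt_nome (h : IsCrossingParameter L lam σ) (ha : a ∈ heights L)
    (hs : s = 1 ∨ s = -1) (u : ℂ) :
    ContinuousAt (fun p : ℝ ↦ siteAlt p lam (s * 2 * a * lam) u) 0 := by
  have h1 := h.siteRatio_continuousAt_nome ha hs
  have h2 := h.siteRatio_continuousAt_nome (s := -s) ha (by omega)
  rw [show ((-s : ℤ) : ℂ) * 2 * a * lam = -(s * 2 * a * lam) by push_cast; ring] at h2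
  have h3 := h.three_ne zero_nome
  set w : ℂ := s * 2 * a * lam with hw
  by_cases h0 : thetaOdd 0 (2 * w + 2 * lam) = 0
  · obtain ⟨n, hn⟩ : ∃ n : ℤ, 2 * w + 2 * lam = n * Real.pi := by
      rw [thetaOdd_nome_zero] at h0
      exact Complex.sin_eq_zero_iff.mp h0
    have h4 : ∀ p, thetaOdd p (2 * w + 2 * lam) = 0 := fun p ↦ by
      rw [hn, ← zero_add ((n : ℂ) * _), thetaOdd_add_int_mul_pi, thetaOdd_zero, mul_zero]
    have h5 : thetaOdd 0 (2 * w - 4 * lam) ≠ 0 := by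
      rw [show 2 * w - 4 * lam = -(6 * lam) + n * Real.pi by rw [← hn]; ring,
        thetaOdd_add_int_mul_pi]
      exact mul_ne_zero (zpow_ne_zero _ (by norm_num))
        (thetaOdd_ne_zero_neg (h.six_ne zero_nome))
    simp only [siteAlt, h4, ne_eq, not_true_eq_false, if_false]
    exact (thetaOdd_mul_div_continuousAt_nome _ _ h3 h5).add
      (((h2.mul (thetaOdd_div_continuousAt_nome _ (h.two_ne zero_nome))).sub
        (theta4_div_continuousAt_nome _ _)).mul (thetaOdd_mul_div_continuousAt_nome _ _ h3 h5))
  · have h4 : ContinuousAt (fun p : ℝ ↦ thetaOdd p (3 * lam - u) * thetaOdd p (2 * w + 2 * lam + u)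
        / (thetaOdd p (3 * lam) * thetaOdd p (2 * w + 2 * lam))
        + siteRatio p lam w * (thetaOdd p u * thetaOdd p (2 * w - lam + u)
          / (thetaOdd p (3 * lam) * thetaOdd p (2 * w + 2 * lam)))) 0 :=
      (thetaOdd_mul_div_continuousAt_nome _ _ h3 h0).add
        (h1.mul (thetaOdd_mul_div_continuousAt_nome _ _ h3 h0))
    refine h4.congr ?_
    filter_upwards [(thetaOdd_continuousAt_nome (2 * w + 2 * lam)).eventually_ne h0] with p hp
    rw [siteAlt, if_pos hp]

lemma stepRoot_continuousAt_nome (m : ℤ) :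
    ContinuousAt (fun p : ℝ ↦ csqrt (theta4 p (2 * m * lam + 3 * lam) * theta4 p (2 * m * lam - lam)
      / theta4 p (2 * m * lam + lam) ^ 2)) 0 := by
  refine csqrt_continuousAt (((theta4_continuousAt_nome _).mul (theta4_continuousAt_nome _)).div
    ((theta4_continuousAt_nome _).pow 2) (pow_ne_zero 2 (theta4_nome_zero_ne _))) ?_
  simp [theta4_nome_zero]

lemma faceWeight_continuousAt_nome (h : IsCrossingParameter L lam σ) (ha : a ∈ heights L)
    (hb : b ∈ heights L) (hc : c ∈ heights L) (hd : d ∈ heights L) (u : ℂ) :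
    ContinuousAt (fun p : ℝ ↦ faceWeight p lam a b c d u) 0 := by
  have two := h.two_ne zero_nome
  have three := h.three_ne zero_nome
  have step : ∀ m : ℤ, ContinuousAt (fun p : ℝ ↦ csqrt (theta4 p (2 * m * lam + 3 * lam)
      * theta4 p (2 * m * lam - lam) / theta4 p (2 * m * lam + lam) ^ 2) * siteStep p lam u) 0 :=
    fun m ↦ (stepRoot_continuousAt_nome m).mul (thetaOdd_mul_div_continuousAt_nome _ _ two three)
  by_cases hadj : |a - b| ≤ 1 ∧ |b - c| ≤ 1 ∧ |c - d| ≤ 1 ∧ |d - a| ≤ 1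
  swap
  · simp only [faceWeight_eq_zero hadj]
    exact continuousAt_const
  obtain ⟨hab, hbc, hcd, hda⟩ := hadj
  refine face_cases (H := (· ∈ heights L))
    (Q := fun a b c d ↦ ContinuousAt (fun p : ℝ ↦ faceWeight p lam a b c d u) 0)
    ?_ ?_ ?_ ?_ ?_ ?_ ?_ ?_ ?_ ?_ ha hb hc hd hab hbc hcd hda
  · intro a ha
    simp only [faceWeight_flat]
    exact h.siteFlat_continuousAt_nome ha u
  · intro a s hs ha _
    simp only [faceWeight_side _ _ _ hs]
    exact h.siteSide_continuousAt_nome _ u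
  · intro a s hs ha _
    simp only [faceWeight_side' _ _ _ hs]
    exact h.siteSide_continuousAt_nome _ u
  · intro a s hs ha hb
    refine ((h.csqrt_siteRatio_continuousAt_nome ha hs hb).mul
      (h.siteTip_continuousAt_nome (s * 2 * a * lam) u)).congr ?_
    filter_upwards [eventually_nome] with p hp
    obtain ⟨r, e, k, c, hg⟩ := h.exists_isGauge hp
    rw [Pi.mul_apply, hg.csqrt_siteRatio ha hs, hg.faceWeight_tip ha hs]
  · intro a s hs ha hb
    refine ((h.csqrt_siteRatio_continuousAt_nome ha hs hb).mul
      (h.siteTip_continuousAt_nome (s * 2 * a * lam) u)).congr ?_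
    filter_upwards [eventually_nome] with p hp
    obtain ⟨r, e, k, c, hg⟩ := h.exists_isGauge hp
    rw [Pi.mul_apply, hg.csqrt_siteRatio ha hs, hg.faceWeight_tip' ha hs]
  · intro a s hs ha hb
    refine (step (min a (a + s))).congr ?_
    filter_upwards [eventually_nome] with p hp
    obtain ⟨r, e, k, c, hg⟩ := h.exists_isGauge hp
    rw [hg.csqrt_theta4, hg.faceWeight_step a hs]
  · intro a s hs ha hb
    refine (step (min a (a + s))).congr ?_
    filter_upwards [eventually_nome] with p hp
    obtain ⟨r, e, k, c, hg⟩ := h.exists_isGauge hp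
    rw [hg.csqrt_theta4, hg.faceWeight_step' a hs]
  · intro a s hs _ _ _
    simp only [faceWeight_straight _ _ _ hs]
    exact thetaOdd_mul_div_continuousAt_nome _ _ two three
  · intro a s hs ha hb hb'
    have hs' : -s = 1 ∨ -s = -1 := by omega
    refine (((h.csqrt_siteRatio_continuousAt_nome ha hs hb).mul
      (h.csqrt_siteRatio_continuousAt_nome ha hs' (by rwa [← sub_eq_add_neg]))).neg.mul
      ((thetaOdd_continuousAt_nome u).mul ((thetaOdd_continuousAt_nome (lam - u)).div
        ((thetaOdd_continuousAt_nome _).mul (thetaOdd_continuousAt_nome _))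
        (mul_ne_zero two three)))).congr ?_
    filter_upwards [eventually_nome] with p hp
    obtain ⟨r, e, k, c, hg⟩ := h.exists_isGauge hp
    simp only [Pi.mul_apply, Pi.neg_apply, Pi.div_apply]
    rw [hg.faceWeight_cross ha hs, hg.csqrt_siteRatio ha hs, hg.csqrt_siteRatio ha hs',
      ← sub_eq_add_neg, siteCross]
  · intro a s hs ha _
    simp only [faceWeight_alt _ _ _ hs]
    exact h.siteAlt_continuousAt_nome ha hs u

lemma turnCoeff_continuousAt_nome (h : IsCrossingParameter L lam σ) (hs : s = 1 ∨ s = -1)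
    (ha : a ∈ heights L) (hb : a + s ∈ heights L) :
    ContinuousAt (fun p : ℝ ↦ turnCoeff p lam a (a + s)) 0 := by
  have h1 := ((thetaOdd_div_continuousAt_nome lam (h.two_ne zero_nome)).mul
    ((h.csqrt_siteRatio_continuousAt_nome ha hs hb).mul
      (theta4_div_continuousAt_nome (2 * a * lam + (a - (a + s : ℤ)) * lam)
        (2 * a * lam + (a - a) * lam)))).neg
  refine h1.congr ?_
  filter_upwards [eventually_nome] with p hp
  obtain ⟨r, e, k, c, hg⟩ := h.exists_isGauge hp
  have hk : csqrt k ≠ 0 := by rw [csqrt]; simp [hg.k_ne]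
  have ha' := mem_heights.mp ha
  have hb' := mem_heights.mp hb
  have a0 := hg.r_ne ha
  have ha4 := csqrt_mul_pow_four k (hg.r_pos _ ha)
  have hb4 := csqrt_mul_pow_four k (hg.r_pos _ hb)
  simp only [Pi.mul_apply, Pi.neg_apply]
  rw [turnCoeff, theta1_div, crossing2, crossing2, hg.csqrt_siteRatio ha hs,
    hg.crossing_eq a (by omega) (by omega), hg.crossing_eq (a + s) (by omega) (by omega), ha4, hb4,
    mul_assoc (csqrt k), mul_assoc (csqrt k), mul_div_mul_left _ _ hk, mul_div_mul_comm, div_pow]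

lemma phi20_continuousAt_nome (h : IsCrossingParameter L lam σ) (ha : a ∈ heights L)
    (hb : b ∈ heights L) {α : ℕ} (hα : α ∈ Finset.Icc 1 (fusedAdj20 L a b)) (x : ℤ) :
    ContinuousAt (fun p : ℝ ↦ phi20 L p lam a x b α) 0 := by
  have hL := h.three_le
  have turn : a = b → ContinuousAt (fun p : ℝ ↦ turnCoeff p lam a (indMid20 L a b α)) 0 := by
    rintro rfl
    obtain ⟨⟨-, hy, -, h1, -⟩, h2⟩ := indMid20_spec (by omega) ha ha hα
    rw [min_self] at h2
    have := h.turnCoeff_continuousAt_nome (a := a) (s := indMid20 L a a α - a)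
      (by rw [abs_le] at h1; omega) ha (by simpa using hy)
    simpa using this
  have e : ∀ p, -(theta1 p lam / theta1 p (2 * lam) * (crossing2 p lam (indMid20 L a b α) a
      / crossing2 p lam a a)) = turnCoeff p lam a (indMid20 L a b α) := fun _ ↦ rfl
  simp only [phi20, e]
  clear e
  generalize indMid20 L a b α = y at *
  have hδ : ContinuousAt (fun _ : ℝ ↦ if α = 1 then (1 : ℂ) else 0) 0 := continuousAt_const
  generalize (if α = 1 then (1 : ℂ) else 0) = δ at *
  have step : ContinuousAt (fun p : ℝ ↦ (-csqrt (theta4 p (2 * y * lam + lam)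
      / theta4 p (2 * y * lam - 3 * lam))) ^ (y - x)) 0 := by
    refine ContinuousAt.zpow₀ (csqrt_continuousAt (theta4_div_continuousAt_nome _ _) ?_).neg _
      (Or.inl ?_)
    · simp [theta4_nome_zero]
    · simp [theta4_nome_zero, csqrt]
  have turn' : a = b → ContinuousAt (fun p : ℝ ↦ if a = x then turnCoeff p lam a y else 1) 0 := by
    intro hab
    by_cases hax : a = x
    · simp only [if_pos hax]
      exact turn hab
    · simp only [if_neg hax]
      exact continuousAt_const
  by_cases h1 : ¬IsPath L a x b
  · simp only [if_pos h1]
    exact continuousAt_const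
  simp only [if_neg h1]
  by_cases h2 : |a - b| = 2
  · simp only [if_pos h2]
    exact hδ
  simp only [if_neg h2]
  by_cases h3 : |a - b| = 1
  · simp only [if_pos h3]
    exact step.mul hδ
  simp only [if_neg h3]
  by_cases h4 : a = b ∧ valence L a = 2
  · simp only [if_pos h4]
    exact (turn' h4.1).mul hδ
  simp only [if_neg h4]
  by_cases h5 : a = b ∧ valence L a = 3 ∧ |y - x| < 2
  · simp only [if_pos h5]
    exact turn' h5.1
  simp only [if_neg h5]
  exact continuousAt_const

lemma fusedWeight20_continuousAt_nome (h : IsCrossingParameter L lam σ) (ha : a ∈ heights L)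
    (hb : b ∈ heights L) (hc : c ∈ heights L) (hd : d ∈ heights L) {α β : ℕ}
    (hα : α ∈ Finset.Icc 1 (fusedAdj20 L a b)) (hβ : β ∈ Finset.Icc 1 (fusedAdj20 L d c)) (u : ℂ) :
    ContinuousAt (fun p : ℝ ↦ fusedWeight20 L p lam a b c d α β u) 0 := by
  have hL := h.three_le
  have hm := indMid20_mem (by omega) hd hc hβ
  refine tendsto_finsetSum _ fun x hx ↦ ?_
  exact ((h.phi20_continuousAt_nome ha hb hα x).mul
    (h.faceWeight_continuousAt_nome ha hx hm hd u)).mul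
    (h.faceWeight_continuousAt_nome hx hb hc hm _)

end IsCrossingParameter

end DiluteA

namespace DiluteA

open Filter Topology

/-- Identities between functions of the nome which are continuous at zero hold at zero once they
hold close to it. -/
lemma eq_of_continuousAt_nome {F G : ℝ → ℂ} (hF : ContinuousAt F 0) (hG : ContinuousAt G 0)
    (h : ∀ p, |p| < 1 → p ≠ 0 → F p = G p) : F 0 = G 0 := by
  have h1 : Tendsto F (𝓝[≠] 0) (𝓝 (F 0)) := hF.mono_left nhdsWithin_le_nhds
  have h2 : Tendsto G (𝓝[≠] 0) (𝓝 (G 0)) := hG.mono_left nhdsWithin_le_nhds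
  refine tendsto_nhds_unique (h1.congr' ?_) h2
  filter_upwards [nhdsWithin_le_nhds eventually_nome, self_mem_nhdsWithin] with p hp hp0
  exact h p hp hp0

end DiluteA

theorem mainTheorem6 (L : ℕ) (hL : 3 ≤ L) (p : ℝ) (hp : |p| < 1) (lam : ℝ)
    (hlam : lam = Real.pi / 4 * ((L : ℝ) / ((L : ℝ) + 1)) ∨
      lam = Real.pi / 4 * (((L : ℝ) + 2) / ((L : ℝ) + 1))) :
    -- the bond variables label exactly the independent paths
    (∀ a ∈ DiluteA.heights L, ∀ b ∈ DiluteA.heights L,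
      (DiluteA.indPath20 L a b).length = DiluteA.fusedAdj20 L a b) ∧
    -- the Yang–Baxter equation
    (∀ a ∈ DiluteA.heights L, ∀ b ∈ DiluteA.heights L, ∀ c ∈ DiluteA.heights L,
      ∀ d ∈ DiluteA.heights L, ∀ e ∈ DiluteA.heights L, ∀ f ∈ DiluteA.heights L,
      ∀ α ∈ Finset.Icc 1 (DiluteA.fusedAdj20 L a b),
      ∀ γ ∈ Finset.Icc 1 (DiluteA.fusedAdj20 L e d), ∀ u v : ℂ,
      ∑ g ∈ DiluteA.heights L, ∑ β ∈ Finset.Icc 1 (DiluteA.fusedAdj20 L f g),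
          DiluteA.fusedWeight20 L p lam a b g f α β u
            * DiluteA.fusedWeight20 L p lam f g d e β γ v
            * DiluteA.faceWeight p lam g b c d (v - u)
        = ∑ g ∈ DiluteA.heights L, ∑ β ∈ Finset.Icc 1 (DiluteA.fusedAdj20 L g c),
          DiluteA.faceWeight p lam f a g e (v - u)
            * DiluteA.fusedWeight20 L p lam a b c g α β v
            * DiluteA.fusedWeight20 L p lam g c d e β γ u) ∧
    -- the zeros at `0` and `λ`
    (∀ a ∈ DiluteA.heights L, ∀ b ∈ DiluteA.heights L, ∀ c ∈ DiluteA.heights L,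
      ∀ d ∈ DiluteA.heights L, ∀ α ∈ Finset.Icc 1 (DiluteA.fusedAdj20 L a b),
      ∀ β ∈ Finset.Icc 1 (DiluteA.fusedAdj20 L d c),
      DiluteA.fusedWeight20 L p lam a b c d α β 0 = 0 ∧
        DiluteA.fusedWeight20 L p lam a b c d α β lam = 0) := by
  obtain ⟨σ, h⟩ := DiluteA.exists_isCrossingParameter hL hlam
  refine ⟨fun a ha b hb ↦ DiluteA.length_indPath20 (by omega) ha hb, ?_, ?_⟩
  · intro a ha b hb c hc d hd e he f hf α hα γ hγ u v
    rcases eq_or_ne p 0 with rfl | hp0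
    · refine DiluteA.eq_of_continuousAt_nome
        (F := fun q ↦ ∑ g ∈ DiluteA.heights L, ∑ β ∈ Finset.Icc 1 (DiluteA.fusedAdj20 L f g),
          DiluteA.fusedWeight20 L q lam a b g f α β u
            * DiluteA.fusedWeight20 L q lam f g d e β γ v
            * DiluteA.faceWeight q lam g b c d (v - u))
        (G := fun q ↦ ∑ g ∈ DiluteA.heights L, ∑ β ∈ Finset.Icc 1 (DiluteA.fusedAdj20 L g c),
          DiluteA.faceWeight q lam f a g e (v - u)
            * DiluteA.fusedWeight20 L q lam a b c g α β v
            * DiluteA.fusedWeight20 L q lam g c d e β γ u)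
        (tendsto_finsetSum _ fun g hg ↦
        tendsto_finsetSum _ fun β hβ ↦ ?_) (tendsto_finsetSum _ fun g hg ↦
        tendsto_finsetSum _ fun β hβ ↦ ?_) fun q hq hq0 ↦ ?_
      · exact ((h.fusedWeight20_continuousAt_nome ha hb hg hf hα hβ u).mul
          (h.fusedWeight20_continuousAt_nome hf hg hd he hβ hγ v)).mul
          (h.faceWeight_continuousAt_nome hg hb hc hd (v - u))
      · exact ((h.faceWeight_continuousAt_nome hf ha hg he (v - u)).mul
          (h.fusedWeight20_continuousAt_nome ha hb hc hg hα hβ v)).mul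
          (h.fusedWeight20_continuousAt_nome hg hc hd he hβ hγ u)
      · obtain ⟨t, r, e', k, c', hr⟩ := h.exists_isRegular hq hq0
        exact hr.fusedWeight20_yang_baxter (by omega) ha hb hc hd he hf hα hγ u v
    · obtain ⟨t, r, e', k, c', hr⟩ := h.exists_isRegular hp hp0
      exact hr.fusedWeight20_yang_baxter (by omega) ha hb hc hd he hf hα hγ u v
  · intro a ha b hb c hc d hd α hα β hβ
    rcases eq_or_ne p 0 with rfl | hp0
    · refine ⟨DiluteA.eq_of_continuousAt_nome
        (h.fusedWeight20_continuousAt_nome ha hb hc hd hα hβ 0) (G := fun _ ↦ 0)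
        continuousAt_const fun q hq hq0 ↦ ?_,
        DiluteA.eq_of_continuousAt_nome
        (h.fusedWeight20_continuousAt_nome ha hb hc hd hα hβ lam) (G := fun _ ↦ 0)
        continuousAt_const
          fun q hq hq0 ↦ ?_⟩
      · obtain ⟨t, r, e', k, c', hr⟩ := h.exists_isRegular hq hq0
        exact hr.fusedWeight20_zero (by omega) ha hb hc hd hα hβ
      · obtain ⟨t, r, e', k, c', hr⟩ := h.exists_isRegular hq hq0
        exact hr.fusedWeight20_lam (by omega) ha hb hc hd hα hβ
    · obtain ⟨t, r, e', k, c', hr⟩ := h.exists_isRegular hp hp0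
      exact ⟨hr.fusedWeight20_zero (by omega) ha hb hc hd hα hβ,
        hr.fusedWeight20_lam (by omega) ha hb hc hd hα hβ⟩
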